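/- Let $n\in\mathbb N$, $0<\alpha<1$, $\beta>0$ and $F:\mathbb C\to\mathbb C$. For a function $w$ of $t\ge 0$ let $$\partial_t^\alpha w(t)=\frac{d}{dt}\Big(\frac1{\Gamma(1-\alpha)}\int_0^t(t-\tau)^{-\alpha}\,(w(\tau)-w(0))\,d\tau\Big)$$ be its Caputo derivative, let $(-\Delta)^s$ be the Fourier multiplier with symbol $|\xi|^{2s}$ (for the Fourier transform for which $-\Delta$ has symbol $|\xi|^2$), and consider the Cauchy problem $$i\,\partial_t^\alpha u-(-\Delta)^\beta u+F(u)=0\quad (x\in\mathbb R^n,\ t>0),\qquad u(0)=u_0 .\tag{1}$$ For $T>0$, $1\le q\le\infty$ and $u_0\in L^2(\mathbb R^n)$, a *weak solution of (1) on $[0,T)$ of class $q$* is a function $u\in C([0,T);L^2(\mathbb R^n))$ with $u(0)=u_0$ and $F(u)\in L^q_{\rm loc}([0,T);L^2(\mathbb R^n))$ such that for every $\varphi\in H^{2\beta}(\mathbb R^n)$ the function $t\mapsto\langle\varphi,u(t)\rangle$ has a Caputo derivative in $L^1_{\rm loc}([0,T))$ (the outer $d/dt$ in the weak sense: the function being differentiated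 is the primitive, vanishing at $0$, of this derivative) and $$i\,\partial_t^\alpha\langle\varphi,u(t)\rangle-\langle(-\Delta)^\beta\varphi,u(t)\rangle+\langle\varphi,F(u(t))\rangle=0\quad\text{for a.e. }t\in(0,T),$$ where $\langle\varphi,v\rangle=\int_{\mathbb R^n}\overline{\varphi}\,v\,dx$. (a) Suppose that $\operatorname{Im}(\overline zF(z))=0$ for all $z\in\mathbb C$. Then for every $T>0$ and $u_0\in L^2(\mathbb R^n)$, every weak solution $u$ of (1) on $[0,T)$ of class $q=1$ satisfies $$\|u(t)\|_{L^2}\le\|u_0\|_{L^2}\qquad(0\le t<T).$$ (b) Let $G:\mathbb C\to[0,\infty)$ be continuous, and suppose that $\operatorname{Re}\big(F(v)\,\partial_t^\alpha\overline v\big)\lesssim-\partial_t^\alpha G(v)$ for all complex functions $v$ of time; that is, there is a constant $C>0$ such that for every continuous $v:[0,\infty)\to\mathbb C$ and every $t>0$ at which $\partial_t^\alpha v(t)$ and $\partial_t^\alpha (G\circ v)(t)$ both exist, $$\operatorname{Re}\big(F(v(t))\,\overline{\partial_t^\alpha v(t)}\big)\le -C\,\partial_t^\alpha (G\circ v)(t).$$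 Then there is a constant $K>0$, independent of $T$, $u_0$, $u$ and $t$, such that for every $T>0$, every $u_0\in H^{\beta/2}(\mathbb R^n)$ with $\int_{\mathbb R^n}G(u_0)\,dx<\infty$, and every weak solution $u$ of (1) on $[0,T)$ of class $q=2$, $$\big\|(-\Delta)^{\beta/2}u(t)\big\|_{L^2}^2+\int_{\mathbb R^n}G(u(t))\,dx\le K\Big(\big\|(-\Delta)^{\beta/2}u_0\big\|_{L^2}^2+\int_{\mathbb R^n}G(u_0)\,dx\Big)\qquad(0\le t<T).$$ Here $\|(-\Delta)^{\beta/2}f\|_{L^2}=\infty$ if $(-\Delta)^{\beta/2}f\notin L^2$; in particular, if the right-hand side is finite, so is the left-hand side. -/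

import Mathlib

open MeasureTheory Set FourierTransform
open scoped ENNReal NNReal SchwartzMap

noncomputable section

/-- The complex Hilbert space `L²(ℝⁿ)`. -/
abbrev L2 (n : ℕ) : Type := Lp ℂ 2 (volume : Measure (EuclideanSpace ℝ (Fin n)))

/-- `s ↦ Γ(1-α)⁻¹ ∫₀ˢ (s-τ)^(-α) (w(τ) - w(0)) dτ`; its derivative is the Caputo derivative of
order `α ∈ (0,1)` of `w`. -/
def caputoIntegral {E : Type*} [NormedAddCommGroup E] [NormedSpace ℝ E]
    (α : ℝ) (w : ℝ → E) (s : ℝ) : E :=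
  (1 / Real.Gamma (1 - α)) • ∫ τ in (0 : ℝ)..s, (s - τ) ^ (-α) • (w τ - w 0)

/-- The Caputo derivative `∂_t^α w` exists at the time `t` and equals `d`. -/
def HasCaputoDerivAt {E : Type*} [NormedAddCommGroup E] [NormedSpace ℝ E]
    (α : ℝ) (w : ℝ → E) (d : E) (t : ℝ) : Prop :=
  HasDerivAt (caputoIntegral α w) d t

/-- `d` is the Caputo derivative `∂_t^α w` of `w` on `[0,T)`, the outer time derivative being taken
in the weak sense: `d` is locally integrable on `[0,T)`, and `caputoIntegral α w` (which vanishes at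
time `0`) is the primitive of `d`. -/
def IsCaputoDerivOn (α T : ℝ) (w d : ℝ → ℂ) : Prop :=
  ∀ t ∈ Ico 0 T, IntervalIntegrable d volume 0 t ∧
    caputoIntegral α w t = ∫ τ in (0 : ℝ)..t, d τ

/-- The Fourier symbol of `(-Δ)^s`: `(2π|ξ|)^(2s)`. The factor `2π` belongs to the normalization
`𝓕 f ξ = ∫ exp(-2πi x·ξ) f x dx`, for which `-Δ` has the symbol `(2π|ξ|)²`. -/
def fracLaplaceSymbol {n : ℕ} (s : ℝ) (ξ : EuclideanSpace ℝ (Fin n)) : ℝ :=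
  (2 * Real.pi * ‖ξ‖) ^ (2 * s)

/-- `f ∈ L²(ℝⁿ)` lies in the domain of `(-Δ)^s` (that is `H^{2s}` for `s ≥ 0`), and
`(-Δ)^s f = g`. -/
def IsFracLaplacian {n : ℕ} (s : ℝ) (f g : L2 n) : Prop :=
  ∀ᵐ ξ, (𝓕 g : L2 n) ξ = (fracLaplaceSymbol s ξ : ℂ) * (𝓕 f : L2 n) ξ

/-- `‖(-Δ)^s f‖²` in `L²(ℝⁿ)`, computed by Plancherel; it is `∞` when `(-Δ)^s f ∉ L²`. -/
def fracLaplaceNormSq {n : ℕ} (s : ℝ) (f : L2 n) : ℝ≥0∞ :=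
  ∫⁻ ξ, ‖(fracLaplaceSymbol s ξ : ℂ) * (𝓕 f : L2 n) ξ‖ₑ ^ 2

/-- `∫ G(f(x)) dx ∈ [0,∞]`, for `G ≥ 0`. -/
def potentialEnergy {n : ℕ} (G : ℂ → ℝ) (f : L2 n) : ℝ≥0∞ :=
  ∫⁻ x, ENNReal.ofReal (G (f x))

/-- The energy `I(f) = ‖(-Δ)^{β/2} f‖² + ∫ G(f(x)) dx ∈ [0,∞]`. -/
def energy {n : ℕ} (β : ℝ) (G : ℂ → ℝ) (f : L2 n) : ℝ≥0∞ :=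
  fracLaplaceNormSq (β / 2) f + potentialEnergy G f

/-- `u ∈ C([0,T); L²)` is a weak solution of
`i ∂_t^α u - (-Δ)^β u + F(u) = 0`, `u(0) = u₀`, with `F(u) ∈ L^q_loc([0,T); L²)`.
The equation holds weakly in space: it is tested against every `φ` in the domain `H^{2β}` of
`(-Δ)^β`, and `(-Δ)^β` is moved to `φ`. (`inner ℂ φ v = ∫ conj(φ) v`.) -/
structure IsWeakSolution {n : ℕ} (α β : ℝ) (F : ℂ → ℂ) (q : ℝ≥0∞) (T : ℝ)
    (u₀ : L2 n) (u : ℝ → L2 n) : Prop where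
  continuousOn : ContinuousOn u (Ico 0 T)
  initial : u 0 = u₀
  equation : ∃ N : ℝ → L2 n,
    (∀ᵐ t, t ∈ Ioo 0 T → (N t : EuclideanSpace ℝ (Fin n) → ℂ) =ᵐ[volume] fun x => F (u t x)) ∧
    (∀ T' < T, MemLp N q (volume.restrict (Ioo 0 T'))) ∧
    ∀ φ ψ : L2 n, IsFracLaplacian β φ ψ →
      ∃ d : ℝ → ℂ, IsCaputoDerivOn α T (fun t => inner ℂ φ (u t)) d ∧
        ∀ᵐ t, t ∈ Ioo 0 T →
          Complex.I * d t - inner ℂ ψ (u t) + inner ℂ φ (N t) = 0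

/-- `Re (F(v) ∂_t^α v̄) ≲ -∂_t^α G(v)` for all complex functions `v` of time: there is a constant
`C > 0` such that the inequality `Re (F(v) ∂_t^α v̄) ≤ -C ∂_t^α G(v)` holds for all continuous
`v : [0,∞) → ℂ`, at every time `t > 0` at which both Caputo derivatives exist. -/
def EnergyHypothesis (α : ℝ) (F : ℂ → ℂ) (G : ℂ → ℝ) : Prop :=
  ∃ C : ℝ, 0 < C ∧ ∀ v : ℝ → ℂ, ContinuousOn v (Ici 0) → ∀ t : ℝ, 0 < t →
    ∀ (d : ℂ) (g : ℝ), HasCaputoDerivAt α v d t → HasCaputoDerivAt α (fun τ => G (v τ)) g t →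
      (F (v t) * (starRingEnd ℂ) d).re ≤ C * (-g)

end

/-! Write g_a(t) = t^(a-1)/Γ(a) and `*` for causal convolution in time. Since g_α * g_(1-α) = 1, a
function v = u - u₀ with Caputo derivative d satisfies v = g_α * d (`ae_eq_causalConv_of_caputo`).
On the Fourier side let U, V be the transforms of u, F(u) and let A be multiplication by the symbol
of (-Δ)^β; formally d = -i(AU - V).

Both parts rest on one chain inequality for convex functionals (`le_causalConv_re_inner`): if ξ(t)
is a subgradient of E at U(t), then E(U(t)) - E(U₀) ≤ (g_α * Re⟨ξ, d⟩)(t). It is elementary for the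
truncated Marchaud derivative, whose memory kernel is nonnegative. Applied to g_α * d that
derivative becomes ψ_ε * d, with ψ_ε an approximate identity, and letting ε tend to 0 removes the
truncation.

(a) Take E = ‖·‖²/2 and ξ = U. Then Re⟨U, d⟩ = -Im⟨U, V⟩ = 0, because ⟨U, AU⟩ is real and Im(conj(z)
F(z)) = 0. As AU need not exist, frequencies are cut off at symbol ≤ R; the remaining term -Im⟨P_R
U, V⟩ tends to 0 in L¹ in time.

(b) Testing the differential inequality on functions that jump almost instantly from b to a and rest
there yields C G(a) - C G(b) ≤ -Re(F(a) conj(a - b)): -F(a) is a subgradient of C G at a. For E =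
½‖(-Δ)^(β/2)·‖² + C∫G the vector ξ = AU - V is then a subgradient, while d = -iξ, so Re⟨ξ, d⟩ = 0
and E does not increase. The constant K only compares the weights 1/2 and C with 1.

In (b) the vector AU must really lie in L²(0,S; L²). This is maximal regularity
(`exists_bound_integral_rlKernel_mul_norm_sq`), proved for the truncations uniformly in R. It uses a
sector property: for a constant κ with Im κ > 0, Re(κ ∫⟨q, g_α * q⟩) ≥ 0. Inserting the equation,
the term i‖d‖² is turned by κ into -(Im κ)‖d‖², which bounds d; Fatou's lemma then removes the
truncation. -/

section CausalConvolution

/-! ### Causal convolution on a bounded time interval. -/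

open Filter Topology ContinuousLinearMap

variable {E : Type*} [NormedAddCommGroup E] [NormedSpace ℝ E]

/-- The causal convolution `t ↦ ∫₀ᵗ a(t-τ) b(τ) dτ` of a real kernel with a vector function. -/
noncomputable def causalConv (a : ℝ → ℝ) (b : ℝ → E) (t : ℝ) : E :=
  ∫ τ in (0 : ℝ)..t, a (t - τ) • b τ

/-- For times before S the cut-offs of both factors to (0,S) leave exactly the range 0 < τ < t. Thus
causal convolution becomes convolution of integrable functions on the whole line. -/
theorem indicator_smul_indicator_sub {S t : ℝ} (ht : t ∈ Ioo 0 S) (a : ℝ → ℝ) (b : ℝ → E) :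
    (fun τ => (Ioo 0 S).indicator a (t - τ) • (Ioo 0 S).indicator b τ) =
      (Ioo 0 t).indicator fun τ => a (t - τ) • b τ := by
  ext τ
  by_cases h : τ ∈ Ioo 0 t
  · rw [indicator_of_mem h, indicator_of_mem, indicator_of_mem]
    · exact ⟨h.1, h.2.trans ht.2⟩
    · exact ⟨by linarith [h.2], by linarith [h.1, ht.2]⟩
  · rw [indicator_of_notMem h]
    by_cases h0 : 0 < τ
    · rw [indicator_of_notMem (a := t - τ), zero_smul]
      exact fun h1 => h ⟨h0, by linarith [h1.1]⟩
    · rw [indicator_of_notMem (a := τ), smul_zero]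
      exact fun h1 => h0 h1.1

theorem causalConv_eq_integral_indicator {S t : ℝ} (ht : t ∈ Ioo 0 S) (a : ℝ → ℝ) (b : ℝ → E) :
    causalConv a b t = ∫ τ, (Ioo 0 S).indicator a (t - τ) • (Ioo 0 S).indicator b τ := by
  rw [indicator_smul_indicator_sub ht, integral_indicator measurableSet_Ioo, causalConv,
    intervalIntegral.integral_of_le ht.1.le, integral_Ioc_eq_integral_Ioo]

theorem causalConv_eq_convolution {S t : ℝ} (ht : t ∈ Ioo 0 S) (a : ℝ → ℝ) (b : ℝ → E) :
    causalConv a b t =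
      convolution ((Ioo 0 S).indicator a) ((Ioo 0 S).indicator b) (lsmul ℝ ℝ) volume t := by
  rw [causalConv_eq_integral_indicator ht, convolution_def,
    ← integral_sub_left_eq_self _ volume t]
  simp

theorem convolution_indicator_of_nonpos {S t : ℝ} (ht : t ≤ 0) (a : ℝ → ℝ) (b : ℝ → E) :
    convolution ((Ioo 0 S).indicator a) ((Ioo 0 S).indicator b) (lsmul ℝ ℝ) volume t = 0 := by
  rw [convolution_def]
  refine integral_eq_zero_of_ae (.of_forall fun s => ?_)
  by_cases hs : s ∈ Ioo 0 S
  · have : t - s ∉ Ioo 0 S := fun h => by linarith [h.1, hs.1]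
    simp [indicator_of_notMem this]
  · simp [indicator_of_notMem hs]

theorem causalConv_congr_ae {S t : ℝ} (ht : t ∈ Ioo 0 S) (a : ℝ → ℝ) {b b' : ℝ → E}
    (h : b =ᵐ[volume.restrict (Ioo 0 S)] b') : causalConv a b t = causalConv a b' t := by
  rw [causalConv, causalConv, intervalIntegral.integral_of_le ht.1.le,
    intervalIntegral.integral_of_le ht.1.le, integral_Ioc_eq_integral_Ioo,
    integral_Ioc_eq_integral_Ioo]
  refine integral_congr_ae ?_
  filter_upwards [ae_restrict_of_ae_restrict_of_subset (Ioo_subset_Ioo_right ht.2.le) h] with τ hτ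
  simp [hτ]

theorem causalConv_congr_ae_left {S t : ℝ} (ht : t ∈ Ioo 0 S) {a a' : ℝ → ℝ} (b : ℝ → E)
    (h : a =ᵐ[volume.restrict (Ioo 0 S)] a') : causalConv a b t = causalConv a' b t := by
  rw [causalConv_eq_convolution ht, causalConv_eq_convolution ht]
  have : (Ioo 0 S).indicator a =ᵐ[volume] (Ioo 0 S).indicator a' := by
    filter_upwards [(ae_restrict_iff' measurableSet_Ioo).1 h] with s hs
    by_cases h' : s ∈ Ioo 0 S
    · simp [h', hs h']
    · simp [h']
  rw [convolution_def, convolution_def]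
  refine integral_congr_ae ?_
  filter_upwards [this] with s hs
  simp [hs]

theorem ae_intervalIntegrable_causalConv {S : ℝ} {a : ℝ → ℝ} {b : ℝ → E}
    (ha : IntegrableOn a (Ioo 0 S)) (hb : IntegrableOn b (Ioo 0 S)) :
    ∀ᵐ t ∂volume.restrict (Ioo 0 S),
      IntervalIntegrable (fun τ => a (t - τ) • b τ) volume 0 t := by
  rw [← integrable_indicator_iff measurableSet_Ioo] at ha hb
  filter_upwards [ae_restrict_of_ae (ha.ae_convolution_exists (lsmul ℝ ℝ) hb),
    ae_restrict_mem measurableSet_Ioo] with t h ht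
  have h2 := h.integrable_swap
  rw [intervalIntegrable_iff_integrableOn_Ioo_of_le ht.1.le, ← integrable_indicator_iff
    measurableSet_Ioo, ← indicator_smul_indicator_sub ht]
  simpa using h2

theorem integrableOn_causalConv {S : ℝ} {a : ℝ → ℝ} {b : ℝ → E}
    (ha : IntegrableOn a (Ioo 0 S)) (hb : IntegrableOn b (Ioo 0 S)) :
    IntegrableOn (causalConv a b) (Ioo 0 S) := by
  rw [← integrable_indicator_iff measurableSet_Ioo] at ha hb
  exact ((ha.integrable_convolution (lsmul ℝ ℝ) hb).integrableOn (s := Ioo 0 S)).congr_fun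
    (fun t ht => (causalConv_eq_convolution ht a b).symm) measurableSet_Ioo

theorem convolution_indicator_causalConv {S t : ℝ} (ht : t ∈ Ioo 0 S) {a b : ℝ → ℝ} (h : ℝ → E) :
    causalConv (causalConv a b) h t = convolution
      (convolution ((Ioo 0 S).indicator a) ((Ioo 0 S).indicator b) (lsmul ℝ ℝ) volume)
      ((Ioo 0 S).indicator h) (lsmul ℝ ℝ) volume t := by
  rw [causalConv_eq_convolution ht, convolution_def, convolution_def]
  congr 1; ext s
  by_cases hs : s ∈ Ioo 0 S
  · rw [indicator_of_mem hs, causalConv_eq_convolution hs]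
  · rw [indicator_of_notMem hs]
    rcases le_or_gt s 0 with h0 | h0
    · rw [convolution_indicator_of_nonpos h0]
    · have : t - s ∉ Ioo 0 S := fun h1 => hs ⟨h0, by linarith [h1.1, ht.2]⟩
      simp [indicator_of_notMem this]

theorem convolution_causalConv_indicator {S t : ℝ} (ht : t ∈ Ioo 0 S) {a b : ℝ → ℝ} (h : ℝ → E) :
    causalConv a (causalConv b h) t = convolution ((Ioo 0 S).indicator a)
      (convolution ((Ioo 0 S).indicator b) ((Ioo 0 S).indicator h) (lsmul ℝ ℝ) volume)
      (lsmul ℝ ℝ) volume t := by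
  rw [causalConv_eq_convolution ht, convolution_def, convolution_def]
  congr 1; ext s
  by_cases hs : t - s ∈ Ioo 0 S
  · rw [indicator_of_mem hs, causalConv_eq_convolution hs]
  · rw [indicator_of_notMem hs]
    rcases le_or_gt (t - s) 0 with h0 | h0
    · rw [convolution_indicator_of_nonpos h0]
    · have : s ∉ Ioo 0 S := fun h1 => hs ⟨h0, by linarith [h1.1, ht.2]⟩
      simp [indicator_of_notMem this]

/-- Causal convolution is associative. -/
theorem causalConv_assoc [CompleteSpace E] {S : ℝ} {a b : ℝ → ℝ} {h : ℝ → E}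
    (ha : IntegrableOn a (Ioo 0 S)) (hb : IntegrableOn b (Ioo 0 S))
    (hh : IntegrableOn h (Ioo 0 S)) :
    ∀ᵐ t ∂volume.restrict (Ioo 0 S),
      causalConv (causalConv a b) h t = causalConv a (causalConv b h) t := by
  rw [← integrable_indicator_iff measurableSet_Ioo] at ha hb hh
  -- The exchange of integrals at time t needs the triple convolution of the norms to exist there,
  -- which is guaranteed only for almost every t.
  filter_upwards [ae_restrict_mem measurableSet_Ioo, ae_restrict_of_ae
    (ha.norm.ae_convolution_exists (mul ℝ ℝ)
      (hb.norm.integrable_convolution (mul ℝ ℝ) hh.norm))] with t ht h1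
  rw [convolution_indicator_causalConv ht, convolution_causalConv_indicator ht]
  refine convolution_assoc (lsmul ℝ ℝ) (lsmul ℝ ℝ) (lsmul ℝ ℝ) (lsmul ℝ ℝ) ?_ ha.1 hb.1 hh.1
    (ha.ae_convolution_exists _ hb) (hb.norm.ae_convolution_exists _ hh.norm) h1
  exact fun x y z => smul_assoc x y z

theorem causalConv_comm (a b : ℝ → ℝ) (t : ℝ) : causalConv a b t = causalConv b a t := by
  have := intervalIntegral.integral_comp_sub_left (a := 0) (b := t) (fun τ => b (t - τ) • a τ) t
  simpa [causalConv, mul_comm] using this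

theorem causalConv_one (b : ℝ → E) (t : ℝ) : causalConv (fun _ => 1) b t = ∫ τ in (0 : ℝ)..t, b τ := by
  simp [causalConv]

theorem causalConv_const_smul (a : ℝ → ℝ) (c : ℝ) (b : ℝ → E) (t : ℝ) :
    causalConv (fun s => c * a s) b t = c • causalConv a b t := by
  simp [causalConv, mul_smul, intervalIntegral.integral_smul]

theorem causalConv_clm {F : Type*} [NormedAddCommGroup F] [NormedSpace ℝ F] [CompleteSpace E]
    [CompleteSpace F] (L : E →L[ℝ] F)
    {a : ℝ → ℝ} {b : ℝ → E} {t : ℝ}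
    (h : IntervalIntegrable (fun τ => a (t - τ) • b τ) volume 0 t) :
    causalConv a (fun τ => L (b τ)) t = L (causalConv a b t) := by
  rw [causalConv, causalConv, ← L.intervalIntegral_comp_comm h]
  simp

theorem enorm_causalConv_le {S t : ℝ} (ht : t ∈ Ioo 0 S) (a : ℝ → ℝ) (b : ℝ → E) :
    ‖causalConv a b t‖ₑ ≤
      ∫⁻ τ, ‖(Ioo 0 S).indicator a (t - τ)‖ₑ * ‖(Ioo 0 S).indicator b τ‖ₑ := by
  rw [causalConv_eq_integral_indicator ht]
  refine (enorm_integral_le_lintegral_enorm _).trans (le_of_eq ?_)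
  simp [enorm_smul]

/-- Young's inequality in L¹, by Tonelli and translation invariance. It carries L¹ limits through
convolution with g_α. -/
theorem lintegral_enorm_causalConv_le {S : ℝ} {a : ℝ → ℝ} {b : ℝ → E}
    (ha : IntegrableOn a (Ioo 0 S)) (hb : IntegrableOn b (Ioo 0 S)) :
    ∫⁻ t in Ioo 0 S, ‖causalConv a b t‖ₑ ≤
      (∫⁻ t in Ioo 0 S, ‖a t‖ₑ) * ∫⁻ t in Ioo 0 S, ‖b t‖ₑ := by
  have ha' := (integrable_indicator_iff measurableSet_Ioo).2 ha
  have hb' := (integrable_indicator_iff measurableSet_Ioo).2 hb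
  calc ∫⁻ t in Ioo 0 S, ‖causalConv a b t‖ₑ
      ≤ ∫⁻ t in Ioo 0 S, ∫⁻ τ, ‖(Ioo 0 S).indicator a (t - τ)‖ₑ * ‖(Ioo 0 S).indicator b τ‖ₑ :=
        setLIntegral_mono' measurableSet_Ioo fun t ht => enorm_causalConv_le ht a b
    _ ≤ ∫⁻ t, ∫⁻ τ, ‖(Ioo 0 S).indicator a (t - τ)‖ₑ * ‖(Ioo 0 S).indicator b τ‖ₑ :=
        setLIntegral_le_lintegral _ _
    _ = ∫⁻ τ, ∫⁻ t, ‖(Ioo 0 S).indicator a (t - τ)‖ₑ * ‖(Ioo 0 S).indicator b τ‖ₑ := by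
        refine lintegral_lintegral_swap ?_
        have := (hb'.1.convolution_integrand (lsmul ℝ ℝ).flip ha'.1).enorm
        simpa [Function.uncurry_def, enorm_smul] using this
    _ = ∫⁻ τ, (∫⁻ t, ‖(Ioo 0 S).indicator a t‖ₑ) * ‖(Ioo 0 S).indicator b τ‖ₑ := by
        refine lintegral_congr fun τ => ?_
        rw [lintegral_mul_const' _ _ enorm_ne_top,
          lintegral_sub_right_eq_self (fun t => ‖(Ioo 0 S).indicator a t‖ₑ)]
    _ = (∫⁻ t, ‖(Ioo 0 S).indicator a t‖ₑ) * ∫⁻ τ, ‖(Ioo 0 S).indicator b τ‖ₑ :=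
        lintegral_const_mul'' _ hb'.1.enorm
    _ = _ := by
        simp_rw [enorm_indicator_eq_indicator_enorm]
        rw [lintegral_indicator measurableSet_Ioo, lintegral_indicator measurableSet_Ioo]

end CausalConvolution

/-! ### Approximate identities in Lᵖ with vector values. -/

section ApproximateIdentity

open Filter Topology ContinuousLinearMap

variable {ι : Type*} {l : Filter ι} {S : ℝ}

/-- Near 0 the weight W is small and the mass at most one; away from 0 the weight is bounded and the
remaining mass is at most 1 minus the mass near 0, which vanishes in the limit. -/
theorem tendsto_lintegral_mul_of_concentrating (hS : 0 < S) {Ψ : ι → ℝ → ℝ≥0∞}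
    (hm : ∀ i, AEMeasurable (Ψ i) (volume.restrict (Ioo 0 S)))
    (hmass : ∀ i, ∫⁻ s in Ioo 0 S, Ψ i s ≤ 1)
    (hlim : ∀ δ ∈ Ioo 0 S, Tendsto (fun i => ∫⁻ s in Ioo 0 δ, Ψ i s) l (𝓝 1))
    {W : ℝ → ℝ≥0∞} {K : ℝ≥0∞} (hK : K ≠ ∞) (hW : ∀ s, W s ≤ K) (hW0 : Tendsto W (𝓝 0) (𝓝 0)) :
    Tendsto (fun i => ∫⁻ s in Ioo 0 S, Ψ i s * W s) l (𝓝 0) := by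
  rw [ENNReal.tendsto_nhds_zero] at hW0 ⊢
  intro ε hε
  obtain ⟨δ, hδ0, hδ⟩ := Metric.eventually_nhds_iff.1
    (hW0 (ε / 2) (ENNReal.half_pos hε.ne'))
  set δ' := min (δ / 2) (S / 2)
  have hδ' : δ' ∈ Ioo 0 S := ⟨by positivity, (min_le_right _ _).trans_lt (by linarith)⟩
  have hsub : Ioo 0 S = Ioo 0 δ' ∪ Ico δ' S := (Ioo_union_Ico_eq_Ioo hδ'.1 hδ'.2.le).symm
  have hdisj : Disjoint (Ioo 0 δ') (Ico δ' S) := by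
    rw [Set.disjoint_left]; exact fun x hx hy => absurd hx.2 (not_lt.2 hy.1)
  have hsplit : ∀ f : ℝ → ℝ≥0∞, ∫⁻ s in Ioo 0 S, f s = (∫⁻ s in Ioo 0 δ', f s) + ∫⁻ s in Ico δ' S, f s := by
    intro f; rw [hsub, lintegral_union measurableSet_Ico hdisj]
  have htail : Tendsto (fun i => K * (1 - ∫⁻ s in Ioo 0 δ', Ψ i s)) l (𝓝 0) := by
    have := ENNReal.Tendsto.const_mul (a := K)
      (ENNReal.Tendsto.sub tendsto_const_nhds (hlim δ' hδ') (Or.inl ENNReal.one_ne_top))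
      (Or.inr hK)
    simpa using this
  filter_upwards [ENNReal.tendsto_nhds_zero.1 htail (ε / 2) (ENNReal.half_pos hε.ne')] with i hi
  have h1 : ∫⁻ s in Ioo 0 δ', Ψ i s * W s ≤ ε / 2 := by
    calc ∫⁻ s in Ioo 0 δ', Ψ i s * W s ≤ ∫⁻ s in Ioo 0 δ', Ψ i s * (ε / 2) := by
          refine setLIntegral_mono' measurableSet_Ioo fun s hs => ?_
          gcongr
          refine hδ ?_
          rw [Real.dist_eq, sub_zero, abs_of_pos hs.1]
          exact hs.2.trans_le ((min_le_left _ _).trans (by linarith))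
      _ = (∫⁻ s in Ioo 0 δ', Ψ i s) * (ε / 2) := by
          refine lintegral_mul_const'' _ ((hm i).mono_measure ?_)
          exact Measure.restrict_mono (Ioo_subset_Ioo_right hδ'.2.le) le_rfl
      _ ≤ 1 * (ε / 2) := by
          gcongr
          exact (lintegral_mono_set (Ioo_subset_Ioo_right hδ'.2.le)).trans (hmass i)
      _ = ε / 2 := one_mul _
  have h2 : ∫⁻ s in Ico δ' S, Ψ i s * W s ≤ ε / 2 := by
    calc ∫⁻ s in Ico δ' S, Ψ i s * W s ≤ ∫⁻ s in Ico δ' S, K * Ψ i s := by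
          refine lintegral_mono fun s => ?_
          rw [mul_comm K]
          exact mul_le_mul_right (hW s) _
      _ = K * ∫⁻ s in Ico δ' S, Ψ i s := lintegral_const_mul' _ _ hK
      _ ≤ K * (1 - ∫⁻ s in Ioo 0 δ', Ψ i s) := by
          gcongr
          refine ENNReal.le_sub_of_add_le_left ?_ ?_
          · exact ((lintegral_mono_set (Ioo_subset_Ioo_right hδ'.2.le)).trans (hmass i)).trans_lt
              ENNReal.one_lt_top |>.ne
          · rw [← hsplit]; exact hmass i
      _ ≤ ε / 2 := hi
  rw [hsplit]
  exact (add_le_add h1 h2).trans (ENNReal.add_halves ε).le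

/-- Jensen's inequality for a weight of mass at most one: Hölder after the splitting Ψ = Ψ^(1/p)
Ψ^(1/p'). -/
theorem lintegral_mul_rpow_le {X : Type*} [MeasurableSpace X] {μ : Measure X} {Ψ x : X → ℝ≥0∞}
    (hΨ : AEMeasurable Ψ μ) (hx : AEMeasurable x μ) (hmass : ∫⁻ s, Ψ s ∂μ ≤ 1) {p : ℝ}
    (hp : 1 ≤ p) : (∫⁻ s, Ψ s * x s ∂μ) ^ p ≤ ∫⁻ s, Ψ s * x s ^ p ∂μ := by
  rcases hp.eq_or_lt with rfl | hp
  · simp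
  have hpq := Real.HolderConjugate.conjExponent hp
  have h := ENNReal.lintegral_mul_le_Lp_mul_Lq μ hpq
    (f := fun s => Ψ s ^ (1 / p) * x s) (g := fun s => Ψ s ^ (1 / p.conjExponent))
    ((hΨ.pow_const _).mul hx) (hΨ.pow_const _)
  have h1 : ∀ s, Ψ s ^ (1 / p) * x s * Ψ s ^ (1 / p.conjExponent) = Ψ s * x s := by
    intro s
    rw [mul_right_comm, ← ENNReal.rpow_add_of_nonneg _ _ (by positivity)
      (by have := hpq.symm.pos; positivity)]
    have : 1 / p + 1 / p.conjExponent = 1 := by simpa using hpq.inv_add_inv_eq_one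
    rw [this, ENNReal.rpow_one]
  have h2 : ∀ s, (Ψ s ^ (1 / p) * x s) ^ p = Ψ s * x s ^ p := by
    intro s
    rw [ENNReal.mul_rpow_of_nonneg _ _ (by positivity), ← ENNReal.rpow_mul,
      one_div_mul_cancel (by positivity), ENNReal.rpow_one]
  have h3 : ∀ s, (Ψ s ^ (1 / p.conjExponent)) ^ p.conjExponent = Ψ s := by
    intro s
    rw [← ENNReal.rpow_mul, one_div_mul_cancel hpq.symm.pos.ne', ENNReal.rpow_one]
  simp only [Pi.mul_apply, h1, h2, h3] at h
  have h4 : ∫⁻ s, Ψ s * x s ∂μ ≤ (∫⁻ s, Ψ s * x s ^ p ∂μ) ^ (1 / p) := by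
    refine h.trans (mul_le_of_le_one_right' ?_)
    exact ENNReal.rpow_le_one hmass (by have := hpq.symm.pos; positivity)
  calc (∫⁻ s, Ψ s * x s ∂μ) ^ p ≤ ((∫⁻ s, Ψ s * x s ^ p ∂μ) ^ (1 / p)) ^ p := by gcongr
    _ = _ := by rw [← ENNReal.rpow_mul, one_div_mul_cancel (by positivity), ENNReal.rpow_one]

variable {E : Type*} [NormedAddCommGroup E]

theorem tendsto_eLpNorm_translation_sub {p : ℝ≥0∞} (hp1 : 1 ≤ p) (hp : p ≠ ∞) {d : ℝ → E}
    (hd : MemLp d p volume) :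
    Tendsto (fun s => eLpNorm (fun t => d (t - s) - d t) p volume) (𝓝 0) (𝓝 0) := by
  have : Fact (1 ≤ p) := ⟨hp1⟩
  have hmp : ∀ s : ℝ, MeasurePreserving (fun t : ℝ => t - s) volume volume :=
    fun s => measurePreserving_sub_right volume s
  let G : C(ℝ × ℝ, ℝ) := ⟨fun q => q.2 - q.1, by fun_prop⟩
  have hG : Continuous (fun s : ℝ => G.curry s) := G.curry.continuous
  have h := Filter.Tendsto.compMeasurePreservingLp (μ := volume) (ν := volume)
    (f := fun _ : ℝ => hd.toLp d) (tendsto_const_nhds (x := hd.toLp d))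
    (hG.tendsto 0) (fun s => hmp s) (hmp 0) hp
  rw [Lp.tendsto_Lp_iff_tendsto_eLpNorm'] at h
  refine h.congr fun s => eLpNorm_congr_ae ?_
  have h0 : ∀ s, (Lp.compMeasurePreserving (G.curry s) (hmp s) (hd.toLp d) : ℝ → E) =ᵐ[volume]
      fun t => d (t - s) := fun s =>
    (Lp.coeFn_compMeasurePreserving _ (hmp s)).trans
      ((hmp s).quasiMeasurePreserving.ae_eq_comp hd.coeFn_toLp)
  filter_upwards [h0 s, h0 0] with t h1 h2
  simp only [Pi.sub_apply]
  rw [h1, h2, sub_zero]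

end ApproximateIdentity

section ApproximateIdentity

open Filter Topology ContinuousLinearMap

variable {ι : Type*} {l : Filter ι} {S : ℝ}
variable {E : Type*} [NormedAddCommGroup E] [NormedSpace ℝ E] [CompleteSpace E]

/-- The first term averages translation differences of d; the second accounts for the mass of ψ that
is missing on (0,S). -/
theorem enorm_causalConv_sub_le {ψ : ℝ → ℝ} (hψ0 : ∀ s ∈ Ioo 0 S, 0 ≤ ψ s)
    (hψ : IntegrableOn ψ (Ioo 0 S)) (hmass : ∫⁻ s in Ioo 0 S, ENNReal.ofReal (ψ s) ≤ 1)
    {d : ℝ → E} {t : ℝ} (ht : t ∈ Ioo 0 S)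
    (hi : IntervalIntegrable (fun τ => ψ (t - τ) • d τ) volume 0 t) :
    ‖causalConv ψ d t - d t‖ₑ ≤
      (∫⁻ s in Ioo 0 S, ENNReal.ofReal (ψ s) *
        ‖(Ioo 0 S).indicator d (t - s) - (Ioo 0 S).indicator d t‖ₑ) +
      (1 - ∫⁻ s in Ioo 0 S, ENNReal.ofReal (ψ s)) * ‖d t‖ₑ := by
  set m := ∫ s in Ioo 0 S, ψ s with hm
  have hmof : ENNReal.ofReal m = ∫⁻ s in Ioo 0 S, ENNReal.ofReal (ψ s) :=
    ofReal_integral_eq_lintegral_ofReal hψ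
      ((ae_restrict_iff' measurableSet_Ioo).2 (.of_forall hψ0))
  have hm0 : 0 ≤ m := setIntegral_nonneg measurableSet_Ioo hψ0
  have hm1 : m ≤ 1 := by
    rw [← hmof] at hmass
    exact ENNReal.ofReal_le_one.1 hmass
  have hconv : IntegrableOn (fun s => ψ s • (Ioo 0 S).indicator d (t - s)) (Ioo 0 S) := by
    rw [intervalIntegrable_iff_integrableOn_Ioo_of_le ht.1.le, ← integrable_indicator_iff
      measurableSet_Ioo, ← indicator_smul_indicator_sub ht] at hi
    have := hi.comp_sub_left t
    simp only [sub_sub_cancel] at this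
    refine (this.integrableOn (s := Ioo 0 S)).congr_fun (fun s hs => ?_) measurableSet_Ioo
    simp [hs]
  have hconst : IntegrableOn (fun s => ψ s • (Ioo 0 S).indicator d t) (Ioo 0 S) :=
    hψ.smul_const _
  have heq : causalConv ψ d t - d t =
      (∫ s in Ioo 0 S, ψ s • ((Ioo 0 S).indicator d (t - s) - (Ioo 0 S).indicator d t)) -
        (1 - m) • d t := by
    simp_rw [smul_sub]
    rw [integral_sub hconv hconst, integral_smul_const, ← hm, indicator_of_mem ht, sub_smul,
      one_smul, causalConv_eq_convolution ht, convolution_def]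
    have : ∫ s, (lsmul ℝ ℝ) ((Ioo 0 S).indicator ψ s) ((Ioo 0 S).indicator d (t - s)) =
        ∫ s in Ioo 0 S, ψ s • (Ioo 0 S).indicator d (t - s) := by
      rw [← integral_indicator measurableSet_Ioo]
      congr 1; ext s
      by_cases hs : s ∈ Ioo 0 S <;> simp [hs]
    rw [this]
    abel
  rw [heq]
  refine enorm_sub_le.trans (add_le_add ?_ ?_)
  · refine (enorm_integral_le_lintegral_enorm _).trans
      (setLIntegral_mono' measurableSet_Ioo fun s hs => ?_)
    rw [enorm_smul, Real.enorm_eq_ofReal (hψ0 s hs)]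
  · rw [enorm_smul, Real.enorm_eq_ofReal (sub_nonneg.2 hm1), ENNReal.ofReal_sub _ hm0, hmof,
      ENNReal.ofReal_one]

/-- Convolution with a concentrating family of nonnegative kernels of mass at most one tends to
the identity in `Lᵖ`, `1 ≤ p < ∞`. -/
theorem tendsto_eLpNorm_causalConv_sub (hS : 0 < S) {ψ : ι → ℝ → ℝ}
    (hψ0 : ∀ i, ∀ s ∈ Ioo 0 S, 0 ≤ ψ i s) (hψ : ∀ i, IntegrableOn (ψ i) (Ioo 0 S))
    (hmass : ∀ i, ∫⁻ s in Ioo 0 S, ENNReal.ofReal (ψ i s) ≤ 1)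
    (hlim : ∀ δ ∈ Ioc 0 S, Tendsto (fun i => ∫⁻ s in Ioo 0 δ, ENNReal.ofReal (ψ i s)) l (𝓝 1))
    {p : ℝ≥0∞} (hp1 : 1 ≤ p) (hp : p ≠ ∞) {d : ℝ → E}
    (hd : MemLp d p (volume.restrict (Ioo 0 S))) :
    Tendsto (fun i => eLpNorm (fun t => causalConv (ψ i) d t - d t) p (volume.restrict (Ioo 0 S)))
      l (𝓝 0) := by
  set μ : Measure ℝ := volume.restrict (Ioo 0 S) with hμ
  have hp0 : p ≠ 0 := (zero_lt_one.trans_le hp1).ne'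
  have hpr : 1 ≤ p.toReal := by
    have := (ENNReal.toReal_le_toReal ENNReal.one_ne_top hp).2 hp1
    simpa using this
  have hd1 : IntegrableOn d (Ioo 0 S) := hd.integrable hp1
  have hD : MemLp ((Ioo 0 S).indicator d) p volume := (memLp_indicator_iff_restrict
    measurableSet_Ioo).2 hd
  set D := (Ioo 0 S).indicator d with hDdef
  set W : ℝ → ℝ≥0∞ := fun s => eLpNorm (fun t => D (t - s) - D t) p volume with hWdef
  have hWtend := tendsto_eLpNorm_translation_sub hp1 hp hD
  have hsm : ∀ i, AEMeasurable (fun s => ENNReal.ofReal (ψ i s)) μ :=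
    fun i => (hψ i).1.aemeasurable.ennreal_ofReal
  have hDm : AEStronglyMeasurable (fun q : ℝ × ℝ => D (q.1 - q.2) - D q.1)
      (volume.prod volume) := by
    refine AEStronglyMeasurable.sub ?_ hD.1.comp_fst
    exact hD.1.comp_quasiMeasurePreserving
      (quasiMeasurePreserving_sub_of_right_invariant volume volume)
  have hDm' : AEStronglyMeasurable (fun q : ℝ × ℝ => D (q.1 - q.2) - D q.1) (μ.prod μ) :=
    hDm.mono_ac (Measure.AbsolutelyContinuous.prod Measure.absolutelyContinuous_restrict
      Measure.absolutelyContinuous_restrict)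
  set X : ι → ℝ → ℝ≥0∞ := fun i t => ∫⁻ s in Ioo 0 S, ENNReal.ofReal (ψ i s) *
    ‖D (t - s) - D t‖ₑ with hX
  have hjoint : ∀ i, AEMeasurable (fun q : ℝ × ℝ => ENNReal.ofReal (ψ i q.2) *
      ‖D (q.1 - q.2) - D q.1‖ₑ) (μ.prod μ) := fun i =>
    ((hsm i).comp_snd).mul hDm'.enorm
  have hXm : ∀ i, AEMeasurable (X i) μ := fun i => (hjoint i).lintegral_prod_right'
  -- Jensen in s followed by Tonelli: the Lᵖ norm of the averaged differences is controlled by the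
  -- average of the translation modulus W, which tends to 0 at s = 0.
  have hXp : ∀ i, eLpNorm (X i) p μ ^ p.toReal ≤
      ∫⁻ s in Ioo 0 S, ENNReal.ofReal (ψ i s) * W s ^ p.toReal := by
    intro i
    rw [eLpNorm_eq_lintegral_rpow_enorm_toReal hp0 hp, ← ENNReal.rpow_mul,
      one_div_mul_cancel (by positivity), ENNReal.rpow_one]
    have hslice : ∀ᵐ t ∂μ, AEStronglyMeasurable (fun s => D (t - s) - D t) μ := hDm'.prodMk_left
    calc ∫⁻ t, ‖X i t‖ₑ ^ p.toReal ∂μ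
        ≤ ∫⁻ t, ∫⁻ s, ENNReal.ofReal (ψ i s) * ‖D (t - s) - D t‖ₑ ^ p.toReal ∂μ ∂μ := by
          refine lintegral_mono_ae ?_
          filter_upwards [hslice] with t ht
          rw [enorm_eq_self]
          exact lintegral_mul_rpow_le (hsm i) ht.enorm (hmass i) hpr
      _ = ∫⁻ s, ∫⁻ t, ENNReal.ofReal (ψ i s) * ‖D (t - s) - D t‖ₑ ^ p.toReal ∂μ ∂μ := by
          refine lintegral_lintegral_swap ?_
          exact ((hsm i).comp_snd).mul (hDm'.enorm.pow_const _)
      _ ≤ ∫⁻ s, ENNReal.ofReal (ψ i s) * W s ^ p.toReal ∂μ := by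
          refine lintegral_mono fun s => ?_
          simp only
          rw [lintegral_const_mul' _ _ ENNReal.ofReal_ne_top]
          gcongr
          rw [hWdef]
          simp only
          rw [eLpNorm_eq_lintegral_rpow_enorm_toReal hp0 hp, ← ENNReal.rpow_mul,
            one_div_mul_cancel (by positivity), ENNReal.rpow_one]
          exact setLIntegral_le_lintegral _ _
  have hWle : ∀ s, W s ≤ 2 * eLpNorm D p volume := by
    intro s
    have hmp : MeasurePreserving (fun t : ℝ => t - s) volume volume :=
      measurePreserving_sub_right volume s
    refine (eLpNorm_sub_le (hD.comp_measurePreserving hmp).1 hD.1 hp1).trans ?_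
    have := eLpNorm_comp_measurePreserving (p := p) hD.1 hmp
    simp only [Function.comp_def] at this ⊢
    rw [this, two_mul]
  have hXtend : Tendsto (fun i => eLpNorm (X i) p μ) l (𝓝 0) := by
    have h1 : Tendsto (fun i => ∫⁻ s in Ioo 0 S, ENNReal.ofReal (ψ i s) * W s ^ p.toReal) l
        (𝓝 0) := by
      refine tendsto_lintegral_mul_of_concentrating hS hsm hmass
        (fun δ hδ => hlim δ ⟨hδ.1, hδ.2.le⟩)
        (K := (2 * eLpNorm D p volume) ^ p.toReal) ?_ ?_ ?_
      · exact ENNReal.rpow_ne_top_of_nonneg (by positivity)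
          (ENNReal.mul_ne_top (by simp) hD.2.ne)
      · intro s; gcongr; exact hWle s
      · have := (ENNReal.continuous_rpow_const (y := p.toReal)).tendsto 0 |>.comp hWtend
        rw [ENNReal.zero_rpow_of_pos (zero_lt_one.trans_le hpr)] at this
        exact this
    have h2 : Tendsto (fun i => eLpNorm (X i) p μ ^ p.toReal) l (𝓝 0) :=
      tendsto_of_tendsto_of_tendsto_of_le_of_le tendsto_const_nhds h1 (fun _ => zero_le) hXp
    have h3 := ((ENNReal.continuous_rpow_const (y := 1 / p.toReal)).tendsto 0).comp h2
    simp only [Function.comp_def, ← ENNReal.rpow_mul] at h3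
    rw [mul_one_div_cancel (by positivity), ENNReal.zero_rpow_of_pos (by positivity)] at h3
    simpa using h3
  have hrest : Tendsto (fun i => (1 - ∫⁻ s in Ioo 0 S, ENNReal.ofReal (ψ i s)) * eLpNorm d p μ) l
      (𝓝 0) := by
    have := ENNReal.Tendsto.mul_const (b := eLpNorm d p μ)
      (ENNReal.Tendsto.sub tendsto_const_nhds (hlim S ⟨hS, le_rfl⟩) (Or.inl ENNReal.one_ne_top))
      (Or.inr hd.2.ne)
    simpa using this
  have hsum := hXtend.add hrest
  rw [add_zero] at hsum
  refine tendsto_of_tendsto_of_tendsto_of_le_of_le tendsto_const_nhds hsum (fun _ => zero_le)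
    fun i => ?_
  simp only
  set r : ℝ≥0∞ := 1 - ∫⁻ s in Ioo 0 S, ENNReal.ofReal (ψ i s) with hr
  have hrtop : r ≠ ∞ := (tsub_le_self.trans_lt ENNReal.one_lt_top).ne
  have hrd : eLpNorm (fun t => r * ‖d t‖ₑ) p μ ≤ r * eLpNorm d p μ := by
    rw [eLpNorm_eq_lintegral_rpow_enorm_toReal hp0 hp, eLpNorm_eq_lintegral_rpow_enorm_toReal hp0 hp]
    simp only [enorm_eq_self, ENNReal.mul_rpow_of_nonneg _ _ (zero_le_one.trans hpr)]
    rw [lintegral_const_mul' _ _ (ENNReal.rpow_ne_top_of_nonneg (by positivity) hrtop),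
      ENNReal.mul_rpow_of_nonneg _ _ (by positivity), ← ENNReal.rpow_mul,
      mul_one_div_cancel (by positivity), ENNReal.rpow_one]
  refine (eLpNorm_mono_enorm_ae (g := fun t => X i t + r * ‖d t‖ₑ) ?_).trans
    ((eLpNorm_add_le (hXm i).aestronglyMeasurable
      (hd.1.enorm.const_mul r).aestronglyMeasurable hp1).trans (add_le_add le_rfl hrd))
  filter_upwards [ae_intervalIntegrable_causalConv (hψ i) hd1, ae_restrict_mem measurableSet_Ioo]
    with t hi ht
  rw [enorm_eq_self]
  exact enorm_causalConv_sub_le (hψ0 i) (hψ i) (hmass i) ht hi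

end ApproximateIdentity

/-! ### Riemann–Liouville kernels and the kernels of the truncated Marchaud derivative. -/

section FractionalKernels

open Filter Topology

/-- The Riemann–Liouville kernel `t^(a-1)/Γ(a)`. -/
noncomputable def rlKernel (a t : ℝ) : ℝ := t ^ (a - 1) / Real.Gamma a

theorem rlKernel_nonneg {a t : ℝ} (ha : 0 < a) (ht : 0 ≤ t) : 0 ≤ rlKernel a t :=
  div_nonneg (Real.rpow_nonneg ht _) (Real.Gamma_pos_of_pos ha).le

theorem rlKernel_pos {a t : ℝ} (ha : 0 < a) (ht : 0 < t) : 0 < rlKernel a t :=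
  div_pos (Real.rpow_pos_of_pos ht _) (Real.Gamma_pos_of_pos ha)

theorem rlKernel_one (t : ℝ) : rlKernel 1 t = 1 := by simp [rlKernel]

theorem rlKernel_antitone {a s t : ℝ} (ha : 0 < a) (ha1 : a ≤ 1) (hs : 0 < s) (hst : s ≤ t) :
    rlKernel a t ≤ rlKernel a s := by
  unfold rlKernel
  have := Real.Gamma_pos_of_pos ha
  gcongr ?_ / _
  exact Real.rpow_le_rpow_of_nonpos hs hst (by linarith)

theorem intervalIntegrable_rlKernel {a : ℝ} (ha : 0 < a) (s t : ℝ) :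
    IntervalIntegrable (rlKernel a) volume s t :=
  (intervalIntegral.intervalIntegrable_rpow' (by linarith)).div_const _

theorem integrableOn_rlKernel {a : ℝ} (ha : 0 < a) (S : ℝ) :
    IntegrableOn (rlKernel a) (Ioo 0 S) := by
  rcases le_total 0 S with h | h
  · exact (intervalIntegrable_iff_integrableOn_Ioo_of_le h).1 (intervalIntegrable_rlKernel ha 0 S)
  · simp [Ioo_eq_empty_of_le h]

/-- The semigroup law g_a * g_b = g_(a+b) is Euler's Beta integral, B(a,b) = Γ(a)Γ(b)/Γ(a+b). -/
theorem causalConv_rlKernel {a b t : ℝ} (ha : 0 < a) (hb : 0 < b) (ht : 0 < t) :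
    causalConv (rlKernel a) (rlKernel b) t = rlKernel (a + b) t := by
  have h := Complex.betaIntegral_scaled (b : ℂ) (a : ℂ) ht
  rw [Complex.betaIntegral_eq_Gamma_mul_div _ _ (by simpa) (by simpa)] at h
  have h1 : ∫ x in (0 : ℝ)..t, (x : ℂ) ^ ((b : ℂ) - 1) * ((t : ℂ) - x) ^ ((a : ℂ) - 1) =
      ((∫ x in (0 : ℝ)..t, x ^ (b - 1) * (t - x) ^ (a - 1) : ℝ) : ℂ) := by
    rw [← intervalIntegral.integral_ofReal]
    refine intervalIntegral.integral_congr fun x hx => ?_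
    rw [uIcc_of_le ht.le] at hx
    push_cast
    rw [Complex.ofReal_cpow hx.1, Complex.ofReal_cpow (sub_nonneg.2 hx.2)]
    push_cast
    ring
  rw [h1] at h
  have h2 : (t : ℂ) ^ ((b : ℂ) + a - 1) = ((t ^ (b + a - 1) : ℝ) : ℂ) := by
    rw [Complex.ofReal_cpow ht.le]; push_cast; rfl
  rw [h2, ← Complex.ofReal_add, Complex.Gamma_ofReal, Complex.Gamma_ofReal,
    Complex.Gamma_ofReal] at h
  have h3 : ∫ x in (0 : ℝ)..t, x ^ (b - 1) * (t - x) ^ (a - 1) =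
      t ^ (b + a - 1) * (Real.Gamma b * Real.Gamma a / Real.Gamma (b + a)) := by
    exact_mod_cast h
  have hga := (Real.Gamma_pos_of_pos ha).ne'
  have hgb := (Real.Gamma_pos_of_pos hb).ne'
  have hgab := (Real.Gamma_pos_of_pos (add_pos hb ha)).ne'
  unfold causalConv
  have h4 : ∀ x, rlKernel a (t - x) • rlKernel b x =
      (Real.Gamma a * Real.Gamma b)⁻¹ * (x ^ (b - 1) * (t - x) ^ (a - 1)) := by
    intro x
    simp only [rlKernel, smul_eq_mul]
    field_simp
  simp_rw [h4]
  rw [intervalIntegral.integral_const_mul, h3, rlKernel, add_comm a b]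
  field_simp

theorem integral_rlKernel {a t : ℝ} (ha : 0 < a) (ht : 0 < t) :
    ∫ s in (0 : ℝ)..t, rlKernel a s = rlKernel (1 + a) t := by
  rw [← causalConv_rlKernel one_pos ha ht]
  simp [causalConv, rlKernel_one]

variable {E : Type*} [NormedAddCommGroup E] [NormedSpace ℝ E]

theorem caputoIntegral_eq_causalConv (α : ℝ) (w : ℝ → E) (s : ℝ) :
    caputoIntegral α w s = causalConv (rlKernel (1 - α)) (fun τ => w τ - w 0) s := by
  rw [caputoIntegral, causalConv, ← intervalIntegral.integral_smul]
  refine intervalIntegral.integral_congr fun τ _ => ?_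
  simp only [rlKernel, smul_smul]
  congr 1
  rw [show 1 - α - 1 = -α by ring]
  ring

variable [CompleteSpace E]

/-- The primitive is continuous, so it vanishes at every time and not only almost everywhere;
Lebesgue differentiation then gives f = 0. -/
theorem ae_eq_zero_of_integral_eq_zero {S : ℝ} {f : ℝ → E} (hf : IntegrableOn f (Ioo 0 S))
    (h : ∀ᵐ t ∂volume.restrict (Ioo 0 S), ∫ τ in (0 : ℝ)..t, f τ = 0) :
    f =ᵐ[volume.restrict (Ioo 0 S)] 0 := by
  rcases le_or_gt S 0 with hS | hS
  · rw [Ioo_eq_empty_of_le hS, Measure.restrict_empty, ae_zero]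
    exact eventually_bot
  have hi : IntervalIntegrable f volume 0 S :=
    (intervalIntegrable_iff_integrableOn_Ioo_of_le hS.le).2 hf
  have hc : ContinuousOn (fun t => ∫ τ in (0 : ℝ)..t, f τ) (Ioo 0 S) := by
    refine (intervalIntegral.continuousOn_primitive_interval
      ((intervalIntegrable_iff' (by simp)).1 hi)).mono ?_
    rw [uIcc_of_le hS.le]; exact Ioo_subset_Icc_self
  have h0 : EqOn (fun t => ∫ τ in (0 : ℝ)..t, f τ) (fun _ => 0) (Ioo 0 S) :=
    Measure.eqOn_open_of_ae_eq h isOpen_Ioo hc continuousOn_const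
  filter_upwards [ae_restrict_of_ae hi.ae_hasDerivAt_integral, ae_restrict_mem measurableSet_Ioo]
    with t ht hmem
  have hd := ht (by rw [uIcc_of_le hS.le]; exact Ioo_subset_Icc_self hmem) 0 left_mem_uIcc
  have hd0 : HasDerivAt (fun t => ∫ τ in (0 : ℝ)..t, f τ) 0 t :=
    (hasDerivAt_const t (0 : E)).congr_of_eventuallyEq
      (h0.eventuallyEq_of_mem (isOpen_Ioo.mem_nhds hmem))
  exact hd.unique hd0

/-- If `t ↦ (k * v)(t)` is the primitive of `d`, with `k` the Caputo kernel of order `α`, then `v`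
is the fractional integral of order `α` of `d`. -/
theorem ae_eq_causalConv_of_caputo {α S : ℝ} (hα₀ : 0 < α) (hα₁ : α < 1) {v d : ℝ → E}
    (hv : IntegrableOn v (Ioo 0 S)) (hd : IntegrableOn d (Ioo 0 S))
    (h : ∀ t ∈ Ioo 0 S, causalConv (rlKernel (1 - α)) v t = ∫ τ in (0 : ℝ)..t, d τ) :
    v =ᵐ[volume.restrict (Ioo 0 S)] causalConv (rlKernel α) d := by
  have hg := integrableOn_rlKernel hα₀ S
  have hk := integrableOn_rlKernel (sub_pos.2 hα₁) S
  have h1 : IntegrableOn (fun _ : ℝ => (1 : ℝ)) (Ioo 0 S) := by simp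
  have hgd := integrableOn_causalConv hg hd
  have hz : (fun t => v t - causalConv (rlKernel α) d t) =ᵐ[volume.restrict (Ioo 0 S)] 0 := by
    -- Convolving the hypothesis g_(1-α) * v = 1 * d with g_α gives 1 * v = 1 * (g_α * d); equality
    -- of the primitives suffices.
    refine ae_eq_zero_of_integral_eq_zero (hv.sub hgd) ?_
    filter_upwards [causalConv_assoc hg hk hv, causalConv_assoc hg h1 hd, causalConv_assoc h1 hg hd,
      ae_restrict_mem measurableSet_Ioo] with t e1 e2 e3 ht
    have hi : ∀ {f : ℝ → E}, IntegrableOn f (Ioo 0 S) → IntervalIntegrable f volume 0 t :=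
      fun hf => (intervalIntegrable_iff_integrableOn_Ioo_of_le ht.1.le).2
        (hf.mono_set (Ioo_subset_Ioo_right ht.2.le))
    rw [intervalIntegral.integral_sub (hi hv) (hi hgd), ← causalConv_one v,
      ← causalConv_one (causalConv _ d), ← e3, sub_eq_zero]
    have c1 : causalConv (causalConv (rlKernel α) (rlKernel (1 - α))) v t =
        causalConv (fun _ => 1) v t := by
      refine causalConv_congr_ae_left ht v ?_
      filter_upwards [ae_restrict_mem measurableSet_Ioo] with s hs
      rw [causalConv_rlKernel hα₀ (by linarith) hs.1, add_sub_cancel, rlKernel_one]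
    have c2 : causalConv (rlKernel α) (causalConv (rlKernel (1 - α)) v) t =
        causalConv (rlKernel α) (causalConv (fun _ => 1) d) t := by
      refine causalConv_congr_ae ht _ ?_
      filter_upwards [ae_restrict_mem measurableSet_Ioo] with s hs
      rw [h s hs, causalConv_one]
    have c3 : causalConv (causalConv (rlKernel α) (fun _ => 1)) d t =
        causalConv (causalConv (fun _ => 1) (rlKernel α)) d t := by
      congr 1; ext s; exact causalConv_comm _ _ _
    rw [← c1, e1, c2, ← e2, c3]
  filter_upwards [hz] with t ht
  exact sub_eq_zero.1 ht

/-- The density of the (nonnegative) memory measure of the truncated Marchaud derivative. -/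
noncomputable def marchaudDensity (α ε t : ℝ) : ℝ :=
  if ε < t then α * t ^ (-α - 1) / Real.Gamma (1 - α) else 0

/-- The kernel `ψ` for which the truncated Marchaud derivative of the fractional integral of `d`
is `ψ * d`. -/
noncomputable def marchaudKernel (α ε t : ℝ) : ℝ :=
  ε ^ (-α) * (t ^ α - (max (t - ε) 0) ^ α) / (t * (Real.Gamma α * Real.Gamma (1 - α)))

variable {α ε : ℝ}

theorem marchaudDensity_nonneg (hα₀ : 0 < α) (hα₁ : α < 1) (hε : 0 < ε) (t : ℝ) :
    0 ≤ marchaudDensity α ε t := by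
  unfold marchaudDensity
  split_ifs with h
  · have := Real.Gamma_pos_of_pos (sub_pos.2 hα₁)
    have : 0 < t := hε.trans h
    positivity
  · exact le_rfl

theorem marchaudDensity_le (hα₀ : 0 < α) (hα₁ : α < 1) (hε : 0 < ε) (t : ℝ) :
    marchaudDensity α ε t ≤ α * ε ^ (-α - 1) / Real.Gamma (1 - α) := by
  have := Real.Gamma_pos_of_pos (sub_pos.2 hα₁)
  unfold marchaudDensity
  split_ifs with h
  · gcongr ?_ / _
    refine mul_le_mul_of_nonneg_left ?_ hα₀.le
    exact Real.rpow_le_rpow_of_nonpos hε h.le (by linarith)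
  · positivity

theorem measurable_marchaudDensity (α ε : ℝ) : Measurable (marchaudDensity α ε) := by
  unfold marchaudDensity
  exact Measurable.ite measurableSet_Ioi (by fun_prop) measurable_const

theorem integrableOn_marchaudDensity (hα₀ : 0 < α) (hα₁ : α < 1) (hε : 0 < ε) (S : ℝ) :
    IntegrableOn (marchaudDensity α ε) (Ioo 0 S) :=
  Measure.integrableOn_of_bounded (by simp) (measurable_marchaudDensity α ε).aestronglyMeasurable
    (.of_forall fun t => by
      rw [Real.norm_of_nonneg (marchaudDensity_nonneg hα₀ hα₁ hε t)]
      exact marchaudDensity_le hα₀ hα₁ hε t)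

/-- Beyond ε the density is minus the derivative of g_(1-α), so its total mass on (0,t) never
exceeds g_(1-α)(ε), the coefficient of the local term. -/
theorem integral_marchaudDensity (hε : 0 < ε) {t : ℝ} (ht : 0 < t) :
    ∫ s in (0 : ℝ)..t, marchaudDensity α ε s =
      rlKernel (1 - α) ε - rlKernel (1 - α) (max t ε) := by
  have hz : ∀ {r : ℝ}, 0 ≤ r → r ≤ ε → ∫ s in (0 : ℝ)..r, marchaudDensity α ε s = 0 := by
    intro r h0 hr
    rw [intervalIntegral.integral_congr (g := fun _ => 0), intervalIntegral.integral_zero]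
    intro s hs
    rw [uIcc_of_le h0] at hs
    simp [marchaudDensity, not_lt.2 (hs.2.trans hr)]
  rcases le_or_gt t ε with h | h
  · rw [hz ht.le h, max_eq_right h, sub_self]
  · rw [max_eq_left h.le]
    have hcont : ContinuousOn (fun s : ℝ => α * s ^ (-α - 1) / Real.Gamma (1 - α)) (Icc ε t) := by
      refine ContinuousOn.div_const (ContinuousOn.mul continuousOn_const ?_) _
      exact ContinuousOn.rpow_const continuousOn_id fun s hs => Or.inl (hε.trans_le hs.1).ne'
    have hae : ∀ᵐ s, s ∈ uIoc ε t → α * s ^ (-α - 1) / Real.Gamma (1 - α) =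
        marchaudDensity α ε s := by
      refine .of_forall fun s hs => ?_
      rw [uIoc_of_le h.le] at hs
      simp [marchaudDensity, hs.1]
    have hint : IntervalIntegrable (fun s : ℝ => α * s ^ (-α - 1) / Real.Gamma (1 - α))
        volume ε t := by
      refine ContinuousOn.intervalIntegrable ?_
      rwa [uIcc_of_le h.le]
    have hint' : IntervalIntegrable (marchaudDensity α ε) volume ε t :=
      hint.congr_ae ((ae_restrict_iff' measurableSet_uIoc).2 hae)
    have hint0 : IntervalIntegrable (marchaudDensity α ε) volume 0 ε := by
      refine (intervalIntegrable_const (c := (0 : ℝ))).congr_ae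
        ((ae_restrict_iff' measurableSet_uIoc).2 (.of_forall fun s hs => ?_))
      rw [uIoc_of_le hε.le] at hs
      simp [marchaudDensity, not_lt.2 hs.2]
    rw [← intervalIntegral.integral_add_adjacent_intervals hint0 hint', hz hε.le le_rfl, zero_add,
      ← intervalIntegral.integral_congr_ae hae,
      intervalIntegral.integral_eq_sub_of_hasDerivAt (f := fun s => -rlKernel (1 - α) s) _ hint]
    · ring
    · intro s hs
      rw [uIcc_of_le h.le] at hs
      have hs0 : s ≠ 0 := (hε.trans_le hs.1).ne'
      have := ((Real.hasDerivAt_rpow_const (x := s) (p := 1 - α - 1) (Or.inl hs0)).div_const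
        (Real.Gamma (1 - α))).neg
      refine this.congr_deriv ?_
      rw [show 1 - α - 1 - 1 = -α - 1 by ring]
      ring

/-- This evaluates the truncated Marchaud derivative of g_α in closed form. The explicit formula
makes its nonnegativity visible. -/
theorem marchaudKernel_eq (hα₀ : 0 < α) (hα₁ : α < 1) (hε : 0 < ε) {t : ℝ} (ht : 0 < t) :
    rlKernel (1 - α) ε * rlKernel α t - causalConv (marchaudDensity α ε) (rlKernel α) t =
      marchaudKernel α ε t := by
  have hG := (Real.Gamma_pos_of_pos hα₀).ne'
  have hG1 := (Real.Gamma_pos_of_pos (sub_pos.2 hα₁)).ne'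
  have hp : t ^ (α - 1) = t ^ α / t := Real.rpow_sub_one ht.ne' α
  have hconv : causalConv (marchaudDensity α ε) (rlKernel α) t =
      ε ^ (-α) * (max (t - ε) 0) ^ α / (t * (Real.Gamma α * Real.Gamma (1 - α))) := by
    have hz : ∀ {r : ℝ}, 0 ≤ r → t - ε ≤ r → r ≤ t →
        ∀ τ ∈ Icc r t, marchaudDensity α ε (t - τ) • rlKernel α τ = 0 := by
      intro r h0 h1 h2 τ hτ
      have : ¬ ε < t - τ := by have := hτ.1; linarith
      simp [marchaudDensity, this]
    rcases le_or_gt t ε with h | h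
    · rw [max_eq_right (by linarith), Real.zero_rpow hα₀.ne', mul_zero, zero_div, causalConv,
        intervalIntegral.integral_congr (g := fun _ => 0), intervalIntegral.integral_zero]
      intro τ hτ
      rw [uIcc_of_le ht.le] at hτ
      exact hz le_rfl (by linarith) ht.le τ hτ
    · have htε : 0 < t - ε := by linarith
      rw [max_eq_left htε.le, causalConv]
      -- An antiderivative: d/dτ [τ^α (t-τ)^(-α)] = α t τ^(α-1) (t-τ)^(-α-1), hence the factor t in
      -- the denominator.
      set Q : ℝ → ℝ := fun τ => τ ^ α * (t - τ) ^ (-α) / (t * (Real.Gamma α * Real.Gamma (1 - α)))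
      have hQd : ∀ τ ∈ Ioo 0 (t - ε), HasDerivAt Q
          (α * (t - τ) ^ (-α - 1) / Real.Gamma (1 - α) * rlKernel α τ) τ := by
        intro τ hτ
        have hτ0 : 0 < τ := hτ.1
        have htτ : 0 < t - τ := by linarith [hτ.2]
        have d1 := Real.hasDerivAt_rpow_const (x := τ) (p := α) (Or.inl hτ0.ne')
        have d2 := (Real.hasDerivAt_rpow_const (x := t - τ) (p := -α) (Or.inl htτ.ne')).comp τ
          ((hasDerivAt_id τ).const_sub t)
        refine ((d1.mul d2).div_const _).congr_deriv ?_
        have e1 : τ ^ α = τ ^ (α - 1) * τ := by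
          rw [Real.rpow_sub_one hτ0.ne']; field_simp
        have e2 : (t - τ) ^ (-α) = (t - τ) ^ (-α - 1) * (t - τ) := by
          rw [Real.rpow_sub_one htτ.ne']; field_simp
        simp only [rlKernel, Function.comp_apply]
        rw [e1, e2]
        field_simp
        ring
      have hQc : ContinuousOn Q (Icc 0 (t - ε)) := by
        refine ContinuousOn.div_const (ContinuousOn.mul ?_ ?_) _
        · exact ContinuousOn.rpow_const continuousOn_id fun _ _ => Or.inr hα₀.le
        · refine ContinuousOn.rpow_const (by fun_prop) fun τ hτ => Or.inl ?_
          have := hτ.2; simp only [ne_eq]; intro h0; linarith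
      have hint : IntervalIntegrable
          (fun τ => α * (t - τ) ^ (-α - 1) / Real.Gamma (1 - α) * rlKernel α τ) volume 0 (t - ε) := by
        refine (intervalIntegrable_rlKernel hα₀ 0 (t - ε)).continuousOn_mul ?_
        rw [uIcc_of_le htε.le]
        refine ContinuousOn.div_const (ContinuousOn.mul continuousOn_const ?_) _
        refine ContinuousOn.rpow_const (by fun_prop) fun τ hτ => Or.inl ?_
        have := hτ.2; simp only [ne_eq]; intro h0; linarith
      have hae : ∀ᵐ τ, τ ∈ uIoc 0 (t - ε) →
          α * (t - τ) ^ (-α - 1) / Real.Gamma (1 - α) * rlKernel α τ =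
            marchaudDensity α ε (t - τ) • rlKernel α τ := by
        have : ∀ᵐ τ : ℝ, τ ≠ t - ε := by simp [ae_iff, measure_singleton]
        filter_upwards [this] with τ hne hτ
        rw [uIoc_of_le htε.le] at hτ
        have : ε < t - τ := by
          have := lt_of_le_of_ne hτ.2 hne; linarith
        simp [marchaudDensity, this]
      have hint' := hint.congr_ae ((ae_restrict_iff' measurableSet_uIoc).2 hae)
      have hae0 : ∀ τ ∈ uIoc (t - ε) t, (0 : ℝ) = marchaudDensity α ε (t - τ) • rlKernel α τ := by
        intro τ hτ
        rw [uIoc_of_le (by linarith)] at hτ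
        exact (hz htε.le le_rfl (by linarith) τ ⟨hτ.1.le, hτ.2⟩).symm
      have hint0 : IntervalIntegrable (fun τ => marchaudDensity α ε (t - τ) • rlKernel α τ)
          volume (t - ε) t :=
        (intervalIntegrable_const (c := (0 : ℝ))).congr_ae
          ((ae_restrict_iff' measurableSet_uIoc).2 (.of_forall hae0))
      rw [← intervalIntegral.integral_add_adjacent_intervals hint' hint0,
        ← intervalIntegral.integral_congr_ae hae,
        ← intervalIntegral.integral_congr_ae (.of_forall hae0), intervalIntegral.integral_zero,
        add_zero, intervalIntegral.integral_eq_sub_of_hasDerivAt_of_le htε.le hQc hQd hint]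
      simp only [Q, sub_sub_cancel, Real.zero_rpow hα₀.ne']
      ring
  rw [hconv, marchaudKernel, rlKernel, rlKernel, hp, show 1 - α - 1 = -α by ring]
  field_simp

theorem marchaudKernel_nonneg (hα₀ : 0 < α) (hα₁ : α < 1) (hε : 0 < ε) {t : ℝ} (ht : 0 < t) :
    0 ≤ marchaudKernel α ε t := by
  have hG := Real.Gamma_pos_of_pos hα₀
  have hG1 := Real.Gamma_pos_of_pos (sub_pos.2 hα₁)
  unfold marchaudKernel
  have : (max (t - ε) 0) ^ α ≤ t ^ α :=
    Real.rpow_le_rpow (le_max_right _ _) (max_le (by linarith) ht.le) hα₀.le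
  have := sub_nonneg.2 this
  positivity

end FractionalKernels

/-! ### Truncated Marchaud derivatives and the mass of ψ_ε. -/

section TruncatedMarchaud

open Filter Topology

variable {α ε S : ℝ} {E : Type*} [NormedAddCommGroup E]

theorem intervalIntegrable_of_integrableOn {b : ℝ → E} (hb : IntegrableOn b (Ioo 0 S)) {t : ℝ}
    (ht : t ∈ Ioo 0 S) : IntervalIntegrable b volume 0 t :=
  (intervalIntegrable_iff_integrableOn_Ioo_of_le ht.1.le).2
    (hb.mono_set (Ioo_subset_Ioo_right ht.2.le))

variable [NormedSpace ℝ E]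

theorem exists_mem_Ioo_of_ae {a b : ℝ} (ha : 0 ≤ a) (hab : a < b) {P : ℝ → Prop}
    (h : ∀ᵐ t ∂volume.restrict (Ioo 0 b), P t) : ∃ t ∈ Ioo a b, P t := by
  have h1 : ∀ᵐ t ∂volume.restrict (Ioo a b), P t :=
    ae_restrict_of_ae_restrict_of_subset (Ioo_subset_Ioo_left ha) h
  have : NeBot (ae (volume.restrict (Ioo a b))) := by
    rw [ae_neBot, Ne, Measure.restrict_eq_zero]; simp [hab]
  obtain ⟨t, ht⟩ := ((ae_restrict_mem measurableSet_Ioo).and h1).exists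
  exact ⟨t, ht⟩

theorem integrableOn_marchaudKernel (hα₀ : 0 < α) (hα₁ : α < 1) (hε : 0 < ε) (S : ℝ) :
    IntegrableOn (marchaudKernel α ε) (Ioo 0 S) := by
  refine IntegrableOn.congr_fun (((integrableOn_rlKernel hα₀ S).const_mul
    (rlKernel (1 - α) ε)).sub (integrableOn_causalConv
      (integrableOn_marchaudDensity hα₀ hα₁ hε S) (integrableOn_rlKernel hα₀ S)))
    (fun t ht => ?_) measurableSet_Ioo
  exact marchaudKernel_eq hα₀ hα₁ hε ht.1

theorem causalConv_marchaudKernel (hα₀ : 0 < α) (hα₁ : α < 1) (hε : 0 < ε) {h : ℝ → E}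
    (hh : IntegrableOn h (Ioo 0 S)) :
    ∀ᵐ t ∂volume.restrict (Ioo 0 S), causalConv (marchaudKernel α ε) h t =
      rlKernel (1 - α) ε • causalConv (rlKernel α) h t -
        causalConv (causalConv (marchaudDensity α ε) (rlKernel α)) h t := by
  have hg := integrableOn_rlKernel hα₀ S
  have hκ := integrableOn_marchaudDensity hα₀ hα₁ hε S
  filter_upwards [ae_intervalIntegrable_causalConv hg hh,
    ae_intervalIntegrable_causalConv (integrableOn_causalConv hκ hg) hh,
    ae_restrict_mem measurableSet_Ioo] with t h1 h2 ht
  have : causalConv (marchaudKernel α ε) h t = causalConv (fun s =>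
      rlKernel (1 - α) ε * rlKernel α s - causalConv (marchaudDensity α ε) (rlKernel α) s) h t := by
    refine causalConv_congr_ae_left ht h ?_
    filter_upwards [ae_restrict_mem measurableSet_Ioo] with s hs
    exact (marchaudKernel_eq hα₀ hα₁ hε hs.1).symm
  rw [this, ← causalConv_const_smul, causalConv, causalConv, causalConv,
    ← intervalIntegral.integral_sub]
  · simp_rw [sub_smul]
  · simpa only [mul_smul, Pi.smul_def] using h1.smul (rlKernel (1 - α) ε)
  · exact h2

/-- The truncated Marchaud derivative of a fractional integral. -/
theorem marchaud_causalConv [CompleteSpace E] (hα₀ : 0 < α) (hα₁ : α < 1) (hε : 0 < ε)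
    {v d : ℝ → E}
    (hd : IntegrableOn d (Ioo 0 S)) (hv : v =ᵐ[volume.restrict (Ioo 0 S)] causalConv (rlKernel α) d) :
    ∀ᵐ t ∂volume.restrict (Ioo 0 S),
      rlKernel (1 - α) ε • v t - causalConv (marchaudDensity α ε) v t =
        causalConv (marchaudKernel α ε) d t := by
  filter_upwards [causalConv_marchaudKernel hα₀ hα₁ hε hd, causalConv_assoc
    (integrableOn_marchaudDensity hα₀ hα₁ hε S) (integrableOn_rlKernel hα₀ S) hd, hv,
    ae_restrict_mem measurableSet_Ioo] with t h1 h2 h3 ht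
  rw [h1, h2, h3, causalConv_congr_ae ht _ hv]

/-- The fractional integral of a truncated Marchaud derivative. -/
theorem causalConv_marchaud [CompleteSpace E] (hα₀ : 0 < α) (hα₁ : α < 1) (hε : 0 < ε)
    {F : ℝ → E} (hF : IntegrableOn F (Ioo 0 S)) :
    ∀ᵐ t ∂volume.restrict (Ioo 0 S), causalConv (rlKernel α)
      (fun s => rlKernel (1 - α) ε • F s - causalConv (marchaudDensity α ε) F s) t =
        causalConv (marchaudKernel α ε) F t := by
  have hg := integrableOn_rlKernel hα₀ S
  have hκ := integrableOn_marchaudDensity hα₀ hα₁ hε S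
  filter_upwards [causalConv_marchaudKernel hα₀ hα₁ hε hF, causalConv_assoc hg hκ hF,
    ae_intervalIntegrable_causalConv hg hF,
    ae_intervalIntegrable_causalConv hg (integrableOn_causalConv hκ hF)] with t h1 h2 h3 h4
  have hc : causalConv (causalConv (marchaudDensity α ε) (rlKernel α)) F t =
      causalConv (causalConv (rlKernel α) (marchaudDensity α ε)) F t := by
    congr 1; ext s; exact causalConv_comm _ _ _
  rw [h1, hc, h2]
  simp only [causalConv, smul_sub] at h4 ⊢
  rw [intervalIntegral.integral_sub _ h4, ← intervalIntegral.integral_smul]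
  · simp_rw [smul_comm (rlKernel (1 - α) ε)]
  · simpa only [smul_comm (rlKernel (1 - α) ε), Pi.smul_def] using h3.smul (rlKernel (1 - α) ε)

/-- A maximum principle. The memory density is nonnegative with mass at most g_(1-α)(ε), so at a
time where G dominates its past and is nonnegative, the truncated derivative of G is nonnegative. -/
theorem causalConv_marchaudDensity_le (hα₀ : 0 < α) (hα₁ : α < 1) (hε : 0 < ε) {G : ℝ → ℝ} {t : ℝ}
    (ht : 0 < t) (hi : IntervalIntegrable (fun τ => marchaudDensity α ε (t - τ) • G τ) volume 0 t)
    (hG0 : 0 ≤ G t) (hG : ∀ᵐ τ ∂volume.restrict (Ioo 0 t), G τ ≤ G t) :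
    causalConv (marchaudDensity α ε) G t ≤ rlKernel (1 - α) ε * G t := by
  have hκ := (intervalIntegrable_iff_integrableOn_Ioo_of_le ht.le).2
    (integrableOn_marchaudDensity hα₀ hα₁ hε t)
  have hκ' : IntervalIntegrable (fun τ => marchaudDensity α ε (t - τ)) volume 0 t := by
    have := (hκ.comp_sub_left t).symm
    simpa using this
  calc causalConv (marchaudDensity α ε) G t
      ≤ ∫ τ in (0 : ℝ)..t, marchaudDensity α ε (t - τ) * G t := by
        refine intervalIntegral.integral_mono_ae_restrict ht.le hi (hκ'.mul_const _) ?_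
        rw [← restrict_Ioo_eq_restrict_Icc]
        filter_upwards [hG] with τ hτ
        exact mul_le_mul_of_nonneg_left hτ (marchaudDensity_nonneg hα₀ hα₁ hε _)
    _ = (rlKernel (1 - α) ε - rlKernel (1 - α) (max t ε)) * G t := by
        rw [intervalIntegral.integral_mul_const,
          intervalIntegral.integral_comp_sub_left (fun s => marchaudDensity α ε s) t, sub_self,
          sub_zero, integral_marchaudDensity hε ht]
    _ ≤ rlKernel (1 - α) ε * G t := by
        refine mul_le_mul_of_nonneg_right ?_ hG0
        have := rlKernel_nonneg (sub_pos.2 hα₁) (ht.le.trans (le_max_left t ε))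
        linarith

theorem integrableOn_rlKernel_max (hε : 0 < ε) (S : ℝ) :
    IntegrableOn (fun s => rlKernel (1 - α) (max s ε)) (Ioo 0 S) := by
  have hc : ContinuousOn (fun s => rlKernel (1 - α) (max s ε)) (Icc 0 S) := by
    unfold rlKernel
    refine ContinuousOn.div_const (ContinuousOn.rpow_const (by fun_prop) fun s _ => Or.inl ?_) _
    exact (hε.trans_le (le_max_right _ _)).ne'
  exact (hc.integrableOn_compact isCompact_Icc).mono_set Ioo_subset_Icc_self

/-- Integrating ψ_ε = g_(1-α)(ε) g_α - κ_ε * g_α, with κ_ε the memory density, and inserting the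
primitive of κ_ε leaves g_(1-α) capped at its value at ε. Comparison with g_(1-α) * g_α = 1 then
gives the mass. -/
theorem integral_marchaudKernel (hα₀ : 0 < α) (hα₁ : α < 1) (hε : 0 < ε) (S : ℝ) :
    ∀ᵐ t ∂volume.restrict (Ioo 0 S), ∫ s in (0 : ℝ)..t, marchaudKernel α ε s =
      causalConv (fun s => rlKernel (1 - α) (max s ε)) (rlKernel α) t := by
  have hg := integrableOn_rlKernel hα₀ S
  have hκ := integrableOn_marchaudDensity hα₀ hα₁ hε S
  have h1 : IntegrableOn (fun _ : ℝ => (1 : ℝ)) (Ioo 0 S) := by simp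
  filter_upwards [causalConv_assoc h1 hκ hg, ae_restrict_mem measurableSet_Ioo,
    ae_intervalIntegrable_causalConv (integrableOn_rlKernel_max hε S) hg] with t h2 ht h3
  have hgi := intervalIntegrable_of_integrableOn hg ht
  have hmi : IntervalIntegrable (fun τ => rlKernel (1 - α) (max (t - τ) ε) * rlKernel α τ)
      volume 0 t := h3
  have e1 : ∫ s in (0 : ℝ)..t, marchaudKernel α ε s = ∫ s in (0 : ℝ)..t,
      (rlKernel (1 - α) ε * rlKernel α s - causalConv (marchaudDensity α ε) (rlKernel α) s) := by
    refine intervalIntegral.integral_congr_ae (.of_forall fun s hs => ?_)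
    rw [uIoc_of_le ht.1.le] at hs
    exact (marchaudKernel_eq hα₀ hα₁ hε hs.1).symm
  rw [e1, intervalIntegral.integral_sub (hgi.const_mul _)
    (intervalIntegrable_of_integrableOn (integrableOn_causalConv hκ hg) ht),
    ← causalConv_one (causalConv _ _), ← h2]
  have e2 : causalConv (causalConv (fun _ => 1) (marchaudDensity α ε)) (rlKernel α) t =
      causalConv (fun s => rlKernel (1 - α) ε - rlKernel (1 - α) (max s ε)) (rlKernel α) t := by
    refine causalConv_congr_ae_left ht _ ?_
    filter_upwards [ae_restrict_mem measurableSet_Ioo] with s hs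
    rw [causalConv_one, integral_marchaudDensity hε hs.1]
  rw [e2]
  simp only [causalConv, smul_eq_mul, sub_mul]
  rw [intervalIntegral.integral_sub (hgi.const_mul _) hmi]
  ring

/-- Capping only lowers the kernel, and only for τ in (t-ε, t). There g_α(τ) ≤ g_α(t-ε), and the
part removed has mass at most ∫₀^ε g_(1-α) = g_(2-α)(ε). -/
theorem causalConv_rlKernel_max_bounds (hα₀ : 0 < α) (hα₁ : α < 1) (hε : 0 < ε) {t : ℝ}
    (ht : ε < t) (hi : IntervalIntegrable
      (fun τ => rlKernel (1 - α) (max (t - τ) ε) • rlKernel α τ) volume 0 t)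
    (hi' : IntervalIntegrable (fun τ => rlKernel (1 - α) (t - τ) • rlKernel α τ) volume 0 t) :
    causalConv (fun s => rlKernel (1 - α) (max s ε)) (rlKernel α) t ≤ 1 ∧
    1 - rlKernel α (t - ε) * rlKernel (1 + (1 - α)) ε ≤
      causalConv (fun s => rlKernel (1 - α) (max s ε)) (rlKernel α) t := by
  have ht0 : 0 < t := hε.trans ht
  have hone : causalConv (rlKernel (1 - α)) (rlKernel α) t = 1 := by
    rw [causalConv_rlKernel (by linarith) hα₀ ht0, sub_add_cancel, rlKernel_one]
  have hle : ∀ s, 0 < s → rlKernel (1 - α) (max s ε) ≤ rlKernel (1 - α) s := fun s hs =>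
    rlKernel_antitone (by linarith) (by linarith) hs (le_max_left _ _)
  constructor
  · refine le_of_le_of_eq ?_ hone
    refine intervalIntegral.integral_mono_on_of_le_Ioo ht0.le hi hi' fun τ hτ => ?_
    exact mul_le_mul_of_nonneg_right (hle _ (by linarith [hτ.2])) (rlKernel_nonneg hα₀ hτ.1.le)
  · have hd : causalConv (rlKernel (1 - α)) (rlKernel α) t - causalConv (fun s => rlKernel (1 - α) (max s ε)) (rlKernel α) t =
        ∫ τ in (0 : ℝ)..t, (rlKernel (1 - α) (t - τ) - rlKernel (1 - α) (max (t - τ) ε)) *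
          rlKernel α τ := by
      simp only [causalConv]
      rw [← intervalIntegral.integral_sub hi' hi]
      simp [sub_mul]
    have hsi : IntervalIntegrable (fun τ => (rlKernel (1 - α) (t - τ) -
        rlKernel (1 - α) (max (t - τ) ε)) * rlKernel α τ) volume 0 t := by
      simpa [sub_mul] using hi'.sub hi
    have hz : ∀ τ ∈ Icc 0 (t - ε), (0 : ℝ) = (rlKernel (1 - α) (t - τ) -
        rlKernel (1 - α) (max (t - τ) ε)) * rlKernel α τ := by
      intro τ hτ
      rw [max_eq_left (by linarith [hτ.2]), sub_self, zero_mul]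
    have hmem : t - ε ∈ uIcc 0 t := by rw [uIcc_of_le ht0.le]; constructor <;> linarith
    have hs1 := hsi.mono_set (uIcc_subset_uIcc_left hmem)
    have hs2 := hsi.mono_set (uIcc_subset_uIcc_right hmem)
    have hk : IntervalIntegrable (fun τ => rlKernel (1 - α) (t - τ) * rlKernel α (t - ε))
        volume (t - ε) t := by
      have := ((intervalIntegrable_rlKernel (sub_pos.2 hα₁) 0 ε).comp_sub_left t).symm
      simpa using this.mul_const (rlKernel α (t - ε))
    have : ∫ τ in (0 : ℝ)..t, (rlKernel (1 - α) (t - τ) - rlKernel (1 - α) (max (t - τ) ε)) *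
          rlKernel α τ ≤ rlKernel α (t - ε) * rlKernel (1 + (1 - α)) ε := by
      rw [← intervalIntegral.integral_add_adjacent_intervals hs1 hs2,
        intervalIntegral.integral_congr (g := fun _ => (0 : ℝ)) (a := 0), intervalIntegral.integral_zero,
        zero_add]
      · calc _ ≤ ∫ τ in (t - ε)..t, rlKernel (1 - α) (t - τ) * rlKernel α (t - ε) := by
              refine intervalIntegral.integral_mono_on_of_le_Ioo (by linarith) hs2 hk fun τ hτ => ?_
              have a1 : 0 ≤ rlKernel (1 - α) (max (t - τ) ε) :=
                rlKernel_nonneg (by linarith) (hε.le.trans (le_max_right _ _))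
              have a2 := hle (t - τ) (by linarith [hτ.2])
              have a3 : rlKernel α τ ≤ rlKernel α (t - ε) :=
                rlKernel_antitone hα₀ hα₁.le (by linarith) hτ.1.le
              have a4 : 0 ≤ rlKernel α τ := rlKernel_nonneg hα₀ (by linarith [hτ.1])
              gcongr
              · linarith
              · linarith
          _ = _ := by
              rw [intervalIntegral.integral_mul_const,
                intervalIntegral.integral_comp_sub_left (fun s => rlKernel (1 - α) s) t, sub_self,
                sub_sub_cancel, integral_rlKernel (by linarith) hε]
              ring
      · intro τ hτ
        rw [uIcc_of_le (by linarith)] at hτ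
        exact (hz τ hτ).symm
    linarith

theorem lintegral_marchaudKernel_eq (hα₀ : 0 < α) (hα₁ : α < 1) (hε : 0 < ε) {t : ℝ} (ht : 0 < t) :
    ∫⁻ s in Ioo 0 t, ENNReal.ofReal (marchaudKernel α ε s) =
      ENNReal.ofReal (∫ s in (0 : ℝ)..t, marchaudKernel α ε s) := by
  rw [intervalIntegral.integral_of_le ht.le, integral_Ioc_eq_integral_Ioo,
    ofReal_integral_eq_lintegral_ofReal (integrableOn_marchaudKernel hα₀ hα₁ hε t)]
  filter_upwards [ae_restrict_mem measurableSet_Ioo] with s hs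
  exact marchaudKernel_nonneg hα₀ hα₁ hε hs.1

/-- The mass formula is available for almost every t only. One good t in each interval is enough, as
the mass is monotone in the endpoint. -/
theorem exists_marchaudKernel_mass (hα₀ : 0 < α) (hα₁ : α < 1) (hε : 0 < ε) {a b : ℝ} (ha : ε ≤ a)
    (hab : a < b) : ∃ t ∈ Ioo a b, ∫ s in (0 : ℝ)..t, marchaudKernel α ε s ≤ 1 ∧
      1 - rlKernel α (t - ε) * rlKernel (1 + (1 - α)) ε ≤
        ∫ s in (0 : ℝ)..t, marchaudKernel α ε s := by
  have hg := integrableOn_rlKernel hα₀ b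
  have h := (integral_marchaudKernel hα₀ hα₁ hε b).and
    ((ae_intervalIntegrable_causalConv (integrableOn_rlKernel_max (α := α) hε b) hg).and
    (ae_intervalIntegrable_causalConv (integrableOn_rlKernel (sub_pos.2 hα₁) b) hg))
  obtain ⟨t, ht, h1, h2, h3⟩ := exists_mem_Ioo_of_ae (hε.le.trans ha) hab h
  refine ⟨t, ht, ?_⟩
  rw [h1]
  exact causalConv_rlKernel_max_bounds hα₀ hα₁ hε (ha.trans_lt ht.1) h2 h3

theorem lintegral_marchaudKernel_le_one (hα₀ : 0 < α) (hα₁ : α < 1) (hε : 0 < ε) (S : ℝ) :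
    ∫⁻ s in Ioo 0 S, ENNReal.ofReal (marchaudKernel α ε s) ≤ 1 := by
  obtain ⟨t, ht, h1, -⟩ := exists_marchaudKernel_mass hα₀ hα₁ hε (le_max_right S ε)
    (lt_add_one (max S ε))
  have hSt : S ≤ t := (le_max_left S ε).trans ht.1.le
  refine (lintegral_mono_set (Ioo_subset_Ioo_right hSt)).trans ?_
  rw [lintegral_marchaudKernel_eq hα₀ hα₁ hε (hε.trans ((le_max_right S ε).trans_lt ht.1))]
  exact ENNReal.ofReal_le_one.2 h1

theorem tendsto_lintegral_marchaudKernel {ι : Type*} {l : Filter ι} {e : ι → ℝ} (hα₀ : 0 < α)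
    (hα₁ : α < 1) (he : ∀ i, 0 < e i) (hl : Tendsto e l (𝓝 0)) {δ : ℝ} (hδ : 0 < δ) :
    Tendsto (fun i => ∫⁻ s in Ioo 0 δ, ENNReal.ofReal (marchaudKernel α (e i) s)) l (𝓝 1) := by
  have h1 : Tendsto (fun i => ENNReal.ofReal (1 - rlKernel α (δ / 4) * rlKernel (1 + (1 - α)) (e i)))
      l (𝓝 1) := by
    have hc : Tendsto (fun i => rlKernel (1 + (1 - α)) (e i)) l (𝓝 0) := by
      have h2 : ContinuousAt (fun x : ℝ => rlKernel (1 + (1 - α)) x) 0 := by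
        unfold rlKernel
        exact (Real.continuousAt_rpow_const _ _ (Or.inr (by linarith))).div_const _
      have h3 : rlKernel (1 + (1 - α)) 0 = 0 := by
        unfold rlKernel
        rw [Real.zero_rpow (by linarith), zero_div]
      have h4 := h2.tendsto.comp hl
      rw [h3] at h4
      exact h4
    have := (hc.const_mul (rlKernel α (δ / 4))).const_sub 1
    simpa using ENNReal.tendsto_ofReal this
  refine tendsto_of_tendsto_of_tendsto_of_le_of_le' h1 tendsto_const_nhds ?_
    (.of_forall fun i => lintegral_marchaudKernel_le_one hα₀ hα₁ (he i) δ)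
  filter_upwards [hl.eventually (gt_mem_nhds (show (0 : ℝ) < δ / 4 by positivity))] with i hi
  -- With t > δ/2 and ε < δ/4 one has t - ε > δ/4, so g_α(t-ε) is bounded independently of ε.
  obtain ⟨t, ht, -, h2⟩ := exists_marchaudKernel_mass hα₀ hα₁ (he i)
    (show e i ≤ δ / 2 by linarith) (show δ / 2 < δ by linarith)
  refine le_trans ?_ (lintegral_mono_set (Ioo_subset_Ioo_right ht.2.le))
  rw [lintegral_marchaudKernel_eq hα₀ hα₁ (he i) (by linarith [ht.1])]
  refine ENNReal.ofReal_le_ofReal (le_trans ?_ h2)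
  have a1 : rlKernel α (t - e i) ≤ rlKernel α (δ / 4) :=
    rlKernel_antitone hα₀ hα₁.le (by positivity) (by linarith [ht.1])
  have a2 : 0 ≤ rlKernel (1 + (1 - α)) (e i) := rlKernel_nonneg (by linarith) (he i).le
  nlinarith

end TruncatedMarchaud

/-! ### The chain inequality for convex functionals. -/

section FractionalChainRule

open Filter Topology

/-- If Fi ≤ Ri, the positive part of F - R is at most |Fi - F| + |Ri - R|, so its integral is 0. -/
theorem ae_le_of_tendsto_eLpNorm_one {X ι : Type*} [MeasurableSpace X] {μ : Measure X}
    {l : Filter ι} [l.NeBot] {F R : X → ℝ} {Fi Ri : ι → X → ℝ} (hF : AEStronglyMeasurable F μ)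
    (hR : AEStronglyMeasurable R μ)
    (hFi : ∀ i, AEStronglyMeasurable (Fi i) μ) (hle : ∀ᶠ i in l, Fi i ≤ᵐ[μ] Ri i)
    (h1 : Tendsto (fun i => eLpNorm (fun x => Fi i x - F x) 1 μ) l (𝓝 0))
    (h2 : Tendsto (fun i => eLpNorm (fun x => Ri i x - R x) 1 μ) l (𝓝 0)) : F ≤ᵐ[μ] R := by
  have h3 : ∫⁻ x, ENNReal.ofReal (F x - R x) ∂μ ≤ 0 := by
    have h4 := h1.add h2
    rw [add_zero] at h4
    refine ge_of_tendsto h4 ?_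
    filter_upwards [hle] with i hi
    rw [eLpNorm_one_eq_lintegral_enorm, eLpNorm_one_eq_lintegral_enorm,
      ← lintegral_add_left' (f := fun x => ‖Fi i x - F x‖ₑ) ((hFi i).sub hF).enorm]
    refine lintegral_mono_ae ?_
    filter_upwards [hi] with x hx
    rw [Real.enorm_eq_ofReal_abs, Real.enorm_eq_ofReal_abs,
      ← ENNReal.ofReal_add (abs_nonneg _) (abs_nonneg _)]
    refine ENNReal.ofReal_le_ofReal ?_
    have := neg_abs_le (Fi i x - F x)
    have := le_abs_self (Ri i x - R x)
    linarith
  have h5 := (lintegral_eq_zero_iff' (hF.sub hR).aemeasurable.ennreal_ofReal).1 (le_antisymm h3 bot_le)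
  filter_upwards [h5] with x hx
  have := ENNReal.ofReal_eq_zero.1 hx
  simp only [Pi.sub_apply] at this
  linarith

variable {H : Type*} [NormedAddCommGroup H] [InnerProductSpace ℂ H] {S α : ℝ}

theorem eLpNorm_re_inner_le {X : Type*} [MeasurableSpace X] {μ : Measure X} {p q : ℝ≥0∞}
    [ENNReal.HolderTriple q p 1] {ξ d : X → H} (hξ : AEStronglyMeasurable ξ μ)
    (hd : AEStronglyMeasurable d μ) :
    eLpNorm (fun t => (inner ℂ (ξ t) (d t)).re) 1 μ ≤ eLpNorm ξ q μ * eLpNorm d p μ := by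
  have := eLpNorm_le_eLpNorm_mul_eLpNorm_of_nnnorm (p := q) (q := p) (r := 1) hξ hd
    (fun x y => (inner ℂ x y).re) 1 (.of_forall fun t => ?_)
  · simpa using this
  · rw [one_mul]
    exact (Complex.abs_re_le_norm _).trans (norm_inner_le_norm _ _)

theorem integrable_re_inner {X : Type*} [MeasurableSpace X] {μ : Measure X} {p q : ℝ≥0∞}
    [ENNReal.HolderTriple q p 1] {ξ d : X → H} (hξ : MemLp ξ q μ) (hd : MemLp d p μ) :
    Integrable (fun t => (inner ℂ (ξ t) (d t)).re) μ :=
  memLp_one_iff_integrable.1 ⟨Complex.continuous_re.comp_aestronglyMeasurable (hξ.1.inner hd.1),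
    (eLpNorm_re_inner_le hξ.1 hd.1).trans_lt (ENNReal.mul_lt_top hξ.2 hd.2)⟩

/-- **Chain inequality for fractional integrals.** If `v` is the fractional integral of `d`, and
`ξ(t)` is a subgradient at `v(t)` along the trajectory of a function whose values are `F`, then `F`
is at most the fractional integral of `Re ⟪ξ, d⟫`. -/
theorem le_causalConv_re_inner [CompleteSpace H] (hα₀ : 0 < α) (hα₁ : α < 1) (hS : 0 < S)
    {p q : ℝ≥0∞} (hp1 : 1 ≤ p) (hp : p ≠ ∞) [ENNReal.HolderTriple q p 1] {v d ξ : ℝ → H} {F : ℝ → ℝ}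
    (hd : MemLp d p (volume.restrict (Ioo 0 S)))
    (hξ : MemLp ξ q (volume.restrict (Ioo 0 S)))
    (hv : v =ᵐ[volume.restrict (Ioo 0 S)] causalConv (rlKernel α) d)
    (hF : IntegrableOn F (Ioo 0 S))
    (hF0 : ∀ᵐ t ∂volume.restrict (Ioo 0 S), F t ≤ (inner ℂ (ξ t) (v t)).re)
    (hF1 : ∀ᵐ t ∂volume.restrict (Ioo 0 S), ∀ᵐ s ∂volume.restrict (Ioo 0 S),
      F t - F s ≤ (inner ℂ (ξ t) (v t - v s)).re) :
    ∀ᵐ t ∂volume.restrict (Ioo 0 S),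
      F t ≤ causalConv (rlKernel α) (fun s => (inner ℂ (ξ s) (d s)).re) t := by
  have hg := integrableOn_rlKernel hα₀ S
  have hd1 : IntegrableOn d (Ioo 0 S) := hd.integrable hp1
  have hvi : IntegrableOn v (Ioo 0 S) := (integrableOn_causalConv hg hd1).congr hv.symm
  have hr : IntegrableOn (fun s => (inner ℂ (ξ s) (d s)).re) (Ioo 0 S) := integrable_re_inner hξ hd
  set e : ℕ → ℝ := fun i => 1 / ((i : ℝ) + 1) with he_def
  have he : ∀ i, 0 < e i := fun i => by positivity
  have hel : Tendsto e atTop (𝓝 0) := tendsto_one_div_add_atTop_nhds_zero_nat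
  set ψ : ℕ → ℝ → ℝ := fun i => marchaudKernel α (e i) with hψ_def
  have hψ0 : ∀ i, ∀ s ∈ Ioo 0 S, 0 ≤ ψ i s := fun i s hs => marchaudKernel_nonneg hα₀ hα₁ (he i) hs.1
  have hψ : ∀ i, IntegrableOn (ψ i) (Ioo 0 S) := fun i => integrableOn_marchaudKernel hα₀ hα₁ (he i) S
  have hmass := fun i => lintegral_marchaudKernel_le_one hα₀ hα₁ (he i) S
  have hlim : ∀ δ ∈ Ioc 0 S, Tendsto (fun i => ∫⁻ s in Ioo 0 δ, ENNReal.ofReal (ψ i s)) atTop (𝓝 1) :=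
    fun δ hδ => tendsto_lintegral_marchaudKernel hα₀ hα₁ he hel hδ.1
  have hFt := tendsto_eLpNorm_causalConv_sub hS hψ0 hψ hmass hlim le_rfl ENNReal.one_ne_top
    (memLp_one_iff_integrable.2 hF)
  have hdt := tendsto_eLpNorm_causalConv_sub hS hψ0 hψ hmass hlim hp1 hp hd
  set r : ℝ → ℝ := fun s => (inner ℂ (ξ s) (d s)).re with hr_def
  set ri : ℕ → ℝ → ℝ := fun i s => (inner ℂ (ξ s) (causalConv (ψ i) d s)).re with hri_def
  have hψd : ∀ i, IntegrableOn (causalConv (ψ i) d) (Ioo 0 S) := fun i =>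
    integrableOn_causalConv (hψ i) hd1
  have hdiff : ∀ i, eLpNorm (fun s => ri i s - r s) 1 (volume.restrict (Ioo 0 S)) ≤
      eLpNorm ξ q (volume.restrict (Ioo 0 S)) *
        eLpNorm (fun t => causalConv (ψ i) d t - d t) p (volume.restrict (Ioo 0 S)) := by
    intro i
    refine le_trans (le_of_eq ?_) (eLpNorm_re_inner_le hξ.1 ((hψd i).1.sub hd.1))
    simp [hri_def, hr_def]
  -- For large i the difference ψ_i * d - d has finite Lᵖ norm, because that norm tends to 0; Hölder
  -- against ξ then gives integrability.
  have hri : ∀ᶠ i in atTop, IntegrableOn (ri i) (Ioo 0 S) := by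
    filter_upwards [hdt.eventually (gt_mem_nhds ENNReal.zero_lt_top)] with i hi
    have h1 : IntegrableOn (fun s => ri i s - r s) (Ioo 0 S) := by
      refine memLp_one_iff_integrable.1 ⟨AEStronglyMeasurable.sub
        (Complex.continuous_re.comp_aestronglyMeasurable (hξ.1.inner (hψd i).1)) hr.1, ?_⟩
      exact (hdiff i).trans_lt (ENNReal.mul_lt_top hξ.2 hi)
    exact (h1.add hr).congr (.of_forall fun s => sub_add_cancel (ri i s) (r s))
  refine ae_le_of_tendsto_eLpNorm_one (l := atTop) (Fi := fun i => causalConv (ψ i) F)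
    (Ri := fun i => causalConv (rlKernel α) (ri i)) hF.1 (integrableOn_causalConv hg hr).1
    (fun i => (integrableOn_causalConv (hψ i) hF).1) ?_ hFt ?_
  · filter_upwards [hri] with i hi
    have hκ := integrableOn_marchaudDensity hα₀ hα₁ (he i) S
    have hD : IntegrableOn (fun s => rlKernel (1 - α) (e i) • F s -
        causalConv (marchaudDensity α (e i)) F s) (Ioo 0 S) :=
      (hF.smul (rlKernel (1 - α) (e i))).sub (integrableOn_causalConv hκ hF)
    -- The chain inequality for the truncated derivative: with ξ(t) frozen, the function τ ↦
    -- Re⟨ξ(t), v(τ)⟩ - F(τ) is largest at τ = t by the subgradient property, and its value there is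
    -- nonnegative by the comparison with the initial state.
    have hle : ∀ᵐ t ∂volume.restrict (Ioo 0 S), rlKernel (1 - α) (e i) • F t -
        causalConv (marchaudDensity α (e i)) F t ≤ ri i t := by
      filter_upwards [marchaud_causalConv hα₀ hα₁ (he i) hd1 hv, hF0, hF1,
        ae_intervalIntegrable_causalConv hκ hF, ae_intervalIntegrable_causalConv hκ hvi,
        ae_restrict_mem measurableSet_Ioo] with t h1 h2 h3 h4 h5 ht
      simp only [hri_def, hψ_def]
      rw [← h1]
      set L : H →L[ℝ] ℝ := Complex.reCLM.comp ((innerSL ℂ (ξ t)).restrictScalars ℝ)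
      have hL : ∀ x, L x = (inner ℂ (ξ t) x).re := fun x => rfl
      have h6 := causalConv_clm L h5
      rw [← hL, map_sub, map_smul, ← h6]
      have hLi : IntervalIntegrable (fun τ => marchaudDensity α (e i) (t - τ) • L (v τ)) volume 0 t := by
        have h6' : IntervalIntegrable (fun τ => L (marchaudDensity α (e i) (t - τ) • v τ))
            volume 0 t := ⟨L.integrable_comp h5.1, L.integrable_comp h5.2⟩
        simpa only [map_smul] using h6'
      have h7 := causalConv_marchaudDensity_le hα₀ hα₁ (he i) (G := fun τ => L (v τ) - F τ) ht.1
        (by simpa [smul_sub, mul_sub] using hLi.sub h4) (by simpa [hL] using h2) (by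
          filter_upwards [ae_restrict_of_ae_restrict_of_subset (Ioo_subset_Ioo_right ht.2.le) h3]
            with s hs
          rw [inner_sub_right, Complex.sub_re, ← hL, ← hL] at hs
          linarith)
      have h8 : causalConv (marchaudDensity α (e i)) (fun τ => L (v τ) - F τ) t =
          causalConv (marchaudDensity α (e i)) (fun τ => L (v τ)) t -
            causalConv (marchaudDensity α (e i)) F t := by
        simp only [causalConv, smul_sub]
        exact intervalIntegral.integral_sub hLi h4
      rw [h8] at h7
      simp only [smul_eq_mul]
      linarith
    -- Convolution with the nonnegative kernel g_α preserves the inequality and turns the left side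
    -- into ψ_i * F, which converges to F.
    filter_upwards [causalConv_marchaud hα₀ hα₁ (he i) hF, ae_intervalIntegrable_causalConv hg hD,
      ae_intervalIntegrable_causalConv hg hi, ae_restrict_mem measurableSet_Ioo] with t h1 h2 h3 ht
    simp only [hψ_def]
    rw [← h1]
    refine intervalIntegral.integral_mono_ae_restrict ht.1.le h2 h3 ?_
    rw [← restrict_Ioo_eq_restrict_Icc]
    filter_upwards [ae_restrict_of_ae_restrict_of_subset (Ioo_subset_Ioo_right ht.2.le) hle,
      ae_restrict_mem measurableSet_Ioo] with τ hτ hτm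
    exact mul_le_mul_of_nonneg_left hτ (rlKernel_nonneg hα₀ (by linarith [hτm.2]))
  · have hb : Tendsto (fun i => (∫⁻ t in Ioo 0 S, ‖rlKernel α t‖ₑ) *
        (eLpNorm ξ q (volume.restrict (Ioo 0 S)) *
        eLpNorm (fun t => causalConv (ψ i) d t - d t) p (volume.restrict (Ioo 0 S)))) atTop (𝓝 0) := by
      have h1 := ENNReal.Tendsto.const_mul (a := eLpNorm ξ q (volume.restrict (Ioo 0 S))) hdt
        (Or.inr hξ.2.ne)
      have h2 := ENNReal.Tendsto.const_mul (a := ∫⁻ t in Ioo 0 S, ‖rlKernel α t‖ₑ) h1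
        (Or.inr hg.2.ne)
      simpa using h2
    refine tendsto_of_tendsto_of_tendsto_of_le_of_le' tendsto_const_nhds hb
      (.of_forall fun _ => zero_le) ?_
    filter_upwards [hri] with i hi
    have h1 : eLpNorm (fun t => causalConv (rlKernel α) (ri i) t - causalConv (rlKernel α) r t) 1
        (volume.restrict (Ioo 0 S)) = ∫⁻ t in Ioo 0 S, ‖causalConv (rlKernel α)
          (fun s => ri i s - r s) t‖ₑ := by
      rw [eLpNorm_one_eq_lintegral_enorm]
      refine lintegral_congr_ae ?_
      filter_upwards [ae_intervalIntegrable_causalConv hg hi,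
        ae_intervalIntegrable_causalConv hg hr] with t h2 h3
      congr 1
      simp only [causalConv, smul_sub]
      exact (intervalIntegral.integral_sub h2 h3).symm
    rw [h1]
    refine (lintegral_enorm_causalConv_le hg (hi.sub hr)).trans ?_
    gcongr
    refine le_trans (le_of_eq ?_) (hdiff i)
    rw [eLpNorm_one_eq_lintegral_enorm]
    rfl

end FractionalChainRule

/-! ### Positivity for exponential kernels, and the rotation constant. -/

section Sector

open Filter Topology

variable {H : Type*} [NormedAddCommGroup H] [InnerProductSpace ℂ H] {S α : ℝ}

/-- Needed because the primitive of a merely integrable q is not C¹, yet its squared norm must be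
integrated by parts. -/
theorem AbsolutelyContinuousOnInterval.of_dist_le {X Y : Type*} [PseudoMetricSpace X]
    [PseudoMetricSpace Y] {f : ℝ → X} {g : ℝ → Y} {a b K : ℝ}
    (hg : AbsolutelyContinuousOnInterval g a b)
    (h : ∀ x ∈ uIcc a b, ∀ y ∈ uIcc a b, dist (f x) (f y) ≤ K * dist (g x) (g y)) :
    AbsolutelyContinuousOnInterval f a b := by
  have h1 := Tendsto.const_mul K hg
  rw [mul_zero] at h1
  refine squeeze_zero' (.of_forall fun E => Finset.sum_nonneg fun i _ => dist_nonneg) ?_ h1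
  filter_upwards [mem_inf_of_right (mem_principal_self _)] with E hE
  rw [Finset.mul_sum]
  refine Finset.sum_le_sum fun i hi => ?_
  have := hE.1 i hi
  exact h _ this.1 _ this.2

/-- With Q the primitive of q, Re⟨q, Q⟩ is half the derivative of ‖Q‖². Integration by parts against
the nonincreasing weight leaves only nonnegative terms, since Q(0) = 0. -/
theorem integral_exp_mul_re_inner_primitive_nonneg [CompleteSpace H] {q : ℝ → H} {s c : ℝ}
    (hs : 0 ≤ s) (hc : 0 ≤ c) (hq : IntervalIntegrable q volume 0 s) :
    0 ≤ ∫ t in (0 : ℝ)..s, Real.exp (-(c * t)) * (inner ℂ (q t) (∫ τ in (0 : ℝ)..t, q τ)).re := by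
  set Q : ℝ → H := fun t => ∫ τ in (0 : ℝ)..t, q τ with hQ
  have hP := hq.norm.absolutelyContinuousOnInterval_intervalIntegral (c := 0) left_mem_uIcc
  have hQac : AbsolutelyContinuousOnInterval Q 0 s := by
    refine hP.of_dist_le (K := 1) fun x hx y hy => ?_
    have hi : ∀ z ∈ uIcc 0 s, IntervalIntegrable q volume 0 z := fun z hz =>
      hq.mono_set (uIcc_subset_uIcc_left hz)
    rw [one_mul, dist_eq_norm, dist_eq_norm, hQ]
    simp only
    rw [intervalIntegral.integral_interval_sub_left (hi x hx) (hi y hy),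
      intervalIntegral.integral_interval_sub_left (hi x hx).norm (hi y hy).norm]
    exact intervalIntegral.norm_integral_le_abs_integral_norm
  have hN : AbsolutelyContinuousOnInterval (fun t => ‖Q t‖) 0 s := by
    refine hQac.of_dist_le (K := 1) fun x _ y _ => ?_
    rw [one_mul, dist_eq_norm (Q x)]; exact dist_norm_norm_le (Q x) (Q y)
  have hN2 : AbsolutelyContinuousOnInterval (fun t => ‖Q t‖ * ‖Q t‖) 0 s := hN.mul hN
  have hE : AbsolutelyContinuousOnInterval (fun t => Real.exp (-(c * t))) 0 s := by
    refine ContDiffOn.absolutelyContinuousOnInterval (ContDiff.contDiffOn ?_)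
    fun_prop
  have hd : ∀ᵐ t, t ∈ uIoc 0 s → Real.exp (-(c * t)) * (inner ℂ (q t) (Q t)).re =
      1 / 2 * (Real.exp (-(c * t)) * deriv (fun t => ‖Q t‖ * ‖Q t‖) t) := by
    filter_upwards [hq.ae_hasDerivAt_integral] with t ht htm
    have h1 : HasDerivAt Q (q t) t := ht (uIoc_subset_uIcc htm) 0 left_mem_uIcc
    have h2 := (Complex.reCLM.hasFDerivAt (x := inner ℂ (Q t) (Q t))).comp_hasDerivAt t (h1.inner ℂ h1)
    have h3 : HasDerivAt (fun t => ‖Q t‖ * ‖Q t‖) (2 * (inner ℂ (q t) (Q t)).re) t := by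
      refine (h2.congr_deriv ?_).congr_of_eventuallyEq (.of_forall fun x => ?_)
      · have : (inner ℂ (Q t) (q t)).re = (inner ℂ (q t) (Q t)).re := inner_re_symm (𝕜 := ℂ) _ _
        simp only [Complex.reCLM_apply, Complex.add_re, this]
        ring
      · exact (inner_self_eq_norm_mul_norm (𝕜 := ℂ) (Q x)).symm
    rw [h3.deriv]
    ring
  rw [intervalIntegral.integral_congr_ae hd, intervalIntegral.integral_const_mul,
    hE.integral_mul_deriv_eq_deriv_mul hN2]
  have h0 : Q 0 = 0 := by simp [hQ]
  have h1 : ∫ x in (0 : ℝ)..s, deriv (fun t => Real.exp (-(c * t))) x * (‖Q x‖ * ‖Q x‖) ≤ 0 := by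
    have h2 : 0 ≤ ∫ x in (0 : ℝ)..s, -(deriv (fun t => Real.exp (-(c * t))) x * (‖Q x‖ * ‖Q x‖)) := by
      refine intervalIntegral.integral_nonneg hs fun x _ => ?_
      have : deriv (fun t => Real.exp (-(c * t))) x = Real.exp (-(c * x)) * -c := by
        have := ((hasDerivAt_id x).const_mul c).neg.exp
        simpa using this.deriv
      rw [this]
      have : 0 ≤ Real.exp (-(c * x)) * c * (‖Q x‖ * ‖Q x‖) := by positivity
      linarith
    rw [intervalIntegral.integral_neg] at h2
    linarith
  rw [h0]
  have : 0 ≤ Real.exp (-(c * s)) * (‖Q s‖ * ‖Q s‖) := by positivity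
  simp only [norm_zero, mul_zero]
  linarith

/-- `∫₀^∞ λ^(-α) exp(-(1-i)λ) dλ`, a complex number in the open first quadrant. -/
noncomputable def sectorConst (α : ℝ) : ℂ :=
  ∫ x in Ioi (0 : ℝ), ((x ^ (-α) * Real.exp (-x) : ℝ) : ℂ) * Complex.exp (Complex.I * x)

/-- The bound sin x ≥ x - x³/6 gives Im κ ≥ Γ(2-α) - Γ(4-α)/6 = Γ(2-α)(1 - (3-α)(2-α)/6), and
(3-α)(2-α) < 6. -/
theorem sectorConst_im_pos (hα₀ : 0 < α) (hα₁ : α < 1) : 0 < (sectorConst α).im := by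
  have hG : ∀ {s : ℝ}, 0 < s → IntegrableOn (fun x => Real.exp (-x) * x ^ (s - 1)) (Ioi 0) :=
    fun hs => Real.GammaIntegral_convergent hs
  have hint : IntegrableOn (fun x : ℝ => ((x ^ (-α) * Real.exp (-x) : ℝ) : ℂ) *
      Complex.exp (Complex.I * x)) (Ioi 0) := by
    have h1 := (hG (sub_pos.2 hα₁)).ofReal (𝕜 := ℂ)
    refine Integrable.mono h1 (by fun_prop) (.of_forall fun x => ?_)
    rw [norm_mul, mul_comm Complex.I, Complex.norm_exp_ofReal_mul_I, mul_one,
      show 1 - α - 1 = -α by ring, mul_comm]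
    rfl
  have him : (sectorConst α).im = ∫ x in Ioi (0 : ℝ), x ^ (-α) * Real.exp (-x) * Real.sin x := by
    unfold sectorConst
    rw [← Complex.imCLM_apply, ← Complex.imCLM.integral_comp_comm hint]
    congr 1; ext x
    rw [Complex.imCLM_apply, Complex.im_ofReal_mul, mul_comm Complex.I, Complex.exp_ofReal_mul_I_im]
  have hlow : IntegrableOn (fun x : ℝ => Real.exp (-x) * x ^ ((2 - α) - 1) -
      1 / 6 * (Real.exp (-x) * x ^ ((4 - α) - 1))) (Ioi 0) :=
    (hG (by linarith)).sub ((hG (by linarith)).const_mul _)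
  have hle : ∫ x in Ioi (0 : ℝ), (Real.exp (-x) * x ^ ((2 - α) - 1) -
      1 / 6 * (Real.exp (-x) * x ^ ((4 - α) - 1))) ≤
      ∫ x in Ioi (0 : ℝ), x ^ (-α) * Real.exp (-x) * Real.sin x := by
    refine setIntegral_mono_on hlow ?_ measurableSet_Ioi fun x hx => ?_
    · have h1 := hG (sub_pos.2 hα₁)
      refine Integrable.mono h1 (by fun_prop) (.of_forall fun x => ?_)
      rw [norm_mul, show 1 - α - 1 = -α by ring, mul_comm (Real.exp _)]
      exact mul_le_of_le_one_right (norm_nonneg _) (Real.abs_sin_le_one x)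
    · have hx0 : (0 : ℝ) < x := hx
      have e1 : x ^ ((2 - α) - 1) = x ^ (-α) * x := by
        rw [← Real.rpow_add_one hx0.ne']; congr 1; ring
      have e2 : x ^ ((4 - α) - 1) = x ^ (-α) * x ^ 3 := by
        rw [← Real.rpow_add_natCast hx0.ne']; congr 1; push_cast; ring
      rw [e1, e2]
      have := Real.sin_ge_sub_cube hx0.le
      have h2 : 0 ≤ x ^ (-α) * Real.exp (-x) := by positivity
      calc _ = x ^ (-α) * Real.exp (-x) * (x - x ^ 3 / 6) := by ring
        _ ≤ _ := mul_le_mul_of_nonneg_left this h2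
  rw [him]
  refine lt_of_lt_of_le ?_ hle
  rw [integral_sub (hG (by linarith)) ((hG (by linarith)).const_mul _), integral_const_mul,
    ← Real.Gamma_eq_integral (by linarith), ← Real.Gamma_eq_integral (by linarith),
    show (4 : ℝ) - α = (2 - α + 1) + 1 by ring, Real.Gamma_add_one (by linarith),
    Real.Gamma_add_one (by linarith)]
  have hpos := Real.Gamma_pos_of_pos (show (0 : ℝ) < 2 - α by linarith)
  have : 0 < Real.Gamma (2 - α) * (1 - (2 - α + 1) * (2 - α) / 6) := by
    refine mul_pos hpos ?_
    nlinarith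
  linarith

/-- By scaling, κ t^(α-1) is a superposition with positive weights of the decaying exponentials
exp(-(1-i)λt). This reduces the sector property to single exponentials. -/
theorem integral_rpow_mul_exp_mul_exp_I {t : ℝ} (ht : 0 < t) :
    ∫ x in Ioi (0 : ℝ), ((x ^ (-α) * Real.exp (-(t * x)) : ℝ) : ℂ) *
      Complex.exp (Complex.I * (t * x : ℝ)) = ((t ^ (α - 1) : ℝ) : ℂ) * sectorConst α := by
  have h := integral_comp_mul_left_Ioi (fun x : ℝ => ((x ^ (-α) * Real.exp (-x) : ℝ) : ℂ) *
    Complex.exp (Complex.I * x)) 0 ht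
  rw [mul_zero] at h
  have h2 : ∫ x in Ioi (0 : ℝ), ((x ^ (-α) * Real.exp (-(t * x)) : ℝ) : ℂ) *
      Complex.exp (Complex.I * (t * x : ℝ)) = ((t ^ α : ℝ) : ℂ) * ∫ x in Ioi (0 : ℝ),
        (((t * x) ^ (-α) * Real.exp (-(t * x)) : ℝ) : ℂ) * Complex.exp (Complex.I * (t * x : ℝ)) := by
    rw [← integral_const_mul]
    refine setIntegral_congr_fun measurableSet_Ioi fun x hx => ?_
    have : x ^ (-α) = t ^ α * (t * x) ^ (-α) := by
      rw [Real.mul_rpow ht.le (le_of_lt hx), ← mul_assoc, ← Real.rpow_add ht]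
      simp
    rw [this]
    push_cast
    ring
  rw [h2, h, Real.rpow_sub_one ht.ne', sectorConst, Complex.real_smul]
  push_cast
  ring

end Sector

/-! ### The sector property of the fractional integral. -/

section SectorInequality

open Filter Topology ContinuousLinearMap

/-- The product ‖D t‖‖D τ‖ is at most ‖D t‖² + ‖D τ‖², and each square gives a convolution of two
integrable functions. -/
theorem integrable_kernel_mul_norm_mul_norm {E : Type*} [NormedAddCommGroup E] {ker : ℝ → ℝ} (hker : Integrable ker)
    (hker0 : ∀ x, 0 ≤ ker x) {D : ℝ → E} (hD : MemLp D 2 volume) :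
    Integrable (fun z : ℝ × ℝ => ker (z.1 - z.2) * (‖D z.1‖ * ‖D z.2‖)) (volume.prod volume) := by
  have hD2 : Integrable (fun t => ‖D t‖ ^ 2) := hD.norm.integrable_sq
  have h1 := hD2.convolution_integrand (mul ℝ ℝ) hker
  have h2 := (hD2.convolution_integrand (mul ℝ ℝ) hker.comp_neg).swap
  have hkm : AEStronglyMeasurable (fun z : ℝ × ℝ => ker (z.1 - z.2)) (volume.prod volume) :=
    hker.1.comp_quasiMeasurePreserving (quasiMeasurePreserving_sub_of_right_invariant volume volume)
  refine (h1.add h2).mono (hkm.mul (hD.1.norm.comp_fst.mul hD.1.norm.comp_snd)) (.of_forall ?_)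
  rintro ⟨t, τ⟩
  have hk := hker0 (t - τ)
  simp only [Pi.add_apply, mul_apply', Function.comp_apply, Prod.swap, neg_sub]
  rw [Real.norm_of_nonneg (by positivity), Real.norm_of_nonneg (by positivity)]
  nlinarith [sq_nonneg (‖D t‖ - ‖D τ‖), mul_nonneg hk (sq_nonneg (‖D t‖ - ‖D τ‖)),
    mul_nonneg hk (sq_nonneg ‖D t‖), mul_nonneg hk (sq_nonneg ‖D τ‖)]

variable {H : Type*} [NormedAddCommGroup H] [InnerProductSpace ℂ H] {S α : ℝ}

/-- The symbol `λ^(-α) exp(-(1-i)λx)`, cut off to `0 < x < S`. -/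
noncomputable def sectorSymbol (α S l x : ℝ) : ℂ :=
  (Ioo 0 S).indicator (fun x => ((l ^ (-α) * Real.exp (-(x * l)) : ℝ) : ℂ) *
    Complex.exp (Complex.I * (x * l : ℝ))) x

theorem norm_sectorSymbol {l : ℝ} (hl : 0 < l) (x : ℝ) : ‖sectorSymbol α S l x‖ =
    (Ioo 0 S).indicator (fun x => l ^ (-α) * Real.exp (-(x * l))) x := by
  unfold sectorSymbol
  by_cases h : x ∈ Ioo 0 S
  · rw [indicator_of_mem h, indicator_of_mem h, norm_mul, mul_comm Complex.I,
      Complex.norm_exp_ofReal_mul_I, mul_one, Complex.norm_real, Real.norm_of_nonneg (by positivity)]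
  · simp [h]

theorem measurable_sectorSymbol : Measurable (fun p : ℝ × ℝ => sectorSymbol α S p.1 p.2) := by
  have : (fun p : ℝ × ℝ => sectorSymbol α S p.1 p.2) =
      ({p : ℝ × ℝ | p.2 ∈ Ioo 0 S}).indicator (fun p =>
        ((p.1 ^ (-α) * Real.exp (-(p.2 * p.1)) : ℝ) : ℂ) *
          Complex.exp (Complex.I * (p.2 * p.1 : ℝ))) := by
    ext p
    simp [sectorSymbol, indicator]
  rw [this]
  exact Measurable.indicator (by fun_prop) (measurable_snd measurableSet_Ioo)

theorem integral_sectorSymbol (x : ℝ) : ∫ l in Ioi (0 : ℝ), sectorSymbol α S l x =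
    (((Ioo 0 S).indicator (fun x => x ^ (α - 1)) x : ℝ) : ℂ) * sectorConst α := by
  by_cases h : x ∈ Ioo 0 S
  · simp only [sectorSymbol, indicator_of_mem h]
    exact integral_rpow_mul_exp_mul_exp_I h.1
  · simp [sectorSymbol, h]

/-- Absolute integrability for Fubini: the modulus integrates over λ to Γ(1-α) x^(α-1), a kernel
integrable on (0,S). -/
theorem integrable_sectorSymbol_mul (hα₀ : 0 < α) (hα₁ : α < 1) {D : ℝ → H}
    (hD : MemLp D 2 volume) :
    Integrable (Function.uncurry fun (l : ℝ) (z : ℝ × ℝ) =>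
      sectorSymbol α S l (z.1 - z.2) * inner ℂ (D z.1) (D z.2))
      ((volume.restrict (Ioi 0)).prod (volume.prod volume)) := by
  have hm : AEStronglyMeasurable (Function.uncurry fun (l : ℝ) (z : ℝ × ℝ) =>
      sectorSymbol α S l (z.1 - z.2) * inner ℂ (D z.1) (D z.2))
      ((volume.restrict (Ioi 0)).prod (volume.prod volume)) := by
    refine AEStronglyMeasurable.mul ?_ ?_
    · have : Measurable (fun p : ℝ × ℝ × ℝ => sectorSymbol α S p.1 (p.2.1 - p.2.2)) :=
        (measurable_sectorSymbol (α := α) (S := S)).comp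
          (measurable_fst.prodMk (measurable_snd.fst.sub measurable_snd.snd))
      exact this.aestronglyMeasurable
    · exact (hD.1.comp_fst.inner hD.1.comp_snd).comp_snd
  have h1a : 0 < 1 - α := by linarith
  have hexp : ∀ {x : ℝ}, 0 < x →
      IntegrableOn (fun l : ℝ => l ^ (-α) * Real.exp (-(x * l))) (Ioi 0) ∧
      ∫ l in Ioi (0 : ℝ), l ^ (-α) * Real.exp (-(x * l)) = x ^ (α - 1) * Real.Gamma (1 - α) := by
    intro x hx
    have e := Real.integral_rpow_mul_exp_neg_mul_Ioi h1a hx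
    rw [show 1 - α - 1 = -α by ring, one_div, Real.inv_rpow hx.le, ← Real.rpow_neg hx.le, neg_sub] at e
    refine ⟨?_, e⟩
    -- A nonintegrable function has integral 0 by convention, whereas this integral is known to be
    -- positive.
    by_contra hni
    rw [integral_undef hni] at e
    have := Real.Gamma_pos_of_pos h1a
    have : 0 < x ^ (α - 1) * Real.Gamma (1 - α) := by positivity
    exact this.ne e
  rw [integrable_prod_iff' hm]
  constructor
  · refine .of_forall fun z => ?_
    suffices hs : Integrable (fun l => sectorSymbol α S l (z.1 - z.2)) (volume.restrict (Ioi 0)) from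
      hs.mul_const (inner ℂ (D z.1) (D z.2))
    by_cases h : z.1 - z.2 ∈ Ioo 0 S
    · have hmz : Measurable (fun l : ℝ => sectorSymbol α S l (z.1 - z.2)) :=
        (measurable_sectorSymbol (α := α) (S := S)).comp (measurable_id.prodMk measurable_const)
      refine Integrable.mono ((hexp h.1).1) hmz.aestronglyMeasurable ?_
      filter_upwards [ae_restrict_mem measurableSet_Ioi] with l hl
      rw [norm_sectorSymbol hl, indicator_of_mem h]
      exact le_abs_self _
    · simp [sectorSymbol, indicator_of_notMem h]
  · have hker : Integrable ((Ioo 0 S).indicator (fun x : ℝ => x ^ (α - 1))) := by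
      rw [integrable_indicator_iff measurableSet_Ioo]
      rcases le_total 0 S with hS | hS
      · exact (intervalIntegrable_iff_integrableOn_Ioo_of_le hS).1
          (intervalIntegral.intervalIntegrable_rpow' (by linarith))
      · simp [Ioo_eq_empty_of_le hS]
    have hker0 : ∀ x, 0 ≤ (Ioo 0 S).indicator (fun x : ℝ => x ^ (α - 1)) x := fun x =>
      indicator_nonneg (fun x hx => Real.rpow_nonneg hx.1.le _) x
    have hb := (integrable_kernel_mul_norm_mul_norm hker hker0 hD).const_mul (Real.Gamma (1 - α))
    refine hb.mono hm.prod_swap.norm.integral_prod_right' (.of_forall fun z => ?_)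
    rw [Real.norm_of_nonneg (integral_nonneg fun _ => norm_nonneg _)]
    refine le_trans (le_of_eq ?_) ((mul_le_mul_of_nonneg_left (mul_le_mul_of_nonneg_left
      (norm_inner_le_norm (𝕜 := ℂ) (D z.1) (D z.2)) (hker0 _))
        (Real.Gamma_pos_of_pos h1a).le).trans (le_abs_self _))
    simp only [Function.uncurry, norm_mul]
    rw [integral_mul_const, ← mul_assoc]
    congr 1
    by_cases h : z.1 - z.2 ∈ Ioo 0 S
    · rw [indicator_of_mem h, mul_comm, ← (hexp h.1).2]
      refine setIntegral_congr_fun measurableSet_Ioi fun l hl => ?_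
      rw [norm_sectorSymbol hl, indicator_of_mem h]
    · simp [sectorSymbol, indicator_of_notMem h]

/-- With m = (1-i)λ and q'(t) = exp(mt) q(t), the kernel exp(-m(t-τ)) is absorbed into ⟨q'(t),
q'(τ)⟩ at the price of the weight exp(-2λt), where λ = Re m. The inner integral is then a primitive
of q'. -/
theorem integral_sectorSymbol_mul_re_nonneg [CompleteSpace H] (hS : 0 ≤ S) {l : ℝ} (hl : 0 < l)
    {q : ℝ → H} (hq : IntegrableOn q (Ioo 0 S))
    (hint : Integrable (fun z : ℝ × ℝ => sectorSymbol α S l (z.1 - z.2) *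
      inner ℂ ((Ioo 0 S).indicator q z.1) ((Ioo 0 S).indicator q z.2)) (volume.prod volume)) :
    0 ≤ (∫ z : ℝ × ℝ, sectorSymbol α S l (z.1 - z.2) *
      inner ℂ ((Ioo 0 S).indicator q z.1) ((Ioo 0 S).indicator q z.2)).re := by
  set m : ℂ := (1 - Complex.I) * l with hm
  set q' : ℝ → H := fun t => Complex.exp (m * t) • q t with hq'
  have hq'i : IntervalIntegrable q' volume 0 S :=
    ((intervalIntegrable_iff_integrableOn_Ioo_of_le hS).2 hq).continuousOn_smul (by fun_prop)
  have hslice : ∀ t, ∫ τ, sectorSymbol α S l (t - τ) *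
      inner ℂ ((Ioo 0 S).indicator q t) ((Ioo 0 S).indicator q τ) =
      (Ioo 0 S).indicator (fun t => ((l ^ (-α) * Real.exp (-(2 * l * t)) : ℝ) : ℂ) *
        inner ℂ (q' t) (∫ τ in (0 : ℝ)..t, q' τ)) t := by
    intro t
    by_cases ht : t ∈ Ioo 0 S
    · rw [indicator_of_mem ht, indicator_of_mem ht]
      have hi : IntegrableOn q' (Ioo 0 t) :=
        (intervalIntegrable_iff_integrableOn_Ioo_of_le ht.1.le).1
          (hq'i.mono_set (uIcc_subset_uIcc_left (by rw [uIcc_of_le hS]; exact ⟨ht.1.le, ht.2.le⟩)))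
      rw [intervalIntegral.integral_of_le ht.1.le, integral_Ioc_eq_integral_Ioo,
        ← integral_inner hi, ← integral_const_mul, ← integral_indicator measurableSet_Ioo]
      congr 1; ext τ
      by_cases hτ : τ ∈ Ioo 0 t
      · have h1 : t - τ ∈ Ioo 0 S := ⟨by linarith [hτ.2], by linarith [hτ.1, ht.2]⟩
        have h2 : τ ∈ Ioo 0 S := ⟨hτ.1, hτ.2.trans ht.2⟩
        rw [indicator_of_mem hτ, indicator_of_mem h2, sectorSymbol, indicator_of_mem h1]
        simp only [hq', inner_smul_left, inner_smul_right, ← Complex.exp_conj]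
        have e : Complex.exp ((starRingEnd ℂ) (m * t)) * Complex.exp (m * τ) *
            ((Real.exp (-(2 * l * t)) : ℝ) : ℂ) = ((Real.exp (-((t - τ) * l)) : ℝ) : ℂ) *
            Complex.exp (Complex.I * ((t - τ) * l : ℝ)) := by
          push_cast
          rw [← Complex.exp_add, ← Complex.exp_add, ← Complex.exp_add]
          congr 1
          simp only [hm, map_mul, map_sub, map_one, Complex.conj_I, Complex.conj_ofReal]
          ring
        push_cast at e ⊢
        linear_combination (-(((l ^ (-α) : ℝ) : ℂ) * inner ℂ (q t) (q τ))) * e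
      · rw [indicator_of_notMem hτ]
        by_cases h0 : 0 < τ
        · have : t - τ ∉ Ioo 0 S := fun h1 => hτ ⟨h0, by linarith [h1.1]⟩
          simp [sectorSymbol, indicator_of_notMem this]
        · have : τ ∉ Ioo 0 S := fun h1 => h0 h1.1
          simp [indicator_of_notMem this]
    · simp [indicator_of_notMem ht]
  have hout := hint.integral_prod_left
  rw [show (volume : Measure (ℝ × ℝ)) = volume.prod volume from rfl, integral_prod _ hint]
  simp only [hslice] at hout ⊢
  rw [integrable_indicator_iff measurableSet_Ioo] at hout
  rw [integral_indicator measurableSet_Ioo]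
  have h1 := Complex.reCLM.integral_comp_comm hout
  simp only [Complex.reCLM_apply, Complex.re_ofReal_mul] at h1
  rw [← h1, ← integral_Ioc_eq_integral_Ioo, ← intervalIntegral.integral_of_le hS]
  simp_rw [mul_assoc]
  rw [intervalIntegral.integral_const_mul]
  have h2 := integral_exp_mul_re_inner_primitive_nonneg (c := 2 * l) hS (by positivity) hq'i
  simp_rw [mul_assoc] at h2
  exact mul_nonneg (by positivity) h2

/-- **Sector property of the fractional integral** on `L²(0,S)`. -/
theorem sectorConst_mul_integral_inner_re_nonneg [CompleteSpace H] (hα₀ : 0 < α) (hα₁ : α < 1)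
    (hS : 0 ≤ S) {q : ℝ → H} (hq : MemLp q 2 (volume.restrict (Ioo 0 S))) :
    0 ≤ (sectorConst α * ∫ t in (0 : ℝ)..S, inner ℂ (q t) (causalConv (rlKernel α) q t)).re := by
  set D := (Ioo 0 S).indicator q with hDdef
  have hD : MemLp D 2 volume := (memLp_indicator_iff_restrict measurableSet_Ioo).2 hq
  have hq1 : IntegrableOn q (Ioo 0 S) := hq.integrable (by norm_num)
  set ker := (Ioo 0 S).indicator (fun x : ℝ => x ^ (α - 1)) with hker_def
  have hkerS : IntegrableOn (fun x : ℝ => x ^ (α - 1)) (Ioo 0 S) :=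
    (intervalIntegrable_iff_integrableOn_Ioo_of_le hS).1
      (intervalIntegral.intervalIntegrable_rpow' (by linarith))
  have hker : Integrable ker := (integrable_indicator_iff measurableSet_Ioo).2 hkerS
  have hker0 : ∀ x, 0 ≤ ker x := fun x =>
    indicator_nonneg (fun x hx => Real.rpow_nonneg hx.1.le _) x
  have hΦ := integrable_sectorSymbol_mul (S := S) hα₀ hα₁ hD
  -- Integrating first over time gives a nonnegative real part for each λ; integrating first over λ
  -- produces κ times the kernel x^(α-1).
  have hswap := integral_integral_swap hΦ
  have hpos : 0 ≤ (∫ l in Ioi (0 : ℝ), ∫ z : ℝ × ℝ, sectorSymbol α S l (z.1 - z.2) *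
      inner ℂ (D z.1) (D z.2) ∂(volume.prod volume)).re := by
    have h1 := hΦ.integral_prod_left
    have h2 := Complex.reCLM.integral_comp_comm h1
    simp only [Complex.reCLM_apply, Function.uncurry] at h2
    rw [← h2]
    refine integral_nonneg_of_ae ?_
    filter_upwards [hΦ.prod_right_ae, ae_restrict_mem measurableSet_Ioi] with l h3 hl
    exact integral_sectorSymbol_mul_re_nonneg hS hl hq1 h3
  have hz : ∫ z : ℝ × ℝ, (∫ l in Ioi (0 : ℝ), sectorSymbol α S l (z.1 - z.2) *
      inner ℂ (D z.1) (D z.2)) ∂(volume.prod volume) =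
      sectorConst α * ∫ z : ℝ × ℝ, (ker (z.1 - z.2) : ℂ) * inner ℂ (D z.1) (D z.2)
        ∂(volume.prod volume) := by
    rw [← integral_const_mul]
    congr 1; ext z
    rw [integral_mul_const, integral_sectorSymbol]
    ring
  have hkB : Integrable (fun z : ℝ × ℝ => (ker (z.1 - z.2) : ℂ) * inner ℂ (D z.1) (D z.2))
      (volume.prod volume) := by
    refine (integrable_kernel_mul_norm_mul_norm hker hker0 hD).mono ?_ (.of_forall fun z => ?_)
    · refine AEStronglyMeasurable.mul (Complex.continuous_ofReal.comp_aestronglyMeasurable ?_)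
        (hD.1.comp_fst.inner hD.1.comp_snd)
      exact hker.1.comp_quasiMeasurePreserving
        (quasiMeasurePreserving_sub_of_right_invariant volume volume)
    · rw [norm_mul, Complex.norm_real, norm_mul, Real.norm_of_nonneg (hker0 _), norm_mul, norm_norm,
        norm_norm]
      exact mul_le_mul_of_nonneg_left (norm_inner_le_norm _ _) (hker0 _)
  have hfin : ∫ z : ℝ × ℝ, (ker (z.1 - z.2) : ℂ) * inner ℂ (D z.1) (D z.2) ∂(volume.prod volume) =
      (Real.Gamma α : ℂ) * ∫ t in (0 : ℝ)..S, inner ℂ (q t) (causalConv (rlKernel α) q t) := by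
    rw [integral_prod _ hkB, ← intervalIntegral.integral_const_mul,
      intervalIntegral.integral_of_le hS, integral_Ioc_eq_integral_Ioo,
      ← integral_indicator measurableSet_Ioo]
    refine integral_congr_ae ?_
    filter_upwards [hker.ae_convolution_exists (lsmul ℝ ℝ) ((integrable_indicator_iff measurableSet_Ioo).2 hq1)] with t ht
    by_cases htm : t ∈ Ioo 0 S
    · rw [indicator_of_mem htm]
      have hi : Integrable (fun τ => ker (t - τ) • D τ) := by simpa using ht.integrable_swap
      have h1 : causalConv (fun x : ℝ => x ^ (α - 1)) q t = Real.Gamma α • causalConv (rlKernel α) q t := by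
        rw [← causalConv_const_smul]
        congr 1; ext x
        rw [rlKernel, mul_div_cancel₀ _ (Real.Gamma_pos_of_pos hα₀).ne']
      have h2 := causalConv_eq_integral_indicator htm (fun x : ℝ => x ^ (α - 1)) q
      have h3 : (Real.Gamma α : ℂ) * inner ℂ (q t) (causalConv (rlKernel α) q t) =
          inner ℂ (D t) (∫ τ, ker (t - τ) • D τ) := by
        rw [← h2, h1, hDdef, indicator_of_mem htm, inner_smul_right_eq_smul, Complex.real_smul]
      rw [h3, ← integral_inner hi]
      simp only [inner_smul_right_eq_smul, Complex.real_smul]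
    · rw [indicator_of_notMem htm]
      simp [hDdef, indicator_of_notMem htm]
  have hfinal : 0 ≤ Real.Gamma α * (sectorConst α *
      ∫ t in (0 : ℝ)..S, inner ℂ (q t) (causalConv (rlKernel α) q t)).re := by
    rw [hswap, hz, hfin] at hpos
    rw [← Complex.re_ofReal_mul]
    convert hpos using 2
    ring
  exact nonneg_of_mul_nonneg_right hfinal (Real.Gamma_pos_of_pos hα₀)

end SectorInequality

/-! ### Maximal L² regularity, uniform in the operator. -/

section MaximalRegularity

open Filter Topology

variable {H : Type*} [NormedAddCommGroup H] [InnerProductSpace ℂ H] {S α : ℝ}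

theorem rlKernel_mono {a s t : ℝ} (ha : 1 ≤ a) (hs : 0 ≤ s) (hst : s ≤ t) :
    rlKernel a s ≤ rlKernel a t := by
  unfold rlKernel
  have := Real.Gamma_pos_of_pos (zero_lt_one.trans_le ha)
  gcongr

theorem continuous_rlKernel {a : ℝ} (ha : 1 ≤ a) : Continuous (rlKernel a) := by
  unfold rlKernel
  exact (Real.continuous_rpow_const (by linarith)).div_const _

theorem sector_primitive_nonneg [CompleteSpace H] (hα₀ : 0 < α) (hα₁ : α < 1)
    {B : H →L[ℂ] H} {v d : ℝ → H} (hd : MemLp d 2 (volume.restrict (Ioo 0 S)))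
    (hv : v =ᵐ[volume.restrict (Ioo 0 S)] causalConv (rlKernel α) d) {s : ℝ} (hs : s ∈ Ioo 0 S) :
    0 ≤ (sectorConst α * ∫ t in (0 : ℝ)..s, inner ℂ (B (d t)) (B (v t))).re := by
  have hsub : Ioo 0 s ⊆ Ioo 0 S := Ioo_subset_Ioo_right hs.2.le
  have hBd : MemLp (fun t => B (d t)) 2 (volume.restrict (Ioo 0 s)) :=
    B.comp_memLp' (hd.mono_measure (Measure.restrict_mono hsub le_rfl))
  refine (sectorConst_mul_integral_inner_re_nonneg hα₀ hα₁ hs.1.le hBd).trans_eq ?_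
  congr 2
  rw [intervalIntegral.integral_of_le hs.1.le, intervalIntegral.integral_of_le hs.1.le,
    integral_Ioc_eq_integral_Ioo, integral_Ioc_eq_integral_Ioo]
  refine integral_congr_ae ?_
  have hdS : IntegrableOn d (Ioo 0 S) := hd.integrable (by norm_num)
  have hd1 : IntegrableOn d (Ioo 0 s) := hdS.mono_set hsub
  filter_upwards [ae_restrict_of_ae_restrict_of_subset hsub hv,
    ae_intervalIntegrable_causalConv (integrableOn_rlKernel hα₀ s) hd1] with t h1 h2
  rw [h1]
  congr 1
  exact causalConv_clm (B.restrictScalars ℝ) h2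

/-- Associativity against the constant kernel: double fractional/ordinary integration. -/
theorem causalConv_rlKernel_primitive {E : Type*} [NormedAddCommGroup E] [NormedSpace ℝ E]
    [CompleteSpace E] (hα₀ : 0 < α) {f : ℝ → E} (hf : IntegrableOn f (Ioo 0 S)) :
    ∀ᵐ t ∂volume.restrict (Ioo 0 S),
      causalConv (rlKernel (1 + α)) f t = causalConv (rlKernel α) (fun s => ∫ τ in (0 : ℝ)..s, f τ) t ∧
      causalConv (rlKernel (1 + α)) f t = ∫ s in (0 : ℝ)..t, causalConv (rlKernel α) f s := by
  have h1 : IntegrableOn (fun _ : ℝ => (1 : ℝ)) (Ioo 0 S) := by simp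
  have hg := integrableOn_rlKernel hα₀ S
  have e : ∀ t, 0 < t → causalConv (fun _ : ℝ => (1 : ℝ)) (rlKernel α) t = rlKernel (1 + α) t := by
    intro t ht
    rw [causalConv_one, integral_rlKernel hα₀ ht]
  filter_upwards [causalConv_assoc hg h1 hf, causalConv_assoc h1 hg hf,
    ae_restrict_mem measurableSet_Ioo] with t e1 e2 ht
  have hc : ∀ k : ℝ → ℝ, (∀ s, 0 < s → k s = rlKernel (1 + α) s) →
      causalConv (rlKernel (1 + α)) f t = causalConv k f t := by
    intro k hk
    refine causalConv_congr_ae_left ht f ?_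
    filter_upwards [ae_restrict_mem measurableSet_Ioo] with s hs
    exact (hk s hs.1).symm
  constructor
  · rw [hc _ fun s hs => (causalConv_comm _ _ s).trans (e s hs), e1]
    simp_rw [← causalConv_one]
  · rw [hc _ e, e2, causalConv_one]

/-- Here D = ‖d‖, N = ‖N‖, p is the time weight, r comes from the forcing and b bounds the
initial-value term. Two uses of Young's inequality each cost (γ/4) p D² out of γ p D², and the
second leaves the factor 1/p. -/
theorem regularity_young {γ c e M p P D N b r : ℝ} (hγ : 0 < γ) (hc0 : 0 ≤ c) (he : 0 ≤ e)
    (hp : 0 < p) (hpP : p ≤ P) (hr : r ≤ c * (D * N)) (hb : b ≤ 1 + e + M * D + M * N) :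
    p * (-(γ * D ^ 2) + r) + c * e * b ≤ -(γ / 2) * (p * D ^ 2) + ((c ^ 2 / γ * P + 1) * N ^ 2 +
      (c * e * (1 + e) + (c * e * M) ^ 2) + (c * e * M) ^ 2 / γ * p⁻¹) := by
  have h1 : γ / 4 * D ^ 2 + c ^ 2 / γ * N ^ 2 - c * (D * N) = (γ / 2 * D - c * N) ^ 2 / γ := by
    field_simp; ring
  have h2 : 0 ≤ (γ / 2 * D - c * N) ^ 2 / γ := by positivity
  have h3 : p * r ≤ p * (γ / 4 * D ^ 2 + c ^ 2 / γ * N ^ 2) :=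
    mul_le_mul_of_nonneg_left (by linarith) hp.le
  have h4 : p * (c ^ 2 / γ * N ^ 2) ≤ P * (c ^ 2 / γ * N ^ 2) :=
    mul_le_mul_of_nonneg_right hpP (by positivity)
  have h5 : γ / 4 * (p * D ^ 2) + (c * e * M) ^ 2 / γ * p⁻¹ - c * e * (M * D) =
      (γ / 2 * p * D - c * e * M) ^ 2 / (γ * p) := by
    field_simp; ring
  have h6 : 0 ≤ (γ / 2 * p * D - c * e * M) ^ 2 / (γ * p) := by positivity
  have h7 : c * e * (M * N) ≤ (c * e * M) ^ 2 + N ^ 2 := by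
    have h8 := sq_nonneg (c * e * M - N)
    have h9 : (c * e * M - N) ^ 2 = (c * e * M) ^ 2 + N ^ 2 - 2 * (c * e * (M * N)) := by ring
    have := sq_nonneg (c * e * M)
    have := sq_nonneg N
    linarith
  have h8 : c * e * b ≤ c * e * (1 + e + M * D + M * N) :=
    mul_le_mul_of_nonneg_left hb (by positivity)
  have e1 : c * e * (1 + e + M * D + M * N) =
    c * e * (1 + e) + c * e * (M * D) + c * e * (M * N) := by ring
  have e2 : p * (-(γ * D ^ 2) + r) = p * r - γ * (p * D ^ 2) := by ring
  have e3 : (c ^ 2 / γ * P + 1) * N ^ 2 = P * (c ^ 2 / γ * N ^ 2) + N ^ 2 := by ring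
  have e4 : p * (γ / 4 * D ^ 2 + c ^ 2 / γ * N ^ 2) =
    γ / 4 * (p * D ^ 2) + p * (c ^ 2 / γ * N ^ 2) := by ring
  rw [e2, e3]
  linarith

set_option maxHeartbeats 800000 in
/-- **Maximal `L²` regularity** for `i ∂_t^α u = A u - N`, with a bound that does not depend on the
nonnegative operator `A = B²`. -/
theorem exists_bound_integral_rlKernel_mul_norm_sq [CompleteSpace H] (hα₀ : 0 < α) (hα₁ : α < 1)
    (hS : 0 < S) {M e ν : ℝ} (hM : 0 ≤ M) (he : 0 ≤ e) :
    ∃ K : ℝ, ∀ (A B : H →L[ℂ] H) (u N d : ℝ → H) (u₀ : H),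
      (∀ x y, inner ℂ x (A y) = inner ℂ (B x) (B y)) →
      (∀ t ∈ Ioo 0 S, ‖u t‖ ≤ M) → ‖B u₀‖ ≤ e →
      MemLp N 2 (volume.restrict (Ioo 0 S)) → ∫ t in Ioo 0 S, ‖N t‖ ^ 2 ≤ ν →
      MemLp d 2 (volume.restrict (Ioo 0 S)) →
      (∀ᵐ t ∂volume.restrict (Ioo 0 S), Complex.I • d t = A (u t) - N t) →
      (fun t => u t - u₀) =ᵐ[volume.restrict (Ioo 0 S)] causalConv (rlKernel α) d →
      ∀ᵐ t ∂volume.restrict (Ioo 0 S),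
        ∫ τ in (0 : ℝ)..t, rlKernel (1 + α) (t - τ) * ‖d τ‖ ^ 2 ≤ K := by
  set γ := (sectorConst α).im with hγdef
  have hγ : 0 < γ := sectorConst_im_pos hα₀ hα₁
  set c := ‖sectorConst α‖ with hcdef
  have hc0 : 0 ≤ c := norm_nonneg _
  -- This weight is chosen because g_(1+α) * d is the primitive of v = g_α * d: it replaces the term
  -- with A u₀, for which no uniform bound is at hand, by one with B u₀.
  set p := rlKernel (1 + α) with hp
  set GG := Real.Gamma (1 + α) * Real.Gamma (1 - α) with hGG
  have hGGpos : 0 < GG := mul_pos (Real.Gamma_pos_of_pos (by linarith))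
    (Real.Gamma_pos_of_pos (by linarith))
  set k := rlKernel (1 - α) with hk
  set Z := (c ^ 2 / γ * p S + 1) * ν + (c * e * (1 + e) + (c * e * M) ^ 2) * S +
    (c * e * M) ^ 2 / γ * GG * rlKernel (1 + (1 - α)) S with hZ
  refine ⟨2 / γ * Z, fun A B u N d u₀ hAB hu hBu hN hNν hd heq hv => ?_⟩
  set v : ℝ → H := fun t => u t - u₀ with hvdef
  have hd1 : IntegrableOn d (Ioo 0 S) := hd.integrable (by norm_num)
  have hg := integrableOn_rlKernel hα₀ S
  have hvi : IntegrableOn v (Ioo 0 S) := (integrableOn_causalConv hg hd1).congr hv.symm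
  have hd2 : IntegrableOn (fun t => ‖d t‖ ^ 2) (Ioo 0 S) := hd.norm.integrable_sq
  have hN2 : IntegrableOn (fun t => ‖N t‖ ^ 2) (Ioo 0 S) := hN.norm.integrable_sq
  have hdN : IntegrableOn (fun t => inner ℂ (d t) (N t)) (Ioo 0 S) := by
    refine Integrable.mono (hd2.add hN2) (hd.1.inner hN.1) (.of_forall fun t => ?_)
    refine (norm_inner_le_norm _ _).trans ?_
    simp only [Pi.add_apply]
    rw [Real.norm_of_nonneg (by positivity)]
    nlinarith [sq_nonneg (‖d t‖ - ‖N t‖), sq_nonneg ‖d t‖, sq_nonneg ‖N t‖]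
  have hdA : IntegrableOn (fun t => inner ℂ (d t) (A u₀)) (Ioo 0 S) := hd1.inner_const (𝕜 := ℂ) (A u₀)
  -- The equation in the form A v = i d + N - A u₀. After multiplication by κ the first term has
  -- real part -(Im κ)‖d‖².
  have hAv : ∀ᵐ t ∂volume.restrict (Ioo 0 S), inner ℂ (B (d t)) (B (v t)) =
      Complex.I * (‖d t‖ ^ 2 : ℝ) + inner ℂ (d t) (N t) - inner ℂ (d t) (A u₀) := by
    filter_upwards [heq] with t ht
    rw [← hAB, hvdef]
    simp only [map_sub]
    rw [show A (u t) = Complex.I • d t + N t by rw [ht]; abel, inner_sub_right, inner_add_right,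
      inner_smul_right, inner_self_eq_norm_sq_to_K]
    norm_cast
  set ρ : ℝ → ℝ := fun t => -(γ * ‖d t‖ ^ 2) + (sectorConst α * inner ℂ (d t) (N t)).re -
    (sectorConst α * inner ℂ (d t) (A u₀)).re with hρ
  have hρN : IntegrableOn (fun t => (sectorConst α * inner ℂ (d t) (N t)).re) (Ioo 0 S) :=
    Complex.reCLM.integrable_comp (hdN.const_mul _)
  have hρA : IntegrableOn (fun t => (sectorConst α * inner ℂ (d t) (A u₀)).re) (Ioo 0 S) :=
    Complex.reCLM.integrable_comp (hdA.const_mul _)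
  have hρi : IntegrableOn ρ (Ioo 0 S) := ((hd2.const_mul γ).neg.add hρN).sub hρA
  have hprim : ∀ s ∈ Ioo 0 S, 0 ≤ ∫ t in (0 : ℝ)..s, ρ t := by
    intro s hs
    refine (sector_primitive_nonneg (B := B) hα₀ hα₁ hd hv hs).trans_eq ?_
    have hsub : Ioo 0 s ⊆ Ioo 0 S := Ioo_subset_Ioo_right hs.2.le
    have hBi : IntegrableOn (fun t => inner ℂ (B (d t)) (B (v t))) (Ioo 0 s) := by
      refine IntegrableOn.mono_set ?_ hsub
      refine Integrable.congr ?_ (hAv.mono fun t ht => ht.symm)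
      exact ((hd2.ofReal.const_mul _).add hdN).sub hdA
    rw [intervalIntegral.integral_of_le hs.1.le, intervalIntegral.integral_of_le hs.1.le,
      integral_Ioc_eq_integral_Ioo, integral_Ioc_eq_integral_Ioo, ← integral_const_mul]
    have := Complex.reCLM.integral_comp_comm (hBi.const_mul (sectorConst α))
    simp only [Complex.reCLM_apply] at this
    rw [← this]
    refine integral_congr_ae ?_
    filter_upwards [ae_restrict_of_ae_restrict_of_subset hsub hAv] with t ht
    rw [ht]
    simp only [hρ, mul_add, mul_sub, Complex.add_re, Complex.sub_re]
    congr 2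
    rw [← mul_assoc, Complex.re_mul_ofReal]
    simp [hγdef]
  filter_upwards [causalConv_rlKernel_primitive hα₀ hρi, causalConv_rlKernel_primitive hα₀ hd1,
    ae_restrict_mem measurableSet_Ioo] with T h1 h2 hT
  have hsub : Ioo 0 T ⊆ Ioo 0 S := Ioo_subset_Ioo_right hT.2.le
  have hpc : ContinuousOn (fun t => p (T - t)) (uIcc 0 T) :=
    ((continuous_rlKernel (by linarith)).comp (by fun_prop)).continuousOn
  have hint : ∀ {f : ℝ → ℝ}, IntegrableOn f (Ioo 0 S) →
      IntervalIntegrable (fun t => p (T - t) * f t) volume 0 T := fun hf =>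
    (intervalIntegrable_of_integrableOn hf hT).continuousOn_mul hpc
  -- All primitives of ρ are nonnegative by the sector property on each (0,s), and g_(1+α) * ρ is
  -- g_α convolved with the primitive.
  have hpos : 0 ≤ causalConv p ρ T := by
    rw [h1.1]
    refine intervalIntegral.integral_nonneg hT.1.le fun s hs => ?_
    refine mul_nonneg (rlKernel_nonneg hα₀ (by linarith [hs.2])) ?_
    rcases hs.1.eq_or_lt with h0 | h0
    · simp [← h0]
    · exact hprim s ⟨h0, hs.2.trans_lt hT.2⟩
  set w : H := ∫ s in (0 : ℝ)..T, v s with hw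
  have hwp : causalConv p d T = w := by
    rw [h2.2, hw]
    rw [intervalIntegral.integral_of_le hT.1.le, intervalIntegral.integral_of_le hT.1.le,
      integral_Ioc_eq_integral_Ioo, integral_Ioc_eq_integral_Ioo]
    exact integral_congr_ae (ae_restrict_of_ae_restrict_of_subset hsub (hv.mono fun _ h => h.symm))
  have hwA : ∫ t in (0 : ℝ)..T, p (T - t) * (sectorConst α * inner ℂ (d t) (A u₀)).re =
      (sectorConst α * inner ℂ w (A u₀)).re := by
    have hpd : IntervalIntegrable (fun t => p (T - t) • d t) volume 0 T :=
      (intervalIntegrable_of_integrableOn hd1 hT).continuousOn_smul hpc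
    set L : H →L[ℝ] ℝ := Complex.reCLM.comp ((ContinuousLinearMap.mul ℝ ℂ (sectorConst α)).comp
      (Complex.conjCLE.toContinuousLinearMap.comp ((innerSL ℂ (A u₀)).restrictScalars ℝ))) with hL
    have hLx : ∀ x, L x = (sectorConst α * inner ℂ x (A u₀)).re := by
      intro x
      simp [hL]
    rw [← hwp, ← hLx, ← causalConv_clm L hpd]
    simp only [causalConv, smul_eq_mul, hLx]
  have hI1 : IntervalIntegrable (fun t => p (T - t) * (-(γ * ‖d t‖ ^ 2) +
      (sectorConst α * inner ℂ (d t) (N t)).re)) volume 0 T :=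
    hint ((hd2.const_mul γ).neg.add hρN)
  have hsplit : causalConv p ρ T = (∫ t in (0 : ℝ)..T, p (T - t) * (-(γ * ‖d t‖ ^ 2) +
      (sectorConst α * inner ℂ (d t) (N t)).re)) - (sectorConst α * inner ℂ w (A u₀)).re := by
    rw [← hwA, ← intervalIntegral.integral_sub hI1 (hint hρA)]
    simp only [causalConv, hρ, smul_eq_mul, mul_sub]
  have hBv : IntervalIntegrable (fun t => B (v t)) volume 0 T :=
    intervalIntegrable_of_integrableOn (B.integrable_comp hvi) hT
  -- One factor B is moved onto w, so that only ‖B u₀‖ ≤ e enters and the bound stays independent of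
  -- the size of A.
  have hwB : |(sectorConst α * inner ℂ w (A u₀)).re| ≤ ∫ t in (0 : ℝ)..T, c * e * ‖B (v t)‖ := by
    rw [intervalIntegral.integral_const_mul]
    refine (Complex.abs_re_le_norm _).trans ?_
    rw [norm_mul, hAB, mul_assoc]
    refine mul_le_mul_of_nonneg_left ?_ hc0
    refine (norm_inner_le_norm _ _).trans ?_
    rw [mul_comm]
    refine mul_le_mul hBu ?_ (norm_nonneg _) he
    have hBw : B w = ∫ t in (0 : ℝ)..T, B (v t) :=
      (B.intervalIntegral_comp_comm (intervalIntegrable_of_integrableOn hvi hT)).symm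
    rw [hBw]
    exact intervalIntegral.norm_integral_le_integral_norm hT.1.le
  set Y : ℝ → ℝ := fun t => (c ^ 2 / γ * p S + 1) * ‖N t‖ ^ 2 +
    (c * e * (1 + e) + (c * e * M) ^ 2) + (c * e * M) ^ 2 / γ * GG * k (T - t) with hY
  have hki : IntervalIntegrable (fun t => k (T - t)) volume 0 T := by
    have := ((intervalIntegrable_rlKernel (sub_pos.2 hα₁) 0 T).comp_sub_left T).symm
    simpa using this
  have hNi : IntervalIntegrable (fun t => ‖N t‖ ^ 2) volume 0 T :=
    intervalIntegrable_of_integrableOn hN2 hT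
  have hYi : IntervalIntegrable Y volume 0 T :=
    ((hNi.const_mul _).add intervalIntegrable_const).add (hki.const_mul _)
  have hmono : ∫ t in (0 : ℝ)..T, (p (T - t) * (-(γ * ‖d t‖ ^ 2) +
      (sectorConst α * inner ℂ (d t) (N t)).re) + c * e * ‖B (v t)‖) ≤
      ∫ t in (0 : ℝ)..T, (-(γ / 2) * (p (T - t) * ‖d t‖ ^ 2) + Y t) := by
    refine intervalIntegral.integral_mono_ae_restrict hT.1.le
      (hI1.add (hBv.norm.const_mul _))
      (((hint hd2).const_mul _).add hYi) ?_
    rw [← restrict_Ioo_eq_restrict_Icc]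
    filter_upwards [ae_restrict_of_ae_restrict_of_subset hsub heq, ae_restrict_mem measurableSet_Ioo]
      with t ht htm
    have hpt : 0 < p (T - t) := rlKernel_pos (by linarith) (by linarith [htm.2])
    have hpS : p (T - t) ≤ p S := rlKernel_mono (by linarith) (by linarith [htm.2])
      (by linarith [htm.1, hT.2])
    -- The factor 1/p left by Young's inequality is a multiple of (T-t)^(-α), which is integrable
    -- because α < 1.
    have hkp : GG * k (T - t) = (p (T - t))⁻¹ := by
      have hx : 0 < T - t := by linarith [htm.2]
      have g1 := (Real.Gamma_pos_of_pos (show 0 < 1 + α by linarith)).ne'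
      have g2 := (Real.Gamma_pos_of_pos (show 0 < 1 - α by linarith)).ne'
      rw [hGG, hk, hp, rlKernel, rlKernel, show 1 - α - 1 = -α by ring, add_sub_cancel_left,
        Real.rpow_neg hx.le]
      field_simp
    have hAu : ‖A (u t)‖ ≤ ‖d t‖ + ‖N t‖ := by
      rw [show A (u t) = Complex.I • d t + N t by rw [ht]; abel]
      refine (norm_add_le _ _).trans ?_
      rw [norm_smul, Complex.norm_I, one_mul]
    -- Interpolation: ‖Bu‖² = ⟨u, Au⟩, and Au is known from the equation. Hence ‖Bu‖ grows at most
    -- like the square root of ‖d‖ and can be absorbed.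
    have hBu2 : ‖B (u t)‖ ^ 2 ≤ M * (‖d t‖ + ‖N t‖) := by
      have h3 : ‖B (u t)‖ ^ 2 = ‖inner ℂ (u t) (A (u t))‖ := by
        rw [hAB, inner_self_eq_norm_sq_to_K]
        simp
      rw [h3]
      refine (norm_inner_le_norm _ _).trans ?_
      exact mul_le_mul (hu t (hsub htm)) hAu (norm_nonneg _) hM
    have hBvt : ‖B (v t)‖ ≤ 1 + e + M * ‖d t‖ + M * ‖N t‖ := by
      have h3 : ‖B (v t)‖ ≤ ‖B (u t)‖ + ‖B u₀‖ := by
        rw [hvdef]; simp only [map_sub]; exact norm_sub_le _ _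
      nlinarith [sq_nonneg (‖B (u t)‖ - 1)]
    have h3 : (sectorConst α * inner ℂ (d t) (N t)).re ≤ c * (‖d t‖ * ‖N t‖) := by
      refine (Complex.re_le_norm _).trans ?_
      rw [norm_mul]
      exact mul_le_mul_of_nonneg_left (norm_inner_le_norm _ _) hc0
    simp only [hY]
    rw [mul_assoc _ GG, hkp]
    exact regularity_young hγ hc0 he hpt hpS h3 hBvt
  have hYle : ∫ t in (0 : ℝ)..T, Y t ≤ Z := by
    have e1 : ∫ t in (0 : ℝ)..T, Y t = (c ^ 2 / γ * p S + 1) * (∫ t in (0 : ℝ)..T, ‖N t‖ ^ 2) +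
        (c * e * (1 + e) + (c * e * M) ^ 2) * T +
        (c * e * M) ^ 2 / γ * GG * rlKernel (1 + (1 - α)) T := by
      simp only [hY]
      rw [intervalIntegral.integral_add ((hNi.const_mul _).add intervalIntegrable_const)
        (hki.const_mul _), intervalIntegral.integral_add (hNi.const_mul _) intervalIntegrable_const,
        intervalIntegral.integral_const_mul, intervalIntegral.integral_const_mul,
        intervalIntegral.integral_const, intervalIntegral.integral_comp_sub_left (fun x => k x) T,
        sub_self, sub_zero, integral_rlKernel (by linarith) hT.1, smul_eq_mul, mul_comm T]
    have e2 : ∫ t in (0 : ℝ)..T, ‖N t‖ ^ 2 ≤ ν := by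
      rw [intervalIntegral.integral_of_le hT.1.le, integral_Ioc_eq_integral_Ioo]
      exact (setIntegral_mono_set hN2 (.of_forall fun _ => by positivity) hsub.eventuallyLE).trans hNν
    have e3 : rlKernel (1 + (1 - α)) T ≤ rlKernel (1 + (1 - α)) S :=
      rlKernel_mono (by linarith) hT.1.le hT.2.le
    have hpS0 : 0 ≤ p S := rlKernel_nonneg (by linarith) hS.le
    rw [e1, hZ]
    gcongr
    exact hT.2.le
  have hfin : γ / 2 * ∫ τ in (0 : ℝ)..T, p (T - τ) * ‖d τ‖ ^ 2 ≤ Z := by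
    rw [intervalIntegral.integral_add hI1 (hBv.norm.const_mul _),
      intervalIntegral.integral_add ((hint hd2).const_mul _) hYi,
      intervalIntegral.integral_const_mul (-(γ / 2))] at hmono
    have := neg_abs_le (sectorConst α * inner ℂ w (A u₀)).re
    linarith
  calc ∫ τ in (0 : ℝ)..T, p (T - τ) * ‖d τ‖ ^ 2
      = 2 / γ * (γ / 2 * ∫ τ in (0 : ℝ)..T, p (T - τ) * ‖d τ‖ ^ 2) := by field_simp
    _ ≤ 2 / γ * Z := by gcongr

end MaximalRegularity

/-! ### Multiplication operators and spectral cut-offs. -/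

noncomputable section Multiplication

open Filter Topology

variable {X : Type*} [MeasurableSpace X] {μ : Measure X}

/-- Multiplication by a bounded real function on `L²`. -/
def mulCLM {m : X → ℝ} (hm : MemLp m ∞ μ) : Lp ℂ 2 μ →L[ℂ] Lp ℂ 2 μ :=
  (ContinuousLinearMap.mul ℂ ℂ).holderL μ ∞ 2 2 (hm.ofReal (K := ℂ)).toLp

theorem coeFn_mulCLM {m : X → ℝ} (hm : MemLp m ∞ μ) (f : Lp ℂ 2 μ) :
    mulCLM hm f =ᵐ[μ] fun x => (m x : ℂ) * f x := by
  have h := (ContinuousLinearMap.mul ℂ ℂ).coeFn_holder (r := 2) (hm.ofReal (K := ℂ)).toLp f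
  filter_upwards [h, (hm.ofReal (K := ℂ)).coeFn_toLp] with x h1 h2
  rw [mulCLM, ContinuousLinearMap.holderL_apply_apply, h1, h2]
  rfl

theorem mulCLM_mulCLM {m m₁ m₂ : X → ℝ} (hm : MemLp m ∞ μ) (h₁ : MemLp m₁ ∞ μ) (h₂ : MemLp m₂ ∞ μ)
    (h : ∀ x, m₁ x * m₂ x = m x) (f : Lp ℂ 2 μ) : mulCLM h₁ (mulCLM h₂ f) = mulCLM hm f := by
  refine Lp.ext ?_
  filter_upwards [coeFn_mulCLM h₁ (mulCLM h₂ f), coeFn_mulCLM h₂ f, coeFn_mulCLM hm f] with x e1 e2 e3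
  rw [e1, e2, e3, ← h x]
  push_cast
  ring

theorem inner_mulCLM {m : X → ℝ} (hm : MemLp m ∞ μ) (f g : Lp ℂ 2 μ) :
    inner ℂ f (mulCLM hm g) = inner ℂ (mulCLM hm f) g := by
  rw [L2.inner_def, L2.inner_def]
  refine integral_congr_ae ?_
  filter_upwards [coeFn_mulCLM hm f, coeFn_mulCLM hm g] with x e1 e2
  rw [e1, e2]
  simp
  ring

theorem enorm_sq_eq_lintegral (f : Lp ℂ 2 μ) : ‖f‖ₑ ^ 2 = ∫⁻ x, ‖f x‖ₑ ^ 2 ∂μ := by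
  rw [Lp.enorm_def, eLpNorm_eq_lintegral_rpow_enorm_toReal (by simp) (by simp)]
  simp only [ENNReal.toReal_ofNat, one_div, ENNReal.rpow_ofNat]
  rw [← ENNReal.rpow_ofNat, ← ENNReal.rpow_mul]
  simp

theorem enorm_mulCLM_sq {m : X → ℝ} (hm : MemLp m ∞ μ) (f : Lp ℂ 2 μ) :
    ‖mulCLM hm f‖ₑ ^ 2 = ∫⁻ x, ‖(m x : ℂ) * f x‖ₑ ^ 2 ∂μ := by
  rw [enorm_sq_eq_lintegral]
  refine lintegral_congr_ae ?_
  filter_upwards [coeFn_mulCLM hm f] with x e1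
  rw [e1]

theorem norm_mulCLM_le {m : X → ℝ} (hm : MemLp m ∞ μ) (h : ∀ x, |m x| ≤ 1) (f : Lp ℂ 2 μ) :
    ‖mulCLM hm f‖ ≤ ‖f‖ := by
  refine Lp.norm_le_norm_of_ae_le ?_
  filter_upwards [coeFn_mulCLM hm f] with x e1
  rw [e1, norm_mul, Complex.norm_real, Real.norm_eq_abs]
  exact mul_le_of_le_one_left (norm_nonneg _) (h x)

variable {a b : X → ℝ}

theorem memLp_indicator_setOf_le (ha : Measurable a) (hb : Measurable b) {R C : ℝ}
    (h : ∀ x, a x ≤ R → |b x| ≤ C) (hC : 0 ≤ C) :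
    MemLp ({x | a x ≤ R}.indicator b) ∞ μ := by
  refine memLp_top_of_bound (hb.indicator (ha measurableSet_Iic)).aestronglyMeasurable C
    (.of_forall fun x => ?_)
  by_cases hx : a x ≤ R
  · rw [indicator_of_mem (show x ∈ {x | a x ≤ R} from hx)]
    exact h x hx
  · rw [indicator_of_notMem (show x ∉ {x | a x ≤ R} from hx)]
    simpa using hC

/-- The spectral projection `1_{a ≤ R}` of the multiplication operator by `a`. -/
def lowPass (μ : Measure X) (ha : Measurable a) (R : ℕ) : Lp ℂ 2 μ →L[ℂ] Lp ℂ 2 μ :=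
  mulCLM (memLp_indicator_setOf_le (R := R) ha (measurable_const (a := 1)) (C := 1) (by simp) zero_le_one)

/-- Multiplication by `a 1_{a ≤ R}`. -/
def lowPassMul (μ : Measure X) (ha : Measurable a) (ha0 : ∀ x, 0 ≤ a x) (R : ℕ) :
    Lp ℂ 2 μ →L[ℂ] Lp ℂ 2 μ :=
  mulCLM (memLp_indicator_setOf_le (R := R) ha ha (C := R)
    (fun x hx => (abs_of_nonneg (ha0 x)).trans_le hx) R.cast_nonneg)

/-- Multiplication by `√a 1_{a ≤ R}`. -/
def lowPassSqrt (μ : Measure X) (ha : Measurable a) (R : ℕ) : Lp ℂ 2 μ →L[ℂ] Lp ℂ 2 μ :=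
  mulCLM (memLp_indicator_setOf_le (R := R) ha ha.sqrt (C := √R)
    (fun _ hx => (abs_of_nonneg (Real.sqrt_nonneg _)).trans_le (Real.sqrt_le_sqrt hx)) (Real.sqrt_nonneg _))

variable (ha : Measurable a) (ha0 : ∀ x, 0 ≤ a x)

theorem lowPass_lowPass (R : ℕ) (f : Lp ℂ 2 μ) : lowPass μ ha R (lowPass μ ha R f) = lowPass μ ha R f :=
  mulCLM_mulCLM _ _ _ (fun x => by simp [indicator]) f

theorem lowPassMul_lowPass (R : ℕ) (f : Lp ℂ 2 μ) :
    lowPassMul μ ha ha0 R (lowPass μ ha R f) = lowPassMul μ ha ha0 R f :=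
  mulCLM_mulCLM _ _ _ (fun x => by by_cases hx : a x ≤ R <;> simp [indicator, hx]) f

theorem lowPass_lowPassMul (R : ℕ) (f : Lp ℂ 2 μ) :
    lowPass μ ha R (lowPassMul μ ha ha0 R f) = lowPassMul μ ha ha0 R f :=
  mulCLM_mulCLM _ _ _ (fun x => by by_cases hx : a x ≤ R <;> simp [indicator, hx]) f

theorem inner_lowPass (R : ℕ) (f g : Lp ℂ 2 μ) :
    inner ℂ f (lowPass μ ha R g) = inner ℂ (lowPass μ ha R f) g := inner_mulCLM _ f g

theorem inner_lowPassMul (R : ℕ) (f g : Lp ℂ 2 μ) :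
    inner ℂ f (lowPassMul μ ha ha0 R g) = inner ℂ (lowPassMul μ ha ha0 R f) g := inner_mulCLM _ f g

theorem inner_lowPassMul_eq_inner_lowPassSqrt (R : ℕ) (f g : Lp ℂ 2 μ) :
    inner ℂ f (lowPassMul μ ha ha0 R g) = inner ℂ (lowPassSqrt μ ha R f) (lowPassSqrt μ ha R g) := by
  rw [lowPassSqrt, ← inner_mulCLM]
  congr 1
  refine (mulCLM_mulCLM _ _ _ (fun x => ?_) g).symm
  by_cases hx : a x ≤ R <;> simp [indicator, hx, Real.mul_self_sqrt (ha0 x)]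

theorem norm_lowPass_le (R : ℕ) (f : Lp ℂ 2 μ) : ‖lowPass μ ha R f‖ ≤ ‖f‖ :=
  norm_mulCLM_le _ (fun x => by by_cases hx : a x ≤ R <;> simp [indicator, hx]) f

theorem tendsto_lowPass (f : Lp ℂ 2 μ) : Tendsto (fun R => lowPass μ ha R f) atTop (𝓝 f) := by
  rw [tendsto_iff_edist_tendsto_0]
  have h : ∀ R, edist (lowPass μ ha R f) f ^ 2 = ∫⁻ x, ({x | a x ≤ R}ᶜ.indicator (fun x => ‖f x‖ₑ ^ 2) x) ∂μ := by
    intro R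
    rw [edist_eq_enorm_sub, enorm_sq_eq_lintegral]
    refine lintegral_congr_ae ?_
    filter_upwards [Lp.coeFn_sub (lowPass μ ha R f) f, coeFn_mulCLM (memLp_indicator_setOf_le (R := R) ha
      (measurable_const (a := 1)) (C := 1) (by simp) zero_le_one) f] with x e1 e2
    rw [e1, Pi.sub_apply, lowPass, e2]
    by_cases hx : a x ≤ R <;> simp [indicator, hx]
  have h2 : Tendsto (fun R => edist (lowPass μ ha R f) f ^ 2) atTop (𝓝 0) := by
    simp_rw [h]
    rw [← lintegral_zero (μ := μ)]
    refine tendsto_lintegral_of_dominated_convergence' (fun x => ‖f x‖ₑ ^ 2) (fun R => ?_)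
      (fun R => .of_forall fun x => indicator_le_self _ _ _) ?_ (.of_forall fun x => ?_)
    · exact ((Lp.aestronglyMeasurable f).enorm.pow_const 2).indicator (ha measurableSet_Iic).compl
    · rw [← enorm_sq_eq_lintegral]
      simp
    · refine tendsto_const_nhds.congr' ?_
      obtain ⟨R₀, hR₀⟩ := exists_nat_ge (a x)
      filter_upwards [eventually_ge_atTop R₀] with R hR
      have : a x ≤ R := hR₀.trans (by exact_mod_cast hR)
      simp [indicator, this]
  have h3 : ∀ x : ℝ≥0∞, (x ^ 2) ^ (1 / 2 : ℝ) = x := fun x => by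
    rw [← ENNReal.rpow_ofNat, ← ENNReal.rpow_mul]; simp
  have h4 := h2.ennrpow_const (1 / 2 : ℝ)
  simp only [h3] at h4
  simpa using h4

/-- Fatou's lemma: at each point the cut-off is eventually inactive. -/
theorem lintegral_le_liminf_enorm_lowPassMul (f : Lp ℂ 2 μ) :
    ∫⁻ x, ‖(a x : ℂ) * f x‖ₑ ^ 2 ∂μ ≤ liminf (fun R => ‖lowPassMul μ ha ha0 R f‖ₑ ^ 2) atTop := by
  simp_rw [lowPassMul, enorm_mulCLM_sq]
  refine le_trans (lintegral_mono fun x => ?_) (lintegral_liminf_le' fun R => ?_)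
  · refine le_of_eq (Tendsto.liminf_eq ?_).symm
    refine tendsto_const_nhds.congr' ?_
    obtain ⟨R₀, hR₀⟩ := exists_nat_ge (a x)
    filter_upwards [eventually_ge_atTop R₀] with R hR
    have : a x ≤ R := hR₀.trans (by exact_mod_cast hR)
    simp [indicator, this]
  · refine AEMeasurable.pow_const (AEStronglyMeasurable.enorm ?_) 2
    refine AEStronglyMeasurable.mul ?_ (Lp.aestronglyMeasurable f)
    exact (Complex.measurable_ofReal.comp (ha.indicator (ha measurableSet_Iic))).aestronglyMeasurable

theorem enorm_lowPassSqrt_sq_le (R : ℕ) (f : Lp ℂ 2 μ) :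
    ‖lowPassSqrt μ ha R f‖ₑ ^ 2 ≤ ∫⁻ x, ‖((√(a x) : ℝ) : ℂ) * f x‖ₑ ^ 2 ∂μ := by
  rw [lowPassSqrt, enorm_mulCLM_sq]
  refine lintegral_mono fun x => ?_
  by_cases hx : a x ≤ R <;> simp [indicator, hx]

theorem lowPass_eq_lowPassMul_of_ae_eq {f g : Lp ℂ 2 μ} (h : g =ᵐ[μ] fun x => (a x : ℂ) * f x) (R : ℕ) :
    lowPass μ ha R g = lowPassMul μ ha ha0 R f := by
  refine Lp.ext ?_
  refine (coeFn_mulCLM _ g).trans (Filter.EventuallyEq.trans ?_ (coeFn_mulCLM _ f).symm)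
  filter_upwards [h] with x hx
  rw [hx]
  by_cases hx : a x ≤ R <;> simp [indicator, hx]

end Multiplication

/-! ### From the weak formulation to a truncated equation in L². -/

section WeakEquation

open Filter Topology

theorem ContinuousOn.memLp_Ioo {E : Type*} [NormedAddCommGroup E] {u : ℝ → E} {S T : ℝ}
    (hu : ContinuousOn u (Ico 0 T)) (hS : S < T) (p : ℝ≥0∞) :
    MemLp u p (volume.restrict (Ioo 0 S)) := by
  have hc : ContinuousOn u (Icc 0 S) := hu.mono (Icc_subset_Ico_right hS)
  obtain ⟨C, hC⟩ := isCompact_Icc.exists_bound_of_continuousOn hc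
  refine MemLp.of_bound ((hc.mono Ioo_subset_Icc_self).aestronglyMeasurable measurableSet_Ioo) C ?_
  filter_upwards [ae_restrict_mem measurableSet_Ioo] with t ht
  exact hC t (Ioo_subset_Icc_self ht)

theorem measurable_fracLaplaceSymbol {n : ℕ} (s : ℝ) :
    Measurable (fracLaplaceSymbol (n := n) s) := by
  unfold fracLaplaceSymbol
  fun_prop

theorem fracLaplaceSymbol_nonneg {n : ℕ} (s : ℝ) (ξ : EuclideanSpace ℝ (Fin n)) :
    0 ≤ fracLaplaceSymbol s ξ := by
  unfold fracLaplaceSymbol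
  positivity

theorem fracLaplaceSymbol_half {n : ℕ} (s : ℝ) (ξ : EuclideanSpace ℝ (Fin n)) :
    fracLaplaceSymbol (s / 2) ξ = √(fracLaplaceSymbol s ξ) := by
  have h : 0 ≤ 2 * Real.pi * ‖ξ‖ := by positivity
  rw [fracLaplaceSymbol, fracLaplaceSymbol, Real.sqrt_eq_rpow, ← Real.rpow_mul h]
  congr 1
  ring

variable {n : ℕ} {α β T : ℝ} {q : ℝ≥0∞} {u₀ : L2 n} {u : ℝ → L2 n}

/-- The spectral truncation of the equation for `u`, in integrated form. -/
theorem lowPass_sub_ae_eq_causalConv (hα₀ : 0 < α) (hα₁ : α < 1) (hq : 1 ≤ q)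
    (hcont : ContinuousOn u (Ico 0 T)) (h0 : u 0 = u₀) {N : ℝ → L2 n}
    (hN : ∀ T' < T, MemLp N q (volume.restrict (Ioo 0 T')))
    (heq : ∀ φ ψ : L2 n, IsFracLaplacian β φ ψ →
      ∃ d : ℝ → ℂ, IsCaputoDerivOn α T (fun t => inner ℂ φ (u t)) d ∧
        ∀ᵐ t, t ∈ Ioo 0 T →
          Complex.I * d t - inner ℂ ψ (u t) + inner ℂ φ (N t) = 0)
    (ha : Measurable (fracLaplaceSymbol (n := n) β)) (ha0 : ∀ ξ, 0 ≤ fracLaplaceSymbol (n := n) β ξ)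
    {S : ℝ} (hS : S ∈ Ioo 0 T) (R : ℕ) :
    (fun t => lowPass volume ha R (𝓕 (u t) - 𝓕 u₀)) =ᵐ[volume.restrict (Ioo 0 S)]
      causalConv (rlKernel α) (fun t => -Complex.I •
        (lowPassMul volume ha ha0 R (𝓕 (u t)) - lowPass volume ha R (𝓕 (N t)))) := by
  have hF : Continuous (fun f : L2 n => (𝓕 f : L2 n)) := continuous_fourier
  set P := lowPass volume ha R with hP
  set A := lowPassMul volume ha ha0 R with hA
  have hU : ContinuousOn (fun t => (𝓕 (u t) : L2 n)) (Ico 0 T) := hF.comp_continuousOn hcont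
  have hvc : ContinuousOn (fun t => P (𝓕 (u t) - 𝓕 u₀)) (Ico 0 T) :=
    P.continuous.comp_continuousOn (hU.sub continuousOn_const)
  have hAc : ContinuousOn (fun t => A (𝓕 (u t))) (Ico 0 T) := A.continuous.comp_continuousOn hU
  have hNi : IntegrableOn N (Ioo 0 S) := (hN S hS.2).integrable hq
  have hNF : IntegrableOn (fun t => (𝓕 (N t) : L2 n)) (Ioo 0 S) :=
    ((Lp.fourierTransformₗᵢ (EuclideanSpace ℝ (Fin n)) ℂ).toContinuousLinearEquiv :
      L2 n →L[ℂ] L2 n).integrable_comp hNi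
  set d : ℝ → L2 n := fun t => -Complex.I • (A (𝓕 (u t)) - P (𝓕 (N t))) with hd
  have hdi : IntegrableOn d (Ioo 0 S) :=
    ((memLp_one_iff_integrable.1 (hAc.memLp_Ioo hS.2 1)).sub (P.integrable_comp hNF)).smul (-Complex.I)
  refine ae_eq_causalConv_of_caputo hα₀ hα₁ (memLp_one_iff_integrable.1 (hvc.memLp_Ioo hS.2 1)) hdi
    fun t ht => ?_
  refine ext_inner_left ℂ fun h => ?_
  -- Band-limited test functions are in the domain of (-Δ)^β for every h in L², so the scalar
  -- equations determine the truncated vector identity.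
  have hfrac : IsFracLaplacian β (𝓕⁻ (P h) : L2 n) (𝓕⁻ (A h)) := by
    unfold IsFracLaplacian
    rw [FourierTransform.fourier_fourierInv_eq, FourierTransform.fourier_fourierInv_eq]
    filter_upwards [coeFn_mulCLM (memLp_indicator_setOf_le (μ := volume) (R := R) ha
      (measurable_const (a := 1)) (C := 1) (by simp) zero_le_one) h,
      coeFn_mulCLM (memLp_indicator_setOf_le (μ := volume) (R := R) ha ha (C := R)
    (fun x hx => (abs_of_nonneg (ha0 x)).trans_le hx) R.cast_nonneg) h] with ξ e1 e2
    rw [hP, hA, lowPass, lowPassMul, e1, e2]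
    by_cases hx : fracLaplaceSymbol β ξ ≤ R <;> simp [indicator, hx]
  obtain ⟨d', hd', hde⟩ := heq _ _ hfrac
  have hin : ∀ f g : L2 n, inner ℂ (𝓕⁻ f : L2 n) g = inner ℂ f (𝓕 g) := by
    intro f g
    rw [← Lp.inner_fourier_eq, FourierTransform.fourier_fourierInv_eq]
  simp only [hin] at hde
  have htT : t ∈ Ico 0 T := ⟨ht.1.le, ht.2.trans hS.2⟩
  obtain ⟨-, hc⟩ := hd' t htT
  set L : L2 n →L[ℝ] ℂ := (innerSL ℂ h).restrictScalars ℝ with hL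
  have hLx : ∀ x, L x = inner ℂ h x := fun x => rfl
  have hvi : IntervalIntegrable (fun τ => rlKernel (1 - α) (t - τ) • P (𝓕 (u τ) - 𝓕 u₀)) volume 0 t := by
    have h1 := ((intervalIntegrable_rlKernel (sub_pos.2 hα₁) 0 t).comp_sub_left t).symm
    simp only [sub_zero, sub_self] at h1
    refine h1.smul_continuousOn (hvc.mono ?_)
    rw [uIcc_of_le ht.1.le]
    exact Icc_subset_Ico_right (ht.2.trans hS.2)
  rw [← hLx, ← hLx, ← causalConv_clm L hvi,
    ← L.intervalIntegral_comp_comm (intervalIntegrable_of_integrableOn hdi ht)]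
  rw [caputoIntegral_eq_causalConv] at hc
  refine Eq.trans ?_ (hc.trans ?_)
  · congr 1
    ext τ
    rw [hLx, hin, hin, h0, inner_lowPass, inner_sub_right]
  · rw [intervalIntegral.integral_of_le ht.1.le, intervalIntegral.integral_of_le ht.1.le,
      integral_Ioc_eq_integral_Ioo, integral_Ioc_eq_integral_Ioo]
    refine integral_congr_ae ?_
    filter_upwards [ae_restrict_of_ae hde, ae_restrict_mem measurableSet_Ioo] with τ e1 hτ
    have e2 := e1 ⟨hτ.1, hτ.2.trans htT.2⟩
    rw [hLx, hd, inner_smul_right, inner_sub_right, inner_lowPassMul, inner_lowPass]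
    linear_combination (-Complex.I) * e2 + d' τ * Complex.I_mul_I

end WeakEquation

/-! ### Part (a): the L² bound. -/

section MassBound

open Filter Topology

/-- A set of times of full measure meets every interval to the right of t, so continuity and
closedness upgrade a.e. membership to all times. -/
theorem ContinuousOn.mem_of_ae_mem {E : Type*} [TopologicalSpace E] {u : ℝ → E} {S T : ℝ}
    (hu : ContinuousOn u (Ico 0 T)) (hS : S ≤ T) {K : Set E} (hK : IsClosed K)
    (h : ∀ᵐ t ∂volume.restrict (Ioo 0 S), u t ∈ K) : ∀ t ∈ Ioo 0 S, u t ∈ K := by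
  intro t ht
  by_contra hn
  have hc : ContinuousAt u t := hu.continuousAt (Ico_mem_nhds ht.1 (ht.2.trans_le hS))
  have he := hc.eventually (hK.isOpen_compl.mem_nhds hn)
  obtain ⟨r, hr, hsub⟩ := exists_Ico_subset_of_mem_nhds he ⟨S, ht.2⟩
  have hm : t < min r S := lt_min hr ht.2
  have h' : ∀ᵐ s ∂volume.restrict (Ioo 0 (min r S)), u s ∈ K :=
    ae_restrict_of_ae_restrict_of_subset (Ioo_subset_Ioo_right (min_le_right _ _)) h
  obtain ⟨s, hs, hsK⟩ := exists_mem_Ioo_of_ae ht.1.le hm h'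
  exact hsub ⟨hs.1.le, hs.2.trans_le (min_le_left _ _)⟩ hsK

theorem half_norm_sq_sub_le {H : Type*} [NormedAddCommGroup H] [InnerProductSpace ℂ H] (x y : H) :
    (1 / 2 : ℝ) * ‖x‖ ^ 2 - 1 / 2 * ‖y‖ ^ 2 ≤ (inner ℂ x (x - y)).re := by
  rw [inner_sub_right, Complex.sub_re]
  have h1 : (inner ℂ x x).re = ‖x‖ ^ 2 := inner_self_eq_norm_sq (𝕜 := ℂ) x
  have h2 : (inner ℂ x y).re ≤ ‖x‖ * ‖y‖ := re_inner_le_norm (𝕜 := ℂ) x y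
  nlinarith [sq_nonneg (‖x‖ - ‖y‖)]

theorem tendsto_eLpNorm_one_of_dominated {X E : Type*} [MeasurableSpace X] {μ : Measure X}
    [NormedAddCommGroup E] {f : ℕ → X → E} {g : X → E} {b : X → ℝ}
    (hf : ∀ k, AEStronglyMeasurable (f k) μ) (hb : Integrable b μ)
    (hle : ∀ k, ∀ᵐ x ∂μ, ‖f k x‖ ≤ b x)
    (h : ∀ᵐ x ∂μ, Tendsto (fun k => f k x) atTop (𝓝 (g x))) :
    Tendsto (fun k => eLpNorm (fun x => f k x - g x) 1 μ) atTop (𝓝 0) := by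
  simpa only [eLpNorm_one_eq_lintegral_enorm, ofReal_norm] using
    tendsto_lintegral_norm_of_dominated_convergence hf hb.2 hle h

variable {n : ℕ} {α β T : ℝ} {F : ℂ → ℂ} {u₀ : L2 n} {u : ℝ → L2 n}

theorem im_inner_eq_zero_of_ae_eq (hF : ∀ z : ℂ, ((starRingEnd ℂ) z * F z).im = 0) {f N : L2 n}
    (h : N =ᵐ[volume] fun x => F (f x)) : (inner ℂ f N).im = 0 := by
  have h1 := Complex.imCLM.integral_comp_comm (L2.integrable_inner (𝕜 := ℂ) f N)
  rw [L2.inner_def]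
  simp only [Complex.imCLM_apply] at h1
  rw [← h1, integral_eq_zero_of_ae]
  filter_upwards [h] with x hx
  have := hF (f x)
  rw [hx]
  simp only [RCLike.inner_apply, Pi.zero_apply]
  rw [mul_comm]
  exact this

theorem norm_le_of_isWeakSolution (hα₀ : 0 < α) (hα₁ : α < 1)
    (hF : ∀ z : ℂ, ((starRingEnd ℂ) z * F z).im = 0) (hsol : IsWeakSolution α β F 1 T u₀ u) :
    ∀ t ∈ Ico 0 T, ‖u t‖ ≤ ‖u₀‖ := by
  intro t ht
  rcases ht.1.eq_or_lt with h0 | h0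
  · rw [← h0, hsol.initial]
  obtain ⟨hcont, hu0, N, hNF, hN, heq⟩ := hsol
  obtain ⟨S, htS, hST⟩ := exists_between ht.2
  have hS : S ∈ Ioo 0 T := ⟨h0.trans htS, hST⟩
  have hK : IsClosed {f : L2 n | ‖f‖ ≤ ‖u₀‖} := isClosed_le continuous_norm continuous_const
  refine hcont.mem_of_ae_mem hST.le hK ?_ t ⟨h0, htS⟩
  have ha := measurable_fracLaplaceSymbol (n := n) β
  have ha0 := fracLaplaceSymbol_nonneg (n := n) β
  set P := lowPass (volume : Measure (EuclideanSpace ℝ (Fin n))) ha with hP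
  set A := lowPassMul (volume : Measure (EuclideanSpace ℝ (Fin n))) ha ha0 with hA
  set U : ℝ → L2 n := fun t => 𝓕 (u t) with hUdef
  set U₀ : L2 n := 𝓕 u₀ with hU₀
  set V : ℝ → L2 n := fun t => 𝓕 (N t) with hV
  have hUc : ContinuousOn U (Ico 0 T) := continuous_fourier.comp_continuousOn hcont
  have hVi : IntegrableOn V (Ioo 0 S) :=
    ((Lp.fourierTransformₗᵢ (EuclideanSpace ℝ (Fin n)) ℂ).toContinuousLinearEquiv :
      L2 n →L[ℂ] L2 n).integrable_comp ((hN S hST).integrable le_rfl)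
  have hPc : ∀ R, ContinuousOn (fun t => P R (U t)) (Ico 0 T) := fun R =>
    (P R).continuous.comp_continuousOn hUc
  set d : ℕ → ℝ → L2 n := fun R t => -Complex.I • (A R (U t) - P R (V t)) with hd
  have hdi : ∀ R, IntegrableOn (d R) (Ioo 0 S) := fun R =>
    ((memLp_one_iff_integrable.1 (((A R).continuous.comp_continuousOn hUc).memLp_Ioo hST 1)).sub
      ((P R).integrable_comp hVi)).smul (-Complex.I)
  -- The linear part drops out because A_R is symmetric, and the projection in front of V can be
  -- moved onto P_R U.
  have hr : ∀ R t, (inner ℂ (P R (U t)) (d R t)).re = -(inner ℂ (P R (U t)) (V t)).im := by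
    intro R t
    have h1 : (inner ℂ (P R (U t)) (A R (U t))).im = 0 := by
      rw [hP, hA, ← inner_lowPass, lowPass_lowPassMul, inner_lowPassMul_eq_inner_lowPassSqrt]
      exact inner_self_im (𝕜 := ℂ) _
    have h2 : inner ℂ (P R (U t)) (P R (V t)) = inner ℂ (P R (U t)) (V t) := by
      rw [hP, inner_lowPass, lowPass_lowPass]
    rw [hd]
    simp only
    rw [inner_smul_right, inner_sub_right, h2]
    simp [h1]
  obtain ⟨M, hM⟩ := isCompact_Icc.exists_bound_of_continuousOn (hUc.mono (Icc_subset_Ico_right hST))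
  have hM' : ∀ s ∈ Ioo 0 S, ‖U s‖ ≤ M := fun s hs => hM s (Ioo_subset_Icc_self hs)
  have hM0 : 0 ≤ M := (norm_nonneg _).trans (hM 0 ⟨le_rfl, hS.1.le⟩)
  have hFm : ∀ R, AEStronglyMeasurable (fun t => 1 / 2 * ‖P R (U t)‖ ^ 2 - 1 / 2 * ‖P R U₀‖ ^ 2)
      (volume.restrict (Ioo 0 S)) := fun R =>
    (((((hPc R).memLp_Ioo hST 1).1.norm).pow 2).const_mul _).sub aestronglyMeasurable_const
  have hFb : ∀ R, ∀ᵐ t ∂volume.restrict (Ioo 0 S),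
      ‖1 / 2 * ‖P R (U t)‖ ^ 2 - 1 / 2 * ‖P R U₀‖ ^ 2‖ ≤ M ^ 2 + ‖U₀‖ ^ 2 := by
    intro R
    filter_upwards [ae_restrict_mem measurableSet_Ioo] with s hs
    have h1 : ‖P R (U s)‖ ^ 2 ≤ M ^ 2 :=
      pow_le_pow_left₀ (norm_nonneg _) ((norm_lowPass_le ha R _).trans (hM' s hs)) 2
    have h2 : ‖P R U₀‖ ^ 2 ≤ ‖U₀‖ ^ 2 :=
      pow_le_pow_left₀ (norm_nonneg _) (norm_lowPass_le ha R _) 2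
    rw [Real.norm_eq_abs, abs_le]
    constructor <;> nlinarith [sq_nonneg ‖P R (U s)‖, sq_nonneg ‖P R U₀‖]
  have hri : ∀ R, IntegrableOn (fun t => (inner ℂ (P R (U t)) (d R t)).re) (Ioo 0 S) := fun R =>
    integrable_re_inner ((hPc R).memLp_Ioo hST ∞) (memLp_one_iff_integrable.2 (hdi R))
  have hchain : ∀ R, ∀ᵐ t ∂volume.restrict (Ioo 0 S),
      1 / 2 * ‖P R (U t)‖ ^ 2 - 1 / 2 * ‖P R U₀‖ ^ 2 ≤
        causalConv (rlKernel α) (fun s => (inner ℂ (P R (U s)) (d R s)).re) t := by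
    intro R
    -- The exponents match the data: F(u) is only L¹ in time, while u is bounded on compact
    -- intervals.
    refine le_causalConv_re_inner (p := 1) (q := ∞) hα₀ hα₁ hS.1 le_rfl (by simp)
      (v := fun t => P R (U t - U₀)) (memLp_one_iff_integrable.2 (hdi R)) ((hPc R).memLp_Ioo hST ∞)
      (lowPass_sub_ae_eq_causalConv hα₀ hα₁ le_rfl hcont hu0 hN heq ha ha0 hS R) ?_ ?_ ?_
    · exact Integrable.mono' (integrable_const (M ^ 2 + ‖U₀‖ ^ 2)) (hFm R) (hFb R)
    · refine .of_forall fun s => ?_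
      rw [map_sub]
      exact half_norm_sq_sub_le _ _
    · refine .of_forall fun s => .of_forall fun r => ?_
      rw [sub_sub_sub_cancel_right, map_sub, map_sub, sub_sub_sub_cancel_right]
      exact half_norm_sq_sub_le _ _
  -- P_R does not commute with the nonlinearity, so the truncated term need not vanish. It tends to
  -- -Im⟨U, V⟩ = 0, dominated by M‖V‖.
  have hr0 : Tendsto (fun R => eLpNorm (fun t => (inner ℂ (P R (U t)) (d R t)).re - 0) 1
      (volume.restrict (Ioo 0 S))) atTop (𝓝 0) := by
    refine tendsto_eLpNorm_one_of_dominated (b := fun t => M * ‖V t‖) (fun R => (hri R).1)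
      (hVi.norm.const_mul M) (fun R => ?_) ?_
    · filter_upwards [ae_restrict_mem measurableSet_Ioo] with s hs
      rw [hr, norm_neg, Real.norm_eq_abs]
      refine (Complex.abs_im_le_norm _).trans ((norm_inner_le_norm _ _).trans ?_)
      exact mul_le_mul_of_nonneg_right ((norm_lowPass_le ha R _).trans (hM' s hs)) (norm_nonneg _)
    · filter_upwards [ae_restrict_of_ae hNF, ae_restrict_mem measurableSet_Ioo] with s h1 hs
      have h2 : (inner ℂ (U s) (V s)).im = 0 := by
        rw [hUdef, hV, Lp.inner_fourier_eq]
        exact im_inner_eq_zero_of_ae_eq hF (h1 ⟨hs.1, hs.2.trans hST⟩)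
      simp only [hr]
      have h3 := (Complex.continuous_im.tendsto _).comp
        ((tendsto_lowPass ha (U s)).inner (𝕜 := ℂ) (tendsto_const_nhds (x := V s)))
      rw [h2] at h3
      simpa using h3.neg
  have hg := integrableOn_rlKernel hα₀ S
  have hlim : (fun t => 1 / 2 * ‖U t‖ ^ 2 - 1 / 2 * ‖U₀‖ ^ 2) ≤ᵐ[volume.restrict (Ioo 0 S)] fun _ => 0 := by
    refine ae_le_of_tendsto_eLpNorm_one (l := atTop)
      (Fi := fun R t => 1 / 2 * ‖P R (U t)‖ ^ 2 - 1 / 2 * ‖P R U₀‖ ^ 2)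
      (Ri := fun R t => causalConv (rlKernel α) (fun s => (inner ℂ (P R (U s)) (d R s)).re) t)
      ?_ aestronglyMeasurable_const hFm (.of_forall hchain) ?_ ?_
    · exact ((((hUc.memLp_Ioo hST 1).1.norm).pow 2).const_mul _).sub aestronglyMeasurable_const
    · refine tendsto_eLpNorm_one_of_dominated hFm (integrable_const (M ^ 2 + ‖U₀‖ ^ 2)) hFb
        (.of_forall fun s => ?_)
      exact (((tendsto_lowPass ha (U s)).norm.pow 2).const_mul _).sub
        (((tendsto_lowPass ha U₀).norm.pow 2).const_mul _)
    · refine tendsto_of_tendsto_of_tendsto_of_le_of_le tendsto_const_nhds ?_ (fun R => bot_le)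
        (fun R => ?_) (g := fun _ => (0 : ℝ≥0∞)) (h := fun R => (∫⁻ t in Ioo 0 S, ‖rlKernel α t‖ₑ) *
          eLpNorm (fun t => (inner ℂ (P R (U t)) (d R t)).re - 0) 1 (volume.restrict (Ioo 0 S)))
      · have := ENNReal.Tendsto.const_mul hr0 (a := ∫⁻ t in Ioo 0 S, ‖rlKernel α t‖ₑ)
          (.inr hg.2.ne)
        simpa using this
      · simp only [sub_zero, eLpNorm_one_eq_lintegral_enorm]
        exact lintegral_enorm_causalConv_le hg (hri R)
  filter_upwards [hlim] with s hs
  have h1 : ‖U s‖ = ‖u s‖ := Lp.norm_fourier_eq _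
  have h2 : ‖U₀‖ = ‖u₀‖ := Lp.norm_fourier_eq _
  rw [h1, h2] at hs
  refine le_of_sq_le_sq ?_ (norm_nonneg _)
  linarith

end MassBound

/-! ### The differential inequality as a subgradient condition. -/

section Subgradient

open Filter Topology

variable {α : ℝ}

/-- A function at rest in c since time e looks at time 1 like a jump from w(0) to c at time 0, with
Caputo derivative (c - w(0))/Γ(1-α) there. The transition contributes O(e), since s - τ ≥ 1/4 keeps
its kernel smooth. -/
theorem hasCaputoDerivAt_one_of_eq_const {E : Type*} [NormedAddCommGroup E] [NormedSpace ℝ E]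
    [CompleteSpace E] (hα₀ : 0 < α) (hα₁ : α < 1) {w : ℝ → E} {c : E} {e M : ℝ} (he : 0 < e)
    (he1 : e ≤ 1 / 2) (hw : ContinuousOn w (Ici 0)) (hc : ∀ τ, e ≤ τ → w τ = c)
    (hM : ∀ τ ∈ Icc 0 e, ‖c - w τ‖ ≤ M) :
    ∃ D, HasCaputoDerivAt α w D 1 ∧
      ‖D - (1 / Real.Gamma (1 - α)) • (c - w 0)‖ ≤
        1 / Real.Gamma (1 - α) * (α * (1 / 4) ^ (-α - 1) * M * e) := by
  have hΓ : 0 < Real.Gamma (1 - α) := Real.Gamma_pos_of_pos (by linarith)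
  have hM0 : 0 ≤ M := (norm_nonneg _).trans (hM 0 ⟨le_rfl, he.le⟩)
  have hball : Metric.ball (1 : ℝ) (1 / 4) ∈ 𝓝 (1 : ℝ) := Metric.ball_mem_nhds _ (by norm_num)
  have hs : ∀ s ∈ Metric.ball (1 : ℝ) (1 / 4), 3 / 4 < s := fun s h => by
    rw [Metric.mem_ball, Real.dist_eq, abs_lt] at h
    linarith [h.1]
  have hwc : ContinuousOn (fun τ => c - w τ) (Icc 0 e) :=
    continuousOn_const.sub (hw.mono Icc_subset_Ici_self)
  have hpow : ∀ s, 3 / 4 < s → ∀ r : ℝ, ContinuousOn (fun τ => (s - τ) ^ r) (Icc 0 e) := by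
    intro s hs r
    refine ContinuousOn.rpow_const (by fun_prop) fun τ hτ => .inl ?_
    have := hτ.2
    linarith
  set f : ℝ → ℝ → E := fun s τ => (s - τ) ^ (-α) • (c - w τ) with hf
  set f' : ℝ → ℝ → E := fun s τ => (-α * (s - τ) ^ (-α - 1)) • (c - w τ) with hf'
  have hfc : ∀ s, 3 / 4 < s → ContinuousOn (f s) (Icc 0 e) := fun s hs => (hpow s hs _).smul hwc
  have hf'c : ∀ s, 3 / 4 < s → ContinuousOn (f' s) (Icc 0 e) := fun s hs =>
    (continuousOn_const.mul (hpow s hs _)).smul hwc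
  have hI : ∀ g : ℝ → E, ContinuousOn g (Icc 0 e) → IntervalIntegrable g volume 0 e := fun g hg =>
    (hg.mono (by rw [uIcc_of_le he.le])).intervalIntegrable
  have hbound : ∀ s, 3 / 4 < s → ∀ τ ∈ Icc 0 e, ‖f' s τ‖ ≤ α * (1 / 4) ^ (-α - 1) * M := by
    intro s hs τ hτ
    have h1 : 1 / 4 ≤ s - τ := by linarith [hτ.2]
    rw [hf', norm_smul, norm_mul, norm_neg, Real.norm_of_nonneg hα₀.le,
      Real.norm_of_nonneg (Real.rpow_nonneg (by linarith) _)]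
    have h2 : (s - τ) ^ (-α - 1) ≤ (1 / 4 : ℝ) ^ (-α - 1) :=
      Real.rpow_le_rpow_of_nonpos (by norm_num) h1 (by linarith)
    have := hM τ hτ
    gcongr
  have h2 : HasDerivAt (fun s => ∫ τ in (0 : ℝ)..e, f s τ) (∫ τ in (0 : ℝ)..e, f' 1 τ) 1 := by
    refine (intervalIntegral.hasDerivAt_integral_of_dominated_loc_of_deriv_le (F := f) (F' := f')
      (bound := fun _ => α * (1 / 4) ^ (-α - 1) * M) hball ?_ (hI _ (hfc 1 (by norm_num))) ?_ ?_
      intervalIntegrable_const ?_).2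
    · filter_upwards [hball] with s h
      rw [uIoc_of_le he.le]
      exact ((hfc s (hs s h)).mono Ioc_subset_Icc_self).aestronglyMeasurable measurableSet_Ioc
    · rw [uIoc_of_le he.le]
      exact ((hf'c 1 (by norm_num)).mono Ioc_subset_Icc_self).aestronglyMeasurable measurableSet_Ioc
    · refine .of_forall fun τ hτ s h => ?_
      rw [uIoc_of_le he.le] at hτ
      exact hbound s (hs s h) τ (Ioc_subset_Icc_self hτ)
    · refine .of_forall fun τ hτ s h => ?_
      rw [uIoc_of_le he.le] at hτ
      have h3 : s - τ ≠ 0 := by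
        have := hτ.2
        have := hs s h
        intro h
        linarith
      have h4 := ((hasDerivAt_id s).sub_const τ).rpow_const (p := -α) (.inl h3)
      simp only [id_eq, one_mul] at h4
      exact h4.smul_const (c - w τ)
  have h1 : HasDerivAt (fun s : ℝ => (s ^ (1 - α) / (1 - α)) • (c - w 0)) (c - w 0) 1 := by
    have h3 := ((Real.hasDerivAt_rpow_const (x := 1) (p := 1 - α) (.inl one_ne_zero)).div_const
      (1 - α)).smul_const (c - w 0)
    have h4 : 1 - α ≠ 0 := by linarith
    simpa [h4] using h3
  -- Write w(τ) - w(0) = (c - w(0)) - (c - w(τ)); the second term lives on τ ≤ e, and the first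
  -- integrates explicitly.
  have heq : caputoIntegral α w =ᶠ[𝓝 1] fun s => (1 / Real.Gamma (1 - α)) •
      ((s ^ (1 - α) / (1 - α)) • (c - w 0) - ∫ τ in (0 : ℝ)..e, f s τ) := by
    filter_upwards [hball] with s h
    have hs' := hs s h
    have hs0 : 0 ≤ s := by linarith
    rw [caputoIntegral]
    congr 1
    have hk : IntervalIntegrable (fun τ => (s - τ) ^ (-α)) volume 0 s := by
      have := ((intervalIntegral.intervalIntegrable_rpow' (r := -α) (by linarith)
        (a := 0) (b := s)).comp_sub_left s).symm
      simpa using this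
    have hki : ∫ τ in (0 : ℝ)..s, (s - τ) ^ (-α) = s ^ (1 - α) / (1 - α) := by
      rw [intervalIntegral.integral_comp_sub_left (fun x => x ^ (-α)) s, sub_self, sub_zero,
        integral_rpow (.inl (by linarith)), Real.zero_rpow (by linarith), sub_zero,
        show -α + 1 = 1 - α by ring]
    have hfi : IntervalIntegrable (f s) volume 0 s := by
      refine hk.smul_continuousOn ((continuousOn_const.sub hw).mono ?_)
      rw [uIcc_of_le hs0]
      exact Icc_subset_Ici_self
    have hfe : ∫ τ in (0 : ℝ)..s, f s τ = ∫ τ in (0 : ℝ)..e, f s τ := by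
      have hes : e ≤ s := by linarith
      have hz : ∫ τ in e..s, f s τ = 0 := by
        refine intervalIntegral.integral_zero_ae (.of_forall fun τ hτ => ?_)
        rw [uIoc_of_le hes] at hτ
        simp [hf, hc τ hτ.1.le]
      rw [← intervalIntegral.integral_add_adjacent_intervals (b := e)
        (hI _ (hfc s hs')) (hfi.mono_set ?_), hz, add_zero]
      rw [uIcc_of_le hes, uIcc_of_le hs0]
      exact Icc_subset_Icc_left he.le
    rw [← hki, ← hfe, ← intervalIntegral.integral_smul_const,
      ← intervalIntegral.integral_sub (hk.smul_continuousOn continuousOn_const) hfi]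
    refine intervalIntegral.integral_congr fun τ _ => ?_
    simp only [hf]
    rw [← smul_sub, sub_sub_sub_cancel_left]
  refine ⟨_, ((h1.sub h2).const_smul (1 / Real.Gamma (1 - α))).congr_of_eventuallyEq heq, ?_⟩
  rw [← smul_sub, sub_sub_cancel_left, norm_smul, norm_neg, Real.norm_of_nonneg (by positivity)]
  refine mul_le_mul_of_nonneg_left ?_ (by positivity)
  have h3 := intervalIntegral.norm_integral_le_of_norm_le_const (a := 0) (b := e) (f := f' 1)
    (C := α * (1 / 4) ^ (-α - 1) * M) fun τ hτ => by
      rw [uIoc_of_le he.le] at hτ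
      exact hbound 1 (by norm_num) τ (Ioc_subset_Icc_self hτ)
  rwa [sub_zero, abs_of_pos he] at h3

/-- The test of the differential inequality on functions that pass from `b` to `a` in a short time
and then rest at `a` shows that `-F` is a subgradient of a multiple of `G`. -/
theorem EnergyHypothesis.exists_re_mul_conj_sub_le (hα₀ : 0 < α) (hα₁ : α < 1) {F : ℂ → ℂ} {G : ℂ → ℝ}
    (hG : Continuous G) (h : EnergyHypothesis α F G) :
    ∃ C : ℝ, 0 < C ∧ ∀ a b : ℂ, C * G a - C * G b ≤ (-(F a * (starRingEnd ℂ) (a - b))).re := by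
  obtain ⟨C, hC, h⟩ := h
  refine ⟨C, hC, fun a b => ?_⟩
  have hΓ : 0 < Real.Gamma (1 - α) := Real.Gamma_pos_of_pos (by linarith)
  set W : ℝ → ℂ := fun x => b + (x : ℂ) * (a - b) with hW
  have hWc : Continuous W := by fun_prop
  obtain ⟨M₁, hM₁⟩ := isCompact_Icc.exists_bound_of_continuousOn
    (f := fun x => a - W x) (s := Icc (0 : ℝ) 1) (by fun_prop)
  obtain ⟨M₂, hM₂⟩ := isCompact_Icc.exists_bound_of_continuousOn
    (f := fun x => G a - G (W x)) (s := Icc (0 : ℝ) 1) (by fun_prop)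
  set e : ℕ → ℝ := fun k => 1 / ((k : ℝ) + 2) with he
  have he0 : ∀ k, 0 < e k := fun k => by positivity
  have he1 : ∀ k, e k ≤ 1 / 2 := fun k =>
    one_div_le_one_div_of_le two_pos (by linarith [k.cast_nonneg (α := ℝ)])
  have het : Tendsto e atTop (𝓝 0) := by
    refine Tendsto.div_atTop (a := (1 : ℝ)) tendsto_const_nhds ?_
    exact tendsto_atTop_add_const_right _ _ tendsto_natCast_atTop_atTop
  -- Linear passage from b to a during time e_k. G∘v also rests after e_k, so both Caputo
  -- derivatives exist at time 1, and they converge to multiples of a - b and G(a) - G(b).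
  set v : ℕ → ℝ → ℂ := fun k τ => W (min (τ / e k) 1) with hv
  have hvc : ∀ k, Continuous (v k) := fun k => by fun_prop
  have hv0 : ∀ k, v k 0 = b := fun k => by simp [hv, hW]
  have hv1 : ∀ k τ, e k ≤ τ → v k τ = a := fun k τ hτ => by
    have : 1 ≤ τ / e k := (one_le_div (he0 k)).2 hτ
    simp [hv, hW, this]
  have hmem : ∀ k, ∀ τ ∈ Icc 0 (e k), min (τ / e k) 1 ∈ Icc (0 : ℝ) 1 := fun k τ hτ =>
    ⟨le_min (div_nonneg hτ.1 (he0 k).le) zero_le_one, min_le_right _ _⟩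
  choose D hD hDb using fun k => hasCaputoDerivAt_one_of_eq_const hα₀ hα₁ (he0 k) (he1 k)
    (hvc k).continuousOn (hv1 k) (fun τ hτ => hM₁ _ (hmem k τ hτ))
  choose g hg hgb using fun k => hasCaputoDerivAt_one_of_eq_const hα₀ hα₁ (he0 k) (he1 k)
    (hG.comp (hvc k)).continuousOn (fun τ hτ => congrArg G (hv1 k τ hτ))
    (fun τ hτ => hM₂ _ (hmem k τ hτ))
  have hlim : ∀ M : ℝ, Tendsto (fun k => 1 / Real.Gamma (1 - α) * (α * (1 / 4) ^ (-α - 1) * M * e k))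
      atTop (𝓝 0) := fun M => by
    simpa using (het.const_mul (α * (1 / 4) ^ (-α - 1) * M)).const_mul (1 / Real.Gamma (1 - α))
  have hDt : Tendsto D atTop (𝓝 ((1 / Real.Gamma (1 - α)) • (a - b))) := by
    rw [tendsto_iff_norm_sub_tendsto_zero]
    refine squeeze_zero (fun k => norm_nonneg _) (fun k => ?_) (hlim M₁)
    simpa only [hv0] using hDb k
  have hgt : Tendsto g atTop (𝓝 ((1 / Real.Gamma (1 - α)) • (G a - G b))) := by
    rw [tendsto_iff_norm_sub_tendsto_zero]
    refine squeeze_zero (fun k => norm_nonneg _) (fun k => ?_) (hlim M₂)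
    simpa only [Function.comp_apply, hv0] using hgb k
  have hle : ∀ k, (F a * (starRingEnd ℂ) (D k)).re ≤ C * (-g k) := fun k => by
    have := h (v k) (hvc k).continuousOn 1 one_pos (D k) (g k) (hD k) (hg k)
    rwa [hv1 k 1 ((he1 k).trans (by norm_num))] at this
  have hfin := le_of_tendsto_of_tendsto'
    ((Complex.continuous_re.tendsto _).comp (((Complex.continuous_conj.tendsto _).comp hDt).const_mul (F a)))
    (hgt.neg.const_mul C) hle
  rw [Complex.real_smul, map_mul, Complex.conj_ofReal, mul_left_comm, Complex.re_ofReal_mul,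
    smul_eq_mul] at hfin
  have h5 : 1 / Real.Gamma (1 - α) * (F a * (starRingEnd ℂ) (a - b)).re ≤
      1 / Real.Gamma (1 - α) * (C * (-(G a - G b))) := by linarith
  have h6 := le_of_mul_le_mul_left h5 (by positivity)
  rw [Complex.neg_re]
  linarith

end Subgradient

/-! ### Convex integral functionals and their decay along the flow. -/

section EnergyFunctional

open Filter Topology

variable {X : Type*} [MeasurableSpace X] {μ : Measure X}

/-- L² convergence gives an a.e. convergent subsequence, to which Fatou's lemma applies. -/
theorem lowerSemicontinuous_lintegral {Φ : X → ℂ → ℝ≥0∞} (hΦ : Measurable (Function.uncurry Φ))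
    (hc : ∀ x, Continuous (Φ x)) : LowerSemicontinuous fun f : Lp ℂ 2 μ => ∫⁻ x, Φ x (f x) ∂μ := by
  rw [lowerSemicontinuous_iff_isClosed_preimage]
  refine fun y => IsSeqClosed.isClosed fun f g hf hfg => ?_
  obtain ⟨k, -, hk⟩ := (tendstoInMeasure_of_tendsto_Lp hfg).exists_seq_tendsto_ae
  have h1 : ∫⁻ x, Φ x (g x) ∂μ ≤ ∫⁻ x, liminf (fun i => Φ x (f (k i) x)) atTop ∂μ := by
    refine lintegral_mono_ae ?_
    filter_upwards [hk] with x hx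
    exact (((hc x).tendsto _).comp hx).liminf_eq.ge
  refine h1.trans ((lintegral_liminf_le' fun i => ?_).trans ?_)
  · exact hΦ.comp_aemeasurable (aemeasurable_id.prodMk (Lp.aestronglyMeasurable (f (k i))).aemeasurable)
  · exact liminf_le_of_frequently_le' (Frequently.of_forall fun i => hf (k i))

theorem LowerSemicontinuous.comp_aemeasurable {Y Z : Type*} [MeasurableSpace Y] {ν : Measure Y}
    [TopologicalSpace Z] [TopologicalSpace.PseudoMetrizableSpace Z] {E : Z → ℝ≥0∞}
    (hE : LowerSemicontinuous E) {U : Y → Z} (hU : AEStronglyMeasurable U ν) :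
    AEMeasurable (fun y => E (U y)) ν := by
  borelize Z
  exact hE.measurable.comp_aemeasurable hU.aemeasurable

/-- A pointwise subgradient inequality integrates to one in L². It also bounds θ(f) by an integrable
function, so finiteness at f is a conclusion and need not be assumed. -/
theorem toReal_lintegral_sub_le_re_inner {θ : X → ℂ → ℝ} (hθ : Measurable (Function.uncurry θ))
    (h0 : ∀ x z, 0 ≤ θ x z) {f g p : Lp ℂ 2 μ}
    (h : ∀ᵐ x ∂μ, θ x (f x) - θ x (g x) ≤ (inner ℂ (p x) (f x - g x)).re)
    (hg : ∫⁻ x, ENNReal.ofReal (θ x (g x)) ∂μ ≠ ∞) :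
    ∫⁻ x, ENNReal.ofReal (θ x (f x)) ∂μ ≠ ∞ ∧
      (∫⁻ x, ENNReal.ofReal (θ x (f x)) ∂μ).toReal - (∫⁻ x, ENNReal.ofReal (θ x (g x)) ∂μ).toReal ≤
        (inner ℂ p (f - g)).re := by
  have hm : ∀ f : Lp ℂ 2 μ, AEStronglyMeasurable (fun x => θ x (f x)) μ := fun f =>
    (hθ.comp_aemeasurable (aemeasurable_id.prodMk
      (Lp.aestronglyMeasurable f).aemeasurable)).aestronglyMeasurable
  have hgi : Integrable (fun x => θ x (g x)) μ :=
    (lintegral_ofReal_ne_top_iff_integrable (hm g) (.of_forall fun x => h0 _ _)).1 hg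
  have hin := L2.integrable_inner (𝕜 := ℂ) p (f - g)
  have hri : Integrable (fun x => (inner ℂ (p x) ((f - g : Lp ℂ 2 μ) x)).re) μ :=
    Complex.reCLM.integrable_comp hin
  have hle : ∀ᵐ x ∂μ, θ x (f x) ≤ θ x (g x) + (inner ℂ (p x) ((f - g : Lp ℂ 2 μ) x)).re := by
    filter_upwards [h, Lp.coeFn_sub f g] with x h1 h2
    rw [h2, Pi.sub_apply]
    linarith
  have hfi : Integrable (fun x => θ x (f x)) μ := by
    refine Integrable.mono' (hgi.add hri) (hm f) ?_
    filter_upwards [hle] with x hx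
    rwa [Real.norm_of_nonneg (h0 _ _)]
  refine ⟨(lintegral_ofReal_ne_top_iff_integrable (hm f) (.of_forall fun x => h0 _ _)).2 hfi, ?_⟩
  rw [← integral_eq_lintegral_of_nonneg_ae (.of_forall fun x => h0 _ _) (hm f),
    ← integral_eq_lintegral_of_nonneg_ae (.of_forall fun x => h0 _ _) (hm g), L2.inner_def]
  have h1 := Complex.reCLM.integral_comp_comm hin
  simp only [Complex.reCLM_apply] at h1
  rw [← h1, sub_le_iff_le_add', ← integral_add hgi hri]
  exact integral_mono_ae hfi (hgi.add hri) hle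

/-- A convex energy does not increase along its fractional Hamiltonian flow `∂_t^α v ∈ -i ∂E(U)`. -/
theorem le_of_re_inner_eq_zero {H : Type*} [NormedAddCommGroup H] [InnerProductSpace ℂ H]
    [CompleteSpace H] {α S T : ℝ} (hα₀ : 0 < α) (hα₁ : α < 1) (hS : 0 < S) (hST : S < T)
    {E : H → ℝ≥0∞} (hE : LowerSemicontinuous E)
    {U ξ d : ℝ → H} {U₀ : H} (hU : ContinuousOn U (Ico 0 T))
    (hξ : MemLp ξ 2 (volume.restrict (Ioo 0 S))) (hd : MemLp d 2 (volume.restrict (Ioo 0 S)))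
    (hv : (fun t => U t - U₀) =ᵐ[volume.restrict (Ioo 0 S)] causalConv (rlKernel α) d)
    (hE0 : E U₀ ≠ ∞)
    (hsub : ∀ᵐ t ∂volume.restrict (Ioo 0 S), ∀ w, E w ≠ ∞ →
      E (U t) ≠ ∞ ∧ (E (U t)).toReal - (E w).toReal ≤ (inner ℂ (ξ t) (U t - w)).re)
    (hz : ∀ t, (inner ℂ (ξ t) (d t)).re = 0) : ∀ t ∈ Ioo 0 S, E (U t) ≤ E U₀ := by
  have hU2 := hU.memLp_Ioo hST 2
  have hm : AEStronglyMeasurable (fun t => (E (U t)).toReal) (volume.restrict (Ioo 0 S)) :=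
    (hE.comp_aemeasurable hU2.1).ennreal_toReal.aestronglyMeasurable
  have hri : IntegrableOn (fun t => (inner ℂ (ξ t) (U t - U₀)).re) (Ioo 0 S) :=
    integrable_re_inner hξ (hU2.sub (memLp_const U₀))
  -- The subgradient inequality against the initial state bounds the energy by an integrable
  -- function of time.
  have hFi : IntegrableOn (fun t => (E (U t)).toReal) (Ioo 0 S) := by
    refine Integrable.mono' ((integrable_const (E U₀).toReal).add hri) hm ?_
    filter_upwards [hsub] with t ht
    rw [Real.norm_of_nonneg ENNReal.toReal_nonneg, Pi.add_apply]
    linarith [(ht U₀ hE0).2]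
  have hchain := le_causalConv_re_inner (p := 2) (q := 2) hα₀ hα₁ hS (by norm_num) (by norm_num)
    (F := fun t => (E (U t)).toReal - (E U₀).toReal) hd hξ hv (hFi.sub (integrable_const _))
    (hsub.mono fun t ht => (ht U₀ hE0).2) (by
      filter_upwards [hsub] with t ht
      filter_upwards [hsub] with s hs
      rw [sub_sub_sub_cancel_right, sub_sub_sub_cancel_right]
      exact (ht _ (hs U₀ hE0).1).2)
  refine hU.mem_of_ae_mem hST.le (hE.isClosed_preimage (E U₀)) ?_
  filter_upwards [hchain, hsub] with t h1 h2
  simp only [causalConv, hz, smul_zero, intervalIntegral.integral_zero] at h1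
  exact (ENNReal.toReal_le_toReal (h2 U₀ hE0).1 hE0).1 (by linarith)

end EnergyFunctional

/-! ### Removing the spectral cut-off. -/

section Regularity

open Filter Topology

variable {X : Type*} [MeasurableSpace X] {μ : Measure X} {a : X → ℝ} {α T : ℝ}

/-- The uniform maximal regularity bound for the spectral truncations of `i ∂_t^α U = a U - V`. -/
theorem exists_bound_integral_norm_sq_lowPass (hα₀ : 0 < α) (hα₁ : α < 1) (ha : Measurable a)
    (ha0 : ∀ x, 0 ≤ a x) {U V : ℝ → Lp ℂ 2 μ} {U₀ : Lp ℂ 2 μ} (hU : ContinuousOn U (Ico 0 T))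
    (hV : ∀ S < T, MemLp V 2 (volume.restrict (Ioo 0 S)))
    (hUV : ∀ S ∈ Ioo 0 T, ∀ R, (fun t => lowPass μ ha R (U t - U₀)) =ᵐ[volume.restrict (Ioo 0 S)]
      causalConv (rlKernel α) (fun t => -Complex.I •
        (lowPassMul μ ha ha0 R (U t) - lowPass μ ha R (V t))))
    (he : ∫⁻ x, ‖((√(a x) : ℝ) : ℂ) * U₀ x‖ₑ ^ 2 ∂μ ≠ ∞) {S : ℝ} (hS : S ∈ Ioo 0 T) :
    ∃ K : ℝ, ∀ R, ∫ t in Ioo 0 S, ‖lowPassMul μ ha ha0 R (U t) - lowPass μ ha R (V t)‖ ^ 2 ≤ K := by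
  -- The weight g_(1+α)(t-τ) degenerates at τ = t. Working up to a time t in (S, S') keeps it at
  -- least g_(1+α)(t-S) > 0 on (0,S).
  obtain ⟨S', hSS', hS'T⟩ := exists_between hS.2
  have hS'0 : 0 < S' := hS.1.trans hSS'
  obtain ⟨M, hM⟩ := isCompact_Icc.exists_bound_of_continuousOn (hU.mono (Icc_subset_Ico_right hS'T))
  have hM0 : 0 ≤ M := (norm_nonneg _).trans (hM 0 ⟨le_rfl, hS'0.le⟩)
  set e := √(∫⁻ x, ‖((√(a x) : ℝ) : ℂ) * U₀ x‖ₑ ^ 2 ∂μ).toReal with hedef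
  have hVS := hV S' hS'T
  have hAU : ∀ R, ContinuousOn (fun t => lowPassMul μ ha ha0 R (U t)) (Ico 0 T) := fun R =>
    (lowPassMul μ ha ha0 R).continuous.comp_continuousOn hU
  have hd : ∀ R, MemLp (fun t => lowPassMul μ ha ha0 R (U t) - lowPass μ ha R (V t)) 2
      (volume.restrict (Ioo 0 S')) := fun R =>
    ((hAU R).memLp_Ioo hS'T 2).sub ((lowPass μ ha R).comp_memLp' hVS)
  obtain ⟨K, hK⟩ := exists_bound_integral_rlKernel_mul_norm_sq (H := Lp ℂ 2 μ) hα₀ hα₁ hS'0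
    (ν := ∫ t in Ioo 0 S', ‖V t‖ ^ 2) hM0 (Real.sqrt_nonneg _ : 0 ≤ e)
  have hall : ∀ᵐ t ∂volume.restrict (Ioo 0 S'), ∀ R, ∫ τ in (0 : ℝ)..t, rlKernel (1 + α) (t - τ) *
      ‖lowPassMul μ ha ha0 R (U τ) - lowPass μ ha R (V τ)‖ ^ 2 ≤ K := by
    rw [ae_all_iff]
    intro R
    have h := hK (lowPassMul μ ha ha0 R) (lowPassSqrt μ ha R) (fun t => lowPass μ ha R (U t))
      (fun t => lowPass μ ha R (V t))
      (fun t => -Complex.I • (lowPassMul μ ha ha0 R (U t) - lowPass μ ha R (V t)))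
      (lowPass μ ha R U₀) (inner_lowPassMul_eq_inner_lowPassSqrt ha ha0 R)
      (fun t ht => (norm_lowPass_le ha R _).trans (hM t (Ioo_subset_Icc_self ht))) ?_
      ((lowPass μ ha R).comp_memLp' hVS) ?_ ((hd R).const_smul (-Complex.I)) (.of_forall fun t => ?_) ?_
    · simpa only [norm_smul, norm_neg, Complex.norm_I, one_mul] using h
    · have h1 : lowPassSqrt μ ha R (lowPass μ ha R U₀) = lowPassSqrt μ ha R U₀ :=
        mulCLM_mulCLM _ _ _ (fun x => by by_cases hx : a x ≤ R <;> simp [indicator, hx]) U₀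
      rw [h1]
      refine Real.le_sqrt_of_sq_le ?_
      have h2 := ENNReal.toReal_mono he (enorm_lowPassSqrt_sq_le (μ := μ) ha R U₀)
      simpa using h2
    · refine integral_mono (((lowPass μ ha R).comp_memLp' hVS).norm.integrable_sq)
        hVS.norm.integrable_sq fun t => ?_
      exact pow_le_pow_left₀ (norm_nonneg _) (norm_lowPass_le ha R _) 2
    · rw [smul_smul, lowPassMul_lowPass]
      simp
    · have h := hUV S' ⟨hS'0, hS'T⟩ R
      simp only [map_sub] at h
      exact h
  -- A single t serves all R, since only countably many exceptional null sets occur.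
  obtain ⟨t, ht, htK⟩ := exists_mem_Ioo_of_ae hS.1.le hSS' hall
  have hp : 0 < rlKernel (1 + α) (t - S) := rlKernel_pos (by linarith) (by linarith [ht.1])
  refine ⟨K / rlKernel (1 + α) (t - S), fun R => ?_⟩
  rw [le_div_iff₀ hp, mul_comm, ← integral_const_mul]
  refine le_trans ?_ (htK R)
  have hsq : IntegrableOn (fun t => ‖lowPassMul μ ha ha0 R (U t) - lowPass μ ha R (V t)‖ ^ 2)
    (Ioo 0 S') := (hd R).norm.integrable_sq
  have hint : IntervalIntegrable (fun τ => rlKernel (1 + α) (t - τ) *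
      ‖lowPassMul μ ha ha0 R (U τ) - lowPass μ ha R (V τ)‖ ^ 2) volume 0 t :=
    (intervalIntegrable_of_integrableOn hsq ⟨hS.1.trans ht.1, ht.2⟩).continuousOn_mul
      ((continuous_rlKernel (by linarith)).comp (by fun_prop)).continuousOn
  have hint2 := (intervalIntegrable_iff_integrableOn_Ioo_of_le (hS.1.trans ht.1).le).1 hint
  rw [intervalIntegral.integral_of_le (hS.1.trans ht.1).le, integral_Ioc_eq_integral_Ioo]
  have hsub : Ioo 0 S ⊆ Ioo 0 t := Ioo_subset_Ioo_right ht.1.le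
  refine (setIntegral_mono_on ((hsq.mono_set (Ioo_subset_Ioo_right hSS'.le)).const_mul _)
    (hint2.mono_set hsub) measurableSet_Ioo fun τ hτ => ?_).trans
    (setIntegral_mono_set hint2 ?_ hsub.eventuallyLE)
  · refine mul_le_mul_of_nonneg_right ?_ (sq_nonneg _)
    exact rlKernel_mono (by linarith) (by linarith [ht.1]) (by linarith [hτ.2])
  · filter_upwards [ae_restrict_mem measurableSet_Ioo] with τ hτ
    exact mul_nonneg (rlKernel_nonneg (by linarith) (by linarith [hτ.2])) (sq_nonneg _)

/-- Solutions with initial value in the form domain of `a` lie in `L²` of the domain of `a`, and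
satisfy the equation in `L²`. -/
theorem exists_memLp_ae_eq_mul (hα₀ : 0 < α) (hα₁ : α < 1) (ha : Measurable a)
    (ha0 : ∀ x, 0 ≤ a x) {U V : ℝ → Lp ℂ 2 μ} {U₀ : Lp ℂ 2 μ} (hU : ContinuousOn U (Ico 0 T))
    (hV : ∀ S < T, MemLp V 2 (volume.restrict (Ioo 0 S)))
    (hUV : ∀ S ∈ Ioo 0 T, ∀ R, (fun t => lowPass μ ha R (U t - U₀)) =ᵐ[volume.restrict (Ioo 0 S)]
      causalConv (rlKernel α) (fun t => -Complex.I •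
        (lowPassMul μ ha ha0 R (U t) - lowPass μ ha R (V t))))
    (he : ∫⁻ x, ‖((√(a x) : ℝ) : ℂ) * U₀ x‖ₑ ^ 2 ∂μ ≠ ∞) {S : ℝ} (hS : S ∈ Ioo 0 T) :
    ∃ W : ℝ → Lp ℂ 2 μ, MemLp W 2 (volume.restrict (Ioo 0 S)) ∧
      (∀ᵐ t ∂volume.restrict (Ioo 0 S), W t =ᵐ[μ] fun x => (a x : ℂ) * U t x) ∧
      (fun t => U t - U₀) =ᵐ[volume.restrict (Ioo 0 S)]
        causalConv (rlKernel α) (fun t => -Complex.I • (W t - V t)) := by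
  have hVS := hV S hS.2
  have hUS := hU.memLp_Ioo hS.2 2
  obtain ⟨K, hK⟩ := exists_bound_integral_norm_sq_lowPass hα₀ hα₁ ha ha0 hU hV hUV he hS
  have hAU : ∀ R, MemLp (fun t => lowPassMul μ ha ha0 R (U t)) 2 (volume.restrict (Ioo 0 S)) :=
    fun R => (lowPassMul μ ha ha0 R).comp_memLp' hUS
  have hPV : ∀ R, MemLp (fun t => lowPass μ ha R (V t)) 2 (volume.restrict (Ioo 0 S)) :=
    fun R => (lowPass μ ha R).comp_memLp' hVS
  set K' := 2 * K + 2 * ∫ t in Ioo 0 S, ‖V t‖ ^ 2 with hK'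
  have hK1 : ∀ R, ∫⁻ t in Ioo 0 S, ‖lowPassMul μ ha ha0 R (U t)‖ₑ ^ 2 ≤ ENNReal.ofReal K' := by
    intro R
    have h1 : ∫⁻ t in Ioo 0 S, ‖lowPassMul μ ha ha0 R (U t)‖ₑ ^ 2 =
        ENNReal.ofReal (∫ t in Ioo 0 S, ‖lowPassMul μ ha ha0 R (U t)‖ ^ 2) := by
      rw [ofReal_integral_eq_lintegral_ofReal (hAU R).norm.integrable_sq
        (.of_forall fun t => sq_nonneg _)]
      refine lintegral_congr fun t => ?_
      rw [ENNReal.ofReal_pow (norm_nonneg _), ofReal_norm]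
    rw [h1]
    refine ENNReal.ofReal_le_ofReal ?_
    have h2 : IntegrableOn (fun t => ‖lowPassMul μ ha ha0 R (U t) - lowPass μ ha R (V t)‖ ^ 2)
      (Ioo 0 S) := ((hAU R).sub (hPV R)).norm.integrable_sq
    calc ∫ t in Ioo 0 S, ‖lowPassMul μ ha ha0 R (U t)‖ ^ 2
        ≤ ∫ t in Ioo 0 S, (2 * ‖lowPassMul μ ha ha0 R (U t) - lowPass μ ha R (V t)‖ ^ 2 +
            2 * ‖V t‖ ^ 2) := by
          refine integral_mono (hAU R).norm.integrable_sq
            ((h2.const_mul 2).add (hVS.norm.integrable_sq.const_mul 2)) fun t => ?_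
          have h3 : ‖lowPassMul μ ha ha0 R (U t)‖ ≤
              ‖lowPassMul μ ha ha0 R (U t) - lowPass μ ha R (V t)‖ + ‖V t‖ :=
            (norm_le_norm_sub_add _ _).trans (add_le_add_right (norm_lowPass_le ha R _) _)
          have h4 := pow_le_pow_left₀ (norm_nonneg _) h3 2
          simp only
          nlinarith [sq_nonneg (‖lowPassMul μ ha ha0 R (U t) - lowPass μ ha R (V t)‖ - ‖V t‖)]
      _ = 2 * (∫ t in Ioo 0 S, ‖lowPassMul μ ha ha0 R (U t) - lowPass μ ha R (V t)‖ ^ 2) +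
            2 * ∫ t in Ioo 0 S, ‖V t‖ ^ 2 := by
          rw [integral_add (h2.const_mul 2) (hVS.norm.integrable_sq.const_mul 2),
            integral_const_mul, integral_const_mul]
      _ ≤ K' := by
          rw [hK']
          linarith [hK R]
  have hΦ : LowerSemicontinuous fun f : Lp ℂ 2 μ => ∫⁻ x, ‖(a x : ℂ) * f x‖ₑ ^ 2 ∂μ :=
    lowerSemicontinuous_lintegral (Φ := fun x z => ‖(a x : ℂ) * z‖ₑ ^ 2)
      (by unfold Function.uncurry; fun_prop) fun x => by fun_prop
  have hΦm := hΦ.comp_aemeasurable hUS.1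
  -- Fatou twice, in x and in t, turns the bound uniform in R into one for aU itself.
  have hΦle : ∫⁻ t in Ioo 0 S, ∫⁻ x, ‖(a x : ℂ) * U t x‖ₑ ^ 2 ∂μ ≤ ENNReal.ofReal K' := by
    refine (lintegral_mono fun t => lintegral_le_liminf_enorm_lowPassMul ha ha0 (U t)).trans ?_
    refine (lintegral_liminf_le' fun R => (hAU R).1.enorm.pow_const 2).trans ?_
    exact liminf_le_of_frequently_le' (Frequently.of_forall hK1)
  have hmem : ∀ᵐ t ∂volume.restrict (Ioo 0 S), MemLp (fun x => (a x : ℂ) * U t x) 2 μ := by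
    filter_upwards [ae_lt_top' hΦm (hΦle.trans_lt ENNReal.ofReal_lt_top).ne] with t ht
    refine ⟨(Complex.measurable_ofReal.comp ha).aestronglyMeasurable.mul (Lp.aestronglyMeasurable _), ?_⟩
    rw [eLpNorm_lt_top_iff_lintegral_rpow_enorm_lt_top (by simp) (by simp)]
    simpa using ht
  classical
  set W : ℝ → Lp ℂ 2 μ := fun t => if h : MemLp (fun x => (a x : ℂ) * U t x) 2 μ then h.toLp else 0
    with hW
  have hWa : ∀ᵐ t ∂volume.restrict (Ioo 0 S), W t =ᵐ[μ] fun x => (a x : ℂ) * U t x := by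
    filter_upwards [hmem] with t ht
    simp only [hW, dif_pos ht]
    exact ht.coeFn_toLp
  have hPW : ∀ᵐ t ∂volume.restrict (Ioo 0 S), ∀ R,
      lowPass μ ha R (W t) = lowPassMul μ ha ha0 R (U t) := by
    filter_upwards [hWa] with t ht R
    exact lowPass_eq_lowPassMul_of_ae_eq ha ha0 ht R
  -- W is chosen time by time; its measurability comes from being the a.e. limit of the measurable
  -- truncations.
  have hWm : AEStronglyMeasurable W (volume.restrict (Ioo 0 S)) := by
    refine aestronglyMeasurable_of_tendsto_ae atTop (fun R => (hAU R).1) ?_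
    filter_upwards [hPW] with t ht
    simpa only [ht] using tendsto_lowPass ha (W t)
  have hW2 : MemLp W 2 (volume.restrict (Ioo 0 S)) := by
    refine ⟨hWm, ?_⟩
    rw [eLpNorm_lt_top_iff_lintegral_rpow_enorm_lt_top (by simp) (by simp)]
    refine lt_of_eq_of_lt (lintegral_congr_ae ?_) (hΦle.trans_lt ENNReal.ofReal_lt_top)
    filter_upwards [hWa] with t ht
    simp only [ENNReal.toReal_ofNat, ENNReal.rpow_ofNat]
    rw [enorm_sq_eq_lintegral]
    exact lintegral_congr_ae (ht.mono fun x hx => by simp only [hx])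
  refine ⟨W, hW2, hWa, ?_⟩
  have hdi : IntegrableOn (fun t => -Complex.I • (W t - V t)) (Ioo 0 S) :=
    (((hW2.sub hVS).const_smul (-Complex.I)).integrable (by norm_num) :)
  have hall : ∀ᵐ t ∂volume.restrict (Ioo 0 S), ∀ R, lowPass μ ha R (U t - U₀) =
      lowPass μ ha R (causalConv (rlKernel α) (fun t => -Complex.I • (W t - V t)) t) := by
    rw [ae_all_iff]
    intro R
    filter_upwards [hUV S hS R, ae_intervalIntegrable_causalConv (integrableOn_rlKernel hα₀ S) hdi,
      ae_restrict_mem measurableSet_Ioo] with t h1 h2 ht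
    rw [h1]
    refine Eq.trans ?_ (causalConv_clm ((lowPass μ ha R).restrictScalars ℝ) h2)
    refine causalConv_congr_ae ht _ ?_
    filter_upwards [hPW] with s hs
    simp [hs R]
  filter_upwards [hall] with t ht
  have h1 := tendsto_lowPass ha (U t - U₀)
  simp only [ht] at h1
  exact tendsto_nhds_unique h1 (tendsto_lowPass ha _)

end Regularity

/-! ### Part (b): the energy bound. -/

section EnergyBound

open Filter Topology

variable {n : ℕ} {α β T : ℝ} {F : ℂ → ℂ} {G : ℂ → ℝ} {u₀ : L2 n} {u : ℝ → L2 n}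

theorem ofReal_half_mul_eq {r : ℝ} (hr : 0 ≤ r) (z : ℂ) :
    ENNReal.ofReal (1 / 2 * (r * ‖z‖ ^ 2)) = ENNReal.ofReal (1 / 2) * ‖((√r : ℝ) : ℂ) * z‖ₑ ^ 2 := by
  rw [ENNReal.ofReal_mul (by norm_num), ← ofReal_norm, norm_mul, Complex.norm_real,
    Real.norm_of_nonneg (Real.sqrt_nonneg _), ← ENNReal.ofReal_pow (by positivity), mul_pow,
    Real.sq_sqrt hr]

theorem half_mul_norm_sq_sub_le {r : ℝ} (hr : 0 ≤ r) (z w : ℂ) :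
    1 / 2 * (r * ‖z‖ ^ 2) - 1 / 2 * (r * ‖w‖ ^ 2) ≤ (inner ℂ ((r : ℂ) * z) (z - w)).re := by
  have h1 := mul_le_mul_of_nonneg_left (half_norm_sq_sub_le z w) hr
  rw [← smul_eq_mul (r : ℂ), inner_smul_left, Complex.conj_ofReal, Complex.re_ofReal_mul]
  linarith

/-- Decay of the energy weighted so that the equation is its fractional Hamiltonian flow. -/
theorem weighted_energy_le_of_isWeakSolution (hα₀ : 0 < α) (hα₁ : α < 1) (hG : Continuous G)
    (hG0 : ∀ z, 0 ≤ G z) {C : ℝ} (hC : 0 < C)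
    (hFG : ∀ a b : ℂ, C * G a - C * G b ≤ (-(F a * (starRingEnd ℂ) (a - b))).re)
    (hsol : IsWeakSolution α β F 2 T u₀ u) (hE0 : energy β G u₀ ≠ ∞) :
    ∀ t ∈ Ico 0 T,
      ENNReal.ofReal (1 / 2) * fracLaplaceNormSq (β / 2) (u t) +
        ENNReal.ofReal C * potentialEnergy G (u t) ≤
      ENNReal.ofReal (1 / 2) * fracLaplaceNormSq (β / 2) u₀ +
        ENNReal.ofReal C * potentialEnergy G u₀ := by
  intro t ht
  rcases ht.1.eq_or_lt with h0 | h0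
  · rw [← h0, hsol.initial]
  obtain ⟨hcont, hu0, N, hNF, hN, heq⟩ := hsol
  obtain ⟨S, htS, hST⟩ := exists_between ht.2
  have hS : S ∈ Ioo 0 T := ⟨h0.trans htS, hST⟩
  have ha := measurable_fracLaplaceSymbol (n := n) β
  have ha0 := fracLaplaceSymbol_nonneg (n := n) β
  set a := fracLaplaceSymbol (n := n) β with ha_def
  set L : L2 n →L[ℂ] L2 n :=
    ((Lp.fourierTransformₗᵢ (EuclideanSpace ℝ (Fin n)) ℂ).toContinuousLinearEquiv : L2 n →L[ℂ] L2 n)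
  set U : ℝ → L2 n := fun t => 𝓕 (u t) with hUdef
  set V : ℝ → L2 n := fun t => 𝓕 (N t) with hVdef
  have hUc : ContinuousOn U (Ico 0 T) := continuous_fourier.comp_continuousOn hcont
  have hV : ∀ S < T, MemLp V 2 (volume.restrict (Ioo 0 S)) := fun S hS => L.comp_memLp' (hN S hS)
  -- The factor 1/2 makes aU the gradient of the quadratic part, and C makes -F a subgradient of the
  -- potential part. With these weights the sum has subgradient W - V.
  set θ₁ : EuclideanSpace ℝ (Fin n) → ℂ → ℝ := fun ξ z => 1 / 2 * (a ξ * ‖z‖ ^ 2) with hθ₁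
  set θ₂ : EuclideanSpace ℝ (Fin n) → ℂ → ℝ := fun _ z => C * G z with hθ₂
  have hθ₁m : Measurable (Function.uncurry θ₁) := by unfold Function.uncurry; fun_prop
  have hθ₂m : Measurable (Function.uncurry θ₂) := by
    have := hG.measurable
    unfold Function.uncurry
    fun_prop
  have hθ₁0 : ∀ ξ z, 0 ≤ θ₁ ξ z := fun ξ z => by have := ha0 ξ; positivity
  have hθ₂0 : ∀ ξ z, 0 ≤ θ₂ ξ z := fun ξ z => mul_nonneg hC.le (hG0 z)
  set E₁ : L2 n → ℝ≥0∞ := fun f => ∫⁻ ξ, ENNReal.ofReal (θ₁ ξ (f ξ)) with hE₁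
  set E₂ : L2 n → ℝ≥0∞ := fun f => ∫⁻ ξ, ENNReal.ofReal (θ₂ ξ (f ξ)) with hE₂
  have hE₁_eq : ∀ f : L2 n, E₁ (𝓕 f) = ENNReal.ofReal (1 / 2) * fracLaplaceNormSq (β / 2) f := by
    intro f
    rw [fracLaplaceNormSq, ← lintegral_const_mul' _ _ ENNReal.ofReal_ne_top]
    refine lintegral_congr fun ξ => ?_
    rw [fracLaplaceSymbol_half]
    exact ofReal_half_mul_eq (ha0 ξ) _
  have hE₂_eq : ∀ f : L2 n, E₂ f = ENNReal.ofReal C * potentialEnergy G f := by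
    intro f
    rw [potentialEnergy, ← lintegral_const_mul' _ _ ENNReal.ofReal_ne_top]
    exact lintegral_congr fun ξ => ENNReal.ofReal_mul hC.le
  have hE₁c : LowerSemicontinuous E₁ :=
    lowerSemicontinuous_lintegral (Φ := fun ξ z => ENNReal.ofReal (θ₁ ξ z))
      hθ₁m.ennreal_ofReal fun ξ => ENNReal.continuous_ofReal.comp (by fun_prop)
  have hE₂c : LowerSemicontinuous E₂ :=
    lowerSemicontinuous_lintegral (Φ := fun ξ z => ENNReal.ofReal (θ₂ ξ z))
      hθ₂m.ennreal_ofReal fun ξ => ENNReal.continuous_ofReal.comp (by fun_prop)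
  have hEc : LowerSemicontinuous fun f : L2 n => E₁ f + E₂ (𝓕⁻ f) :=
    hE₁c.add (hE₂c.comp continuous_fourierInv)
  have hinv : ∀ f : L2 n, 𝓕⁻ (𝓕 f : L2 n) = f := fun f => FourierTransform.fourierInv_fourier_eq f
  have hinv' : ∀ f : L2 n, 𝓕 (𝓕⁻ f : L2 n) = f := fun f => FourierTransform.fourier_fourierInv_eq f
  have hfin : fracLaplaceNormSq (β / 2) u₀ ≠ ∞ ∧ potentialEnergy G u₀ ≠ ∞ := ENNReal.add_ne_top.1 hE0
  have hE0' : E₁ (𝓕 u₀) + E₂ (𝓕⁻ (𝓕 u₀ : L2 n)) ≠ ∞ := by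
    rw [hinv, hE₁_eq, hE₂_eq]
    exact ENNReal.add_ne_top.2 ⟨ENNReal.mul_ne_top ENNReal.ofReal_ne_top hfin.1,
      ENNReal.mul_ne_top ENNReal.ofReal_ne_top hfin.2⟩
  have he : ∫⁻ ξ, ‖((√(a ξ) : ℝ) : ℂ) * (𝓕 u₀ : L2 n) ξ‖ₑ ^ 2 ≠ ∞ := by
    simpa only [fracLaplaceNormSq, fracLaplaceSymbol_half] using hfin.1
  obtain ⟨W, hW, hWa, hv⟩ := exists_memLp_ae_eq_mul hα₀ hα₁ ha ha0 hUc hV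
    (fun S hS R => lowPass_sub_ae_eq_causalConv hα₀ hα₁ (by norm_num) hcont hu0 hN heq ha ha0 hS R)
    he hS
  have hξ : MemLp (fun t => W t - V t) 2 (volume.restrict (Ioo 0 S)) := hW.sub (hV S hST)
  have key := le_of_re_inner_eq_zero hα₀ hα₁ hS.1 hST hEc hUc hξ (hξ.const_smul (-Complex.I)) hv hE0'
    ?_ ?_ t ⟨h0, htS⟩
  · simpa only [hUdef, hinv, hE₁_eq, hE₂_eq] using key
  · filter_upwards [hWa, ae_restrict_of_ae hNF, ae_restrict_mem measurableSet_Ioo] with s h1 h2 hs w hw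
    obtain ⟨hw1, hw2⟩ := ENNReal.add_ne_top.1 hw
    have k1 := toReal_lintegral_sub_le_re_inner hθ₁m hθ₁0 (f := U s) (g := w) (p := W s) (by
      filter_upwards [h1] with ξ hξ
      rw [hξ]
      exact half_mul_norm_sq_sub_le (ha0 ξ) _ _) hw1
    have k2 := toReal_lintegral_sub_le_re_inner hθ₂m hθ₂0 (f := u s) (g := 𝓕⁻ w) (p := -N s) (by
      filter_upwards [h2 ⟨hs.1, hs.2.trans hST⟩, Lp.coeFn_neg (N s)] with x hx hx2
      rw [hx2, Pi.neg_apply, hx]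
      refine (hFG (u s x) ((𝓕⁻ w : L2 n) x)).trans_eq ?_
      rw [inner_neg_left, RCLike.inner_apply, Complex.neg_re, Complex.neg_re, Complex.mul_re,
        Complex.mul_re, Complex.conj_re, Complex.conj_re, Complex.conj_im, Complex.conj_im]
      ring) hw2
    -- The potential energy lives in physical space and the kinetic energy in frequency space;
    -- Plancherel brings both subgradient inequalities to the same side.
    have k3 : inner ℂ (-N s) (u s - 𝓕⁻ w) = -inner ℂ (V s) (U s - w) := by
      rw [inner_neg_left, ← Lp.inner_fourier_eq,
        show (𝓕 (u s - 𝓕⁻ w) : L2 n) = 𝓕 (u s) - 𝓕 (𝓕⁻ w : L2 n) from L.map_sub _ _, hinv']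
    have k4 : E₁ (U s) + E₂ (𝓕⁻ (U s)) = E₁ (U s) + E₂ (u s) := by rw [hUdef, hinv]
    rw [k4]
    refine ⟨ENNReal.add_ne_top.2 ⟨k1.1, k2.1⟩, ?_⟩
    rw [ENNReal.toReal_add k1.1 k2.1, ENNReal.toReal_add hw1 hw2, inner_sub_left, Complex.sub_re]
    have k5 := k2.2
    rw [k3, Complex.neg_re] at k5
    linarith [k1.2]
  -- Here d = -iξ, and ⟨ξ, -iξ⟩ = -i‖ξ‖² is purely imaginary.
  · intro s
    change (inner ℂ (W s - V s) (-Complex.I • (W s - V s))).re = 0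
    rw [inner_smul_right]
    have : (inner ℂ (W s - V s) (W s - V s)).im = 0 := inner_self_im (𝕜 := ℂ) _
    generalize inner ℂ (W s - V s) (W s - V s) = z at this
    simp [this]

theorem exists_energy_le (hα₀ : 0 < α) (hα₁ : α < 1) (hG : Continuous G)
    (hG0 : ∀ z, 0 ≤ G z) (h : EnergyHypothesis α F G) :
    ∃ K : ℝ≥0, 0 < K ∧ ∀ (T : ℝ) (u₀ : L2 n) (u : ℝ → L2 n), IsWeakSolution α β F 2 T u₀ u →
      ∀ t ∈ Ico 0 T, energy β G (u t) ≤ K * energy β G u₀ := by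
  obtain ⟨C, hC, hFG⟩ := h.exists_re_mul_conj_sub_le hα₀ hα₁ hG
  -- The weighted energy lies between m and M times the unweighted one, hence K = M/m, which depends
  -- only on C.
  set m : ℝ := min (1 / 2) C with hm
  have hm0 : 0 < m := lt_min (by norm_num) hC
  set M : ℝ := max (1 / 2) C with hM
  have hM0 : 0 < M := hC.trans_le (le_max_right _ _)
  refine ⟨(M / m).toNNReal, Real.toNNReal_pos.2 (div_pos hM0 hm0), fun T u₀ u hsol t ht => ?_⟩
  change _ ≤ ENNReal.ofReal (M / m) * _
  by_cases hE0 : energy β G u₀ = ∞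
  · rw [hE0, ENNReal.mul_top (ENNReal.ofReal_pos.2 (div_pos hM0 hm0)).ne']
    exact le_top
  have key := weighted_energy_le_of_isWeakSolution hα₀ hα₁ hG hG0 hC hFG hsol hE0 t ht
  have hmne : ENNReal.ofReal m ≠ 0 := (ENNReal.ofReal_pos.2 hm0).ne'
  rw [ENNReal.ofReal_div_of_pos hm0, ENNReal.mul_comm_div, ← mul_div_assoc,
    ENNReal.le_div_iff_mul_le (.inl hmne) (.inl ENNReal.ofReal_ne_top), mul_comm]
  unfold energy
  calc ENNReal.ofReal m * (fracLaplaceNormSq (β / 2) (u t) + potentialEnergy G (u t))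
      ≤ ENNReal.ofReal (1 / 2) * fracLaplaceNormSq (β / 2) (u t) +
        ENNReal.ofReal C * potentialEnergy G (u t) := by
        rw [mul_add]
        gcongr
        · exact min_le_left _ _
        · exact min_le_right _ _
    _ ≤ _ := key
    _ ≤ ENNReal.ofReal M * (fracLaplaceNormSq (β / 2) u₀ + potentialEnergy G u₀) := by
        rw [mul_add]
        gcongr
        · exact le_max_left _ _
        · exact le_max_right _ _

end EnergyBound

theorem mainTheorem9 (n : ℕ) (α β : ℝ) (hα₀ : 0 < α) (hα₁ : α < 1) (hβ : 0 < β) (F : ℂ → ℂ) :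
    ((∀ z : ℂ, ((starRingEnd ℂ) z * F z).im = 0) →
      ∀ (T : ℝ) (u₀ : L2 n) (u : ℝ → L2 n), IsWeakSolution α β F 1 T u₀ u →
        ∀ t ∈ Ico 0 T, ‖u t‖ ≤ ‖u₀‖) ∧
    (∀ G : ℂ → ℝ, Continuous G → (∀ z, 0 ≤ G z) → EnergyHypothesis α F G →
      ∃ K : ℝ≥0, 0 < K ∧
        ∀ (T : ℝ) (u₀ : L2 n) (u : ℝ → L2 n),
          TemperedDistribution.MemSobolev (β / 2) 2 (u₀ : 𝓢'(EuclideanSpace ℝ (Fin n), ℂ)) →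
          potentialEnergy G u₀ < ∞ →
          IsWeakSolution α β F 2 T u₀ u →
          ∀ t ∈ Ico 0 T, energy β G (u t) ≤ K * energy β G u₀) := by
  refine ⟨fun hF T u₀ u hsol => norm_le_of_isWeakSolution hα₀ hα₁ hF hsol, fun G hG hG0 hE => ?_⟩
  obtain ⟨K, hK, h⟩ := exists_energy_le (n := n) (β := β) hα₀ hα₁ hG hG0 hE
  exact ⟨K, hK, fun T u₀ u _ _ hsol => h T u₀ u hsol⟩
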